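/- Let $f\in C^\infty(\mathbb{R})$ be real-valued, let $\varepsilon>0$, and let $\psi:\mathbb{R}\to\mathbb{C}$ be one of the following Fourier symbols: (a) $\psi(\xi)=(i\xi)^{\alpha+1}$ (principal branch) with $0<\alpha<1$, the symbol of $\partial_x\mathcal{D}^\alpha$, where $\mathcal{D}^\alpha[g](x)=\frac{1}{\Gamma(1-\alpha)}\int_{-\infty}^x\frac{g'(z)}{(x-z)^\alpha}\,dz$; (b) $\psi(\xi)=-|\xi|^\beta\exp\left[i\,\mathrm{sign}(\xi)\,\gamma\frac{\pi}{2}\right]$ with $1<\beta\le 2$ and $|\gamma|\le\min\{\beta,2-\beta\}$, the symbol of the Riesz–Feller operator of order $\beta$ and skewness $\gamma$. Let $K^\varepsilon(t,x)=\frac{1}{2\pi}\int_{\mathbb{R}}e^{i\xi x}e^{\varepsilon t\psi(\xi)}\,d\xi$ for $t>0$, $x\in\mathbb{R}$. For $u_0\in L^\infty(\mathbb{R})$, a mild solution of $$\partial_t u+\partial_x f(u)=\varepsilon L[u],\qquad u(0,\cdot)=u_0,$$ where $L$ is the Fourier multiplier operator with symbol $\psi$, is a function $u\in L^\infty((0,\infty)\times\mathbb{R})$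 such that, for a.e. $(t,x)\in(0,\infty)\times\mathbb{R}$, $$u(t,x)=\big(K^\varepsilon(t,\cdot)*u_0\big)(x)-\int_0^t\big(\partial_xK^\varepsilon(t-s,\cdot)*f(u(s,\cdot))\big)(x)\,ds.$$ Let $u_0,v_0\in L^\infty(\mathbb{R})$ with $u_0-v_0\in L^1(\mathbb{R})$, and let $u^\varepsilon,v^\varepsilon$ be mild solutions with initial data $u_0$ and $v_0$, respectively. Then $u^\varepsilon$ and $v^\varepsilon$ have continuous representatives on $(0,\infty)\times\mathbb{R}$ and, for these representatives and for every $t>0$, $u^\varepsilon(t,\cdot)-v^\varepsilon(t,\cdot)\in L^1(\mathbb{R})$ and $$\|u^\varepsilon(t,\cdot)-v^\varepsilon(t,\cdot)\|_1\le\|u_0-v_0\|_1.$$ In particular mild solutions are unique: if $u_0=v_0$ a.e. in $\mathbb{R}$, then $u^\varepsilon=v^\varepsilon$ a.e. in $(0,\infty)\times\mathbb{R}$. -/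

import Mathlib

open MeasureTheory Set
open scoped ContDiff

noncomputable section

namespace NonlocalConservationLaw

/-- The Fourier symbol `(iξ)^(α+1)` (principal branch) of the operator `∂ₓ 𝒟^α`, where
`𝒟^α[g](x) = Γ(1-α)⁻¹ ∫_{-∞}^x g'(z) (x-z)^(-α) dz`. -/
def caputoSymbol (α : ℝ) (ξ : ℝ) : ℂ :=
  (Complex.I * (ξ : ℂ)) ^ ((α : ℂ) + 1)

/-- The symbol `-|ξ|^β exp(i sign(ξ) γ π/2)` of the Riesz–Feller operator of order `β` and
skewness `γ`. -/
def rieszFellerSymbol (β γ : ℝ) (ξ : ℝ) : ℂ :=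
  -(((|ξ| ^ β : ℝ) : ℂ) * Complex.exp (Complex.I * ((Real.sign ξ * γ * (Real.pi / 2) : ℝ) : ℂ)))

/-- The convolution kernel `K(t, x) = (2π)⁻¹ ∫ exp(iξx) exp(t ψ(ξ)) dξ` of the semigroup generated
by the Fourier multiplier operator with symbol `ψ`. It is used for symbols with
`ψ(-ξ) = conj (ψ(ξ))`, for which the integral is real. -/
def kernel (ψ : ℝ → ℂ) (t x : ℝ) : ℝ :=
  (((2 * Real.pi : ℝ) : ℂ)⁻¹ *
    ∫ ξ : ℝ, Complex.exp (Complex.I * (ξ : ℂ) * (x : ℂ)) * Complex.exp ((t : ℂ) * ψ ξ)).re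

/-- The right-hand side of Duhamel's formula,
`K(t,·) * u₀ (x) - ∫₀ᵗ ∂ₓK(t-s,·) * f(u(s,·)) (x) ds`. -/
def duhamel (ψ : ℝ → ℂ) (f u₀ : ℝ → ℝ) (u : ℝ → ℝ → ℝ) (t x : ℝ) : ℝ :=
  (∫ y : ℝ, kernel ψ t (x - y) * u₀ y) -
    ∫ s in (0 : ℝ)..t, ∫ y : ℝ, deriv (fun z : ℝ => kernel ψ (t - s) z) (x - y) * f (u s y)

/-- Lebesgue measure on `(0,∞) × ℝ`. -/
def halfPlaneMeasure : Measure (ℝ × ℝ) :=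
  volume.restrict (Ioi (0 : ℝ) ×ˢ (univ : Set ℝ))

/-- `u` is a mild solution on `(0,∞) × ℝ` of `∂ₜu + ∂ₓ f(u) = L[u]`, `u(0,·) = u₀`, where `L` is
the Fourier multiplier operator with symbol `ψ`: it lies in `L^∞((0,∞) × ℝ)` and satisfies
Duhamel's formula almost everywhere. -/
structure IsMildSolution (ψ : ℝ → ℂ) (f u₀ : ℝ → ℝ) (u : ℝ → ℝ → ℝ) : Prop where
  memLp_top : MemLp (fun p : ℝ × ℝ => u p.1 p.2) ⊤ halfPlaneMeasure
  duhamel_eq : ∀ᵐ p : ℝ × ℝ ∂halfPlaneMeasure, u p.1 p.2 = duhamel ψ f u₀ u p.1 p.2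

/-- `U` is a continuous representative on `(0,∞) × ℝ` of the class of `u`. -/
structure IsContinuousRepresentative (U u : ℝ → ℝ → ℝ) : Prop where
  continuousOn : ContinuousOn (fun p : ℝ × ℝ => U p.1 p.2) (Ioi (0 : ℝ) ×ˢ (univ : Set ℝ))
  ae_eq : ∀ᵐ p : ℝ × ℝ ∂halfPlaneMeasure, U p.1 p.2 = u p.1 p.2

end NonlocalConservationLaw

end

open Filter Topology

noncomputable section

/-! Both symbols are exponents of stable laws of index `β ∈ (1, 2]`, so the kernel `K(t, ·)` is a
self-similar probability density with the semigroup property, and the `L¹` norm of `∂ₓK(t, ·)` is a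
multiple of `t^(-1/β)`, integrable at `t = 0`. Positivity is the delicate point. A shifted
Grünwald–Letnikov formula exhibits `(iξ)^β` as a limit of compound Poisson exponents, and a
Riesz–Feller symbol is a combination of `(iξ)^β` and `(-iξ)^β` with nonnegative coefficients; the
symbol in case (a) is a Riesz–Feller symbol of extremal skewness. All this is collected in
`IsStableKernel`.

For two mild solutions put `g = (f(u) - f(v)) / (u - v)`, a measurable function bounded by a
Lipschitz constant `L` of `f`. Then `W = exp(-λt)(u - v)` solves a linear transport-diffusion
equation with velocity `g`, written as the fixed point equation `W = k * w₀ - ∂ₓk * (gW)` with `k =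
exp(-λt) K`. For large `λ` one has `L ‖∂ₓk‖₁ ≤ 1/2`; hence the Picard iterates converge both in `L¹`
and uniformly, and `W` is integrable (`integrable_of_bounded_fixedPoint`).

This alone does not give the constant `1`, and `g` has no regularity for an entropy argument.
Instead, transport is replaced by jumps: mass at `q` jumps by `τ g(q)` in space at rate `μ = 1/τ`.
Jumps preserve mass and sign. With the loss term absorbed into the kernel the regularized equation
reads `Z = k' * w₀ + μ k' * (jumped Z)`, `k' = exp(-(λ+μ)t) K`, and every iterate started at `0` has
slice norm at most `exp(-λt) ‖w₀‖₁` (`exists_regularized_solution`). By a first-order Taylor formula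
in `L¹` the jump operator approximates `-∂ₓk * (gZ)` with an error that vanishes as `τ → 0`,
uniformly in the measurable field `g` (`lintegral_sub_regularized_le`). So `Z → W` in `L¹`, and
Fatou's lemma transfers the slice bound to `W` (`ae_lintegral_slice_le`).

The right-hand side of Duhamel's formula is continuous for `t > 0` and serves as the representative;
a second use of Fatou's lemma extends the estimate from almost every time to every time. Uniqueness
is the case `‖u₀ - v₀‖₁ = 0`. -/

namespace NonlocalConservationLaw

/-! ### Oscillatory integrals on the half-line and their decay. -/

section HalfLine

lemma norm_exp_I_mul_mul (ξ x : ℝ) : ‖Complex.exp (Complex.I * ξ * x)‖ = 1 := by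
  rw [show Complex.I * ξ * x = ((ξ * x : ℝ) : ℂ) * Complex.I by push_cast; ring]
  exact Complex.norm_exp_ofReal_mul_I _

/-- Integration by parts on the half-line against `exp(iξx)`. -/
lemma integral_Ioi_exp_mul_eq {Φ Φ' : ℝ → ℂ} {a : ℂ} (x : ℝ)
    (hd : ∀ ξ ∈ Ioi (0 : ℝ), HasDerivAt Φ (Φ' ξ) ξ)
    (hi : IntegrableOn Φ (Ioi 0)) (hi' : IntegrableOn Φ' (Ioi 0))
    (ha : Tendsto Φ (𝓝[>] 0) (𝓝 a)) :
    Complex.I * x * ∫ ξ in Ioi (0 : ℝ), Complex.exp (Complex.I * ξ * x) * Φ ξ =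
      -a - ∫ ξ in Ioi (0 : ℝ), Complex.exp (Complex.I * ξ * x) * Φ' ξ := by
  have hnorm := fun ξ => norm_exp_I_mul_mul ξ x
  have hcont : Continuous fun ξ : ℝ => Complex.exp (Complex.I * ξ * x) := by fun_prop
  have hInt : ∀ {Ψ : ℝ → ℂ}, IntegrableOn Ψ (Ioi 0) →
      IntegrableOn (fun ξ : ℝ => Complex.exp (Complex.I * ξ * x) * Ψ ξ) (Ioi 0) := fun h =>
    Integrable.bdd_mul (c := 1) h hcont.aestronglyMeasurable (ae_of_all _ fun ξ => (hnorm ξ).le)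
  have hexp : ∀ ξ : ℝ, HasDerivAt (fun ξ : ℝ => Complex.exp (Complex.I * ξ * x))
      (Complex.I * x * Complex.exp (Complex.I * ξ * x)) ξ := fun ξ => by
    have := (((hasDerivAt_id (ξ : ℂ)).const_mul Complex.I).mul_const (x : ℂ)).cexp.comp_ofReal
    exact this.congr_deriv (by simp only [id]; ring)
  have h0 : Tendsto ((fun ξ : ℝ => Complex.exp (Complex.I * ξ * x)) * Φ) (𝓝[>] 0) (𝓝 a) := by
    have := (hcont.tendsto 0).mono_left (nhdsWithin_le_nhds (s := Ioi (0 : ℝ)))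
    refine Tendsto.congr (fun _ => rfl) (f₁ := fun ξ : ℝ => Complex.exp (Complex.I * ξ * x) * Φ ξ) ?_
    simpa using this.mul ha
  have hinf : Tendsto ((fun ξ : ℝ => Complex.exp (Complex.I * ξ * x)) * Φ) atTop (𝓝 0) := by
    have := tendsto_zero_of_hasDerivAt_of_integrableOn_Ioi hd hi' hi
    rw [tendsto_zero_iff_norm_tendsto_zero] at this ⊢
    refine this.congr fun ξ => ?_
    simp [hnorm]
  have huv : IntegrableOn ((fun ξ : ℝ => Complex.I * x * Complex.exp (Complex.I * ξ * x)) * Φ +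
      (fun ξ : ℝ => Complex.exp (Complex.I * ξ * x)) * Φ') (Ioi 0) := by
    refine Integrable.add ?_ (hInt hi')
    refine ((hInt hi).const_mul (Complex.I * x)).congr (ae_of_all _ fun ξ => ?_)
    simp [mul_assoc]
  have := integral_Ioi_deriv_mul_eq_sub (fun ξ _ => hexp ξ) hd huv h0 hinf
  rw [integral_add (((hInt hi).const_mul (Complex.I * x)).congr (ae_of_all _ fun ξ => by
    simp [mul_assoc])) (hInt hi')] at this
  simp_rw [mul_assoc (Complex.I * (x : ℂ))] at this
  rw [integral_const_mul] at this
  linear_combination this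

/-- Second-order decay of oscillatory integrals on the half-line. -/
lemma norm_integral_Ioi_exp_mul_sub_le {Φ Φ' Φ'' : ℝ → ℂ} {a b : ℂ} {x : ℝ} (hx : x ≠ 0)
    (hd : ∀ ξ ∈ Ioi (0 : ℝ), HasDerivAt Φ (Φ' ξ) ξ)
    (hd' : ∀ ξ ∈ Ioi (0 : ℝ), HasDerivAt Φ' (Φ'' ξ) ξ)
    (hi : IntegrableOn Φ (Ioi 0)) (hi' : IntegrableOn Φ' (Ioi 0)) (hi'' : IntegrableOn Φ'' (Ioi 0))
    (ha : Tendsto Φ (𝓝[>] 0) (𝓝 a)) (hb : Tendsto Φ' (𝓝[>] 0) (𝓝 b)) :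
    ‖(∫ ξ in Ioi (0 : ℝ), Complex.exp (Complex.I * ξ * x) * Φ ξ) - Complex.I * a / x‖ ≤
      (‖b‖ + ∫ ξ in Ioi (0 : ℝ), ‖Φ'' ξ‖) / x ^ 2 := by
  have h1 := integral_Ioi_exp_mul_eq x hd hi hi' ha
  have h2 := integral_Ioi_exp_mul_eq x hd' hi' hi'' hb
  have hx' : (x : ℂ) ≠ 0 := by exact_mod_cast hx
  set A := ∫ ξ in Ioi (0 : ℝ), Complex.exp (Complex.I * ξ * x) * Φ ξ
  set B := ∫ ξ in Ioi (0 : ℝ), Complex.exp (Complex.I * ξ * x) * Φ' ξ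
  set D := ∫ ξ in Ioi (0 : ℝ), Complex.exp (Complex.I * ξ * x) * Φ'' ξ with hD
  have key : A - Complex.I * a / x = -(b + D) / x ^ 2 := by
    field_simp
    linear_combination (-Complex.I * x) * h1 + h2 + A * x ^ 2 * Complex.I_sq
  rw [key, norm_div, norm_neg, norm_pow, Complex.norm_real, Real.norm_eq_abs, sq_abs]
  gcongr
  refine (norm_add_le _ _).trans ?_
  gcongr
  refine (norm_integral_le_integral_norm _).trans (le_of_eq ?_)
  refine integral_congr_ae (ae_of_all _ fun ξ => ?_)
  simp [norm_exp_I_mul_mul]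

/-- The function `ξ ↦ ξ^s exp(-c ξ^β)` on the half-line. -/
def powExp (c : ℂ) (β s ξ : ℝ) : ℂ :=
  ((ξ ^ s : ℝ) : ℂ) * Complex.exp (-c * ((ξ ^ β : ℝ) : ℂ))

variable {c : ℂ} {β s : ℝ}

lemma norm_powExp {ξ : ℝ} (hξ : 0 < ξ) :
    ‖powExp c β s ξ‖ = ξ ^ s * Real.exp (-c.re * ξ ^ β) := by
  rw [powExp, norm_mul, Complex.norm_exp, Complex.norm_real, Real.norm_eq_abs,
    abs_of_nonneg (by positivity)]
  simp

lemma hasDerivAt_powExp {ξ : ℝ} (hξ : 0 < ξ) :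
    HasDerivAt (powExp c β s)
      (s * powExp c β (s - 1) ξ - c * β * powExp c β (s + (β - 1)) ξ) ξ := by
  have h1 : HasDerivAt (fun ξ : ℝ => ((ξ ^ s : ℝ) : ℂ)) ((s * ξ ^ (s - 1) : ℝ) : ℂ) ξ :=
    (Real.hasDerivAt_rpow_const (Or.inl hξ.ne')).ofReal_comp
  have h2 : HasDerivAt (fun ξ : ℝ => ((ξ ^ β : ℝ) : ℂ)) ((β * ξ ^ (β - 1) : ℝ) : ℂ) ξ :=
    (Real.hasDerivAt_rpow_const (Or.inl hξ.ne')).ofReal_comp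
  refine (h1.mul (h2.const_mul (-c)).cexp).congr_deriv ?_
  simp only [powExp]
  rw [Real.rpow_add hξ]
  push_cast
  ring

lemma continuousOn_powExp : ContinuousOn (powExp c β s) (Ioi 0) := fun _ hξ =>
  (hasDerivAt_powExp hξ).continuousAt.continuousWithinAt

lemma integrableOn_powExp (hc : 0 < c.re) (hβ : 0 < β) (hs : -1 < s) :
    IntegrableOn (powExp c β s) (Ioi 0) := by
  refine Integrable.mono' (integrableOn_rpow_mul_exp_neg_mul_rpow hs hβ hc)
    (continuousOn_powExp.aestronglyMeasurable measurableSet_Ioi) ?_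
  filter_upwards [ae_restrict_mem measurableSet_Ioi] with ξ hξ
  exact (norm_powExp hξ).le

lemma tendsto_powExp_zero (hβ : 0 < β) (hs : 0 ≤ s) :
    Tendsto (powExp c β s) (𝓝[>] 0) (𝓝 (((0 : ℝ) ^ s : ℝ) : ℂ)) := by
  have h1 : Continuous (powExp c β s) := by
    unfold powExp
    have := Real.continuous_rpow_const hs
    have := Real.continuous_rpow_const hβ.le
    fun_prop
  have := (h1.tendsto 0).mono_left (nhdsWithin_le_nhds (s := Ioi (0 : ℝ)))
  simpa [powExp, Real.zero_rpow hβ.ne'] using this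

/-- The oscillatory integral `∫₀^∞ exp(iξx) ξ^s exp(-c ξ^β) dξ`. -/
def oscInt (c : ℂ) (β s x : ℝ) : ℂ :=
  ∫ ξ in Ioi (0 : ℝ), Complex.exp (Complex.I * ξ * x) * powExp c β s ξ

lemma norm_oscInt_le (x : ℝ) :
    ‖oscInt c β s x‖ ≤ ∫ ξ in Ioi (0 : ℝ), ‖powExp c β s ξ‖ := by
  refine (norm_integral_le_integral_norm _).trans (le_of_eq ?_)
  refine integral_congr_ae (ae_of_all _ fun ξ => ?_)
  simp [norm_exp_I_mul_mul]

lemma continuous_oscInt (hc : 0 < c.re) (hβ : 0 < β) (hs : -1 < s) :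
    Continuous (oscInt c β s) := by
  refine continuous_of_dominated (bound := fun ξ => ‖powExp c β s ξ‖) (fun x => ?_) (fun x => ?_)
    (integrableOn_powExp hc hβ hs).norm (ae_of_all _ fun ξ => by fun_prop)
  · exact (Continuous.aestronglyMeasurable (by fun_prop)).mul
      (integrableOn_powExp hc hβ hs).aestronglyMeasurable
  · exact ae_of_all _ fun ξ => by simp [norm_exp_I_mul_mul]

lemma hasDerivAt_oscInt (hc : 0 < c.re) (hβ : 0 < β) (hs : -1 < s) (x : ℝ) :
    HasDerivAt (oscInt c β s) (Complex.I * oscInt c β (s + 1) x) x := by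
  have hmul : ∀ {ξ : ℝ}, 0 < ξ → powExp c β (s + 1) ξ = ξ * powExp c β s ξ := fun {ξ} hξ => by
    simp only [powExp]
    rw [Real.rpow_add hξ, Real.rpow_one]
    push_cast
    ring
  have hInt := integrableOn_powExp hc hβ hs
  have hInt1 := integrableOn_powExp (s := s + 1) hc hβ (by linarith)
  have := (hasDerivAt_integral_of_dominated_loc_of_deriv_le (μ := volume.restrict (Ioi (0 : ℝ)))
    (s := univ) (x₀ := x) (F := fun x ξ : ℝ => Complex.exp (Complex.I * ξ * x) * powExp c β s ξ)
    (F' := fun x ξ : ℝ =>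
      Complex.I * (Complex.exp (Complex.I * ξ * x) * powExp c β (s + 1) ξ))
    (bound := fun ξ => ‖powExp c β (s + 1) ξ‖) univ_mem ?_ ?_ ?_ ?_ hInt1.norm ?_).2
  · rwa [integral_const_mul] at this
  · exact Eventually.of_forall fun x => (Continuous.aestronglyMeasurable (by fun_prop)).mul
      hInt.aestronglyMeasurable
  · exact hInt.bdd_mul (c := 1) (Continuous.aestronglyMeasurable (by fun_prop))
      (ae_of_all _ fun ξ => (norm_exp_I_mul_mul _ _).le)
  · exact ((Continuous.aestronglyMeasurable (by fun_prop)).mul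
      hInt1.aestronglyMeasurable).const_mul _
  · exact ae_of_all _ fun ξ x _ => by simp [norm_exp_I_mul_mul]
  · filter_upwards [ae_restrict_mem measurableSet_Ioi] with ξ hξ y _
    have hexp : HasDerivAt (fun y : ℝ => Complex.exp (Complex.I * ξ * y))
        (Complex.exp (Complex.I * ξ * y) * (Complex.I * ξ)) y := by
      have := ((hasDerivAt_id (y : ℂ)).const_mul (Complex.I * ξ)).cexp.comp_ofReal
      simpa using this
    refine (hexp.mul_const (powExp c β s ξ)).congr_deriv ?_
    rw [hmul hξ]
    ring

/-- The only boundary term of order `1/x` is `i/x`, which is purely imaginary and disappears from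
the real part. The next one vanishes because `β > 1` makes the derivative of `exp(-c ξ^β)` zero at
the origin; `β > 1` also makes the singularity `ξ^(β-2)` of the second derivative integrable. -/
lemma exists_abs_re_oscInt_zero_le (hc : 0 < c.re) (hβ : 1 < β) :
    ∃ C, ∀ x : ℝ, |(oscInt c β 0 x).re| ≤ C * (1 + x ^ 2)⁻¹ := by
  have hβ0 : 0 < β := by linarith
  let Φ'' : ℝ → ℂ := fun ξ => -(c * β) * ((β - 1 : ℝ) * powExp c β (β - 1 - 1) ξ -
    c * β * powExp c β (β - 1 + (β - 1)) ξ)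
  let A := ∫ ξ in Ioi (0 : ℝ), ‖powExp c β 0 ξ‖
  let B := ∫ ξ in Ioi (0 : ℝ), ‖Φ'' ξ‖
  refine ⟨A + B, fun x => ?_⟩
  have hA : |(oscInt c β 0 x).re| ≤ A := (Complex.abs_re_le_norm _).trans (norm_oscInt_le x)
  have hB : |(oscInt c β 0 x).re| * x ^ 2 ≤ B := by
    rcases eq_or_ne x 0 with rfl | hx
    · simpa using integral_nonneg fun ξ => norm_nonneg _
    have := norm_integral_Ioi_exp_mul_sub_le (Φ := powExp c β 0)
      (Φ' := fun ξ => -(c * β) * powExp c β (β - 1) ξ) (Φ'' := Φ'') (a := 1) (b := 0) hx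
      (fun ξ hξ => by
        refine (hasDerivAt_powExp (c := c) (β := β) (s := 0) hξ).congr_deriv ?_
        simp)
      (fun ξ hξ => (hasDerivAt_powExp hξ).const_mul _)
      (integrableOn_powExp hc hβ0 (by norm_num))
      ((integrableOn_powExp hc hβ0 (by linarith)).const_mul _)
      ((((integrableOn_powExp hc hβ0 (by linarith)).const_mul _).sub
        ((integrableOn_powExp hc hβ0 (by linarith)).const_mul _)).const_mul _)
      (by simpa using tendsto_powExp_zero (c := c) hβ0 le_rfl)
      (by
        have := (tendsto_powExp_zero (c := c) (s := β - 1) hβ0 (by linarith)).const_mul (-(c * β))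
        rw [Real.zero_rpow (by linarith)] at this
        simpa using this)
    rw [norm_zero, zero_add, le_div_iff₀ (by positivity)] at this
    refine le_trans ?_ this
    gcongr
    refine le_trans (le_of_eq ?_) (Complex.abs_re_le_norm _)
    rw [Complex.sub_re, Complex.div_ofReal_re]
    simp [oscInt]
  rw [← div_eq_mul_inv, le_div_iff₀ (by positivity)]
  linarith

/-- Here the factor `ξ` kills the boundary term of order `1/x`, so the whole integral decays and not
only its real part; the slope `1` at the origin is the `1` added to `B`. -/
lemma exists_norm_oscInt_one_le (hc : 0 < c.re) (hβ : 1 < β) :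
    ∃ C, ∀ x : ℝ, ‖oscInt c β 1 x‖ ≤ C * (1 + x ^ 2)⁻¹ := by
  have hβ0 : 0 < β := by linarith
  let Φ'' : ℝ → ℂ := fun ξ => (-(c * β) * powExp c β (β - 1) ξ) - c * β *
    (β * powExp c β (β - 1) ξ - c * β * powExp c β (β + (β - 1)) ξ)
  let A := ∫ ξ in Ioi (0 : ℝ), ‖powExp c β 1 ξ‖
  let B := ∫ ξ in Ioi (0 : ℝ), ‖Φ'' ξ‖
  refine ⟨A + (1 + B), fun x => ?_⟩
  have hA : ‖oscInt c β 1 x‖ ≤ A := norm_oscInt_le x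
  have hB : ‖oscInt c β 1 x‖ * x ^ 2 ≤ 1 + B := by
    rcases eq_or_ne x 0 with rfl | hx
    · have : 0 ≤ B := integral_nonneg fun ξ => norm_nonneg _
      simp only [ne_eq, OfNat.ofNat_ne_zero, not_false_eq_true, zero_pow, mul_zero]
      linarith
    have := norm_integral_Ioi_exp_mul_sub_le (Φ := powExp c β 1)
      (Φ' := fun ξ => powExp c β 0 ξ - c * β * powExp c β β ξ) (Φ'' := Φ'') (a := 0) (b := 1) hx
      (fun ξ hξ => by
        refine (hasDerivAt_powExp (c := c) (β := β) (s := 1) hξ).congr_deriv ?_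
        simp)
      (fun ξ hξ => by
        refine ((hasDerivAt_powExp (c := c) (β := β) (s := 0) hξ).sub
          ((hasDerivAt_powExp (c := c) (β := β) (s := β) hξ).const_mul (c * β))).congr_deriv ?_
        simp [Φ''])
      (integrableOn_powExp hc hβ0 (by norm_num))
      ((integrableOn_powExp hc hβ0 (by norm_num)).sub
        ((integrableOn_powExp hc hβ0 (by linarith)).const_mul _))
      (((integrableOn_powExp hc hβ0 (by linarith)).const_mul _).sub
        ((((integrableOn_powExp hc hβ0 (by linarith)).const_mul _).sub
        ((integrableOn_powExp hc hβ0 (by linarith)).const_mul _)).const_mul _))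
      (by simpa using tendsto_powExp_zero (c := c) (s := 1) hβ0 zero_le_one)
      (by
        have := (tendsto_powExp_zero (c := c) (s := β) hβ0 hβ0.le).const_mul (c * β)
        rw [Real.zero_rpow hβ0.ne'] at this
        simpa using (tendsto_powExp_zero (c := c) hβ0 le_rfl).sub this)
    rw [norm_one, le_div_iff₀ (by positivity)] at this
    simpa [oscInt] using this
  rw [← div_eq_mul_inv, le_div_iff₀ (by positivity)]
  linarith

end HalfLine

/-! ### Stable symbols and the analytic properties of their kernels. -/

open scoped ComplexConjugate FourierTransform

/-- `Ψ` is the symbol `-c ξ^β` on the positive half-line, extended by conjugation. -/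
structure IsStableSymbol (Ψ : ℝ → ℂ) (c : ℂ) (β : ℝ) : Prop where
  eq_of_nonneg : ∀ ξ : ℝ, 0 ≤ ξ → Ψ ξ = -c * ((ξ ^ β : ℝ) : ℂ)
  neg : ∀ ξ : ℝ, Ψ (-ξ) = conj (Ψ ξ)
  re_pos : 0 < c.re
  one_lt : 1 < β

lemma re_ofReal_mul_pos {c : ℂ} (hc : 0 < c.re) {t : ℝ} (ht : 0 < t) : 0 < ((t : ℂ) * c).re := by
  rw [Complex.re_ofReal_mul]
  positivity

/-- Substitute `ξ ↦ t^(-1/β) ξ`, which turns `t ξ^β` into `ξ^β`. -/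
lemma oscInt_scaling {c : ℂ} {β : ℝ} (s : ℝ) (hβ : 0 < β) {t : ℝ} (ht : 0 < t) (x : ℝ) :
    oscInt (t * c) β s x = ((t ^ (-(1 / β)) : ℝ) : ℂ) * (((t ^ (-(1 / β))) ^ s : ℝ) : ℂ) *
      oscInt c β s (t ^ (-(1 / β)) * x) := by
  set a := t ^ (-(1 / β)) with ha
  have ha0 : 0 < a := by positivity
  have haβ : t * a ^ β = 1 := by
    rw [ha, ← Real.rpow_mul ht.le]
    field_simp
    rw [Real.rpow_neg_one, mul_inv_cancel₀ ht.ne']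
  have h := integral_comp_mul_left_Ioi
    (fun ξ : ℝ => Complex.exp (Complex.I * ξ * x) * powExp (t * c) β s ξ) 0 ha0
  rw [mul_zero, Complex.real_smul] at h
  have h2 : oscInt (t * c) β s x = (a : ℂ) * ∫ ξ in Ioi (0 : ℝ),
      Complex.exp (Complex.I * ↑(a * ξ) * x) * powExp (t * c) β s (a * ξ) := by
    rw [h, oscInt, ← mul_assoc, ← Complex.ofReal_mul, mul_inv_cancel₀ ha0.ne', Complex.ofReal_one,
      one_mul]
  rw [h2, mul_assoc]
  congr 1
  rw [oscInt, ← integral_const_mul]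
  refine setIntegral_congr_fun measurableSet_Ioi fun ξ hξ => ?_
  have hξ0 : (0 : ℝ) ≤ ξ := le_of_lt hξ
  simp only [powExp]
  rw [Real.mul_rpow ha0.le hξ0, Real.mul_rpow ha0.le hξ0,
    show -((t : ℂ) * c) * ((a ^ β * ξ ^ β : ℝ) : ℂ) = -c * (((t * a ^ β) * ξ ^ β : ℝ) : ℂ) by
      push_cast; ring, haβ, one_mul]
  push_cast
  ring_nf

namespace IsStableSymbol

variable {Ψ : ℝ → ℂ} {c : ℂ} {β : ℝ}

lemma beta_pos (h : IsStableSymbol Ψ c β) : 0 < β := by linarith [h.one_lt]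

lemma eq_of_nonpos (h : IsStableSymbol Ψ c β) {ξ : ℝ} (hξ : ξ ≤ 0) :
    Ψ ξ = -conj c * (((-ξ) ^ β : ℝ) : ℂ) := by
  have := h.neg (-ξ)
  rw [neg_neg, h.eq_of_nonneg (-ξ) (by linarith), map_mul, map_neg, Complex.conj_ofReal] at this
  exact this

lemma eq_abs (h : IsStableSymbol Ψ c β) (ξ : ℝ) :
    (Ψ ξ).re = -c.re * |ξ| ^ β := by
  rcases le_total 0 ξ with hξ | hξ
  · rw [h.eq_of_nonneg ξ hξ, Complex.re_mul_ofReal, abs_of_nonneg hξ, Complex.neg_re]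
  · rw [h.eq_of_nonpos hξ, Complex.re_mul_ofReal, abs_of_nonpos hξ, Complex.neg_re, Complex.conj_re]

lemma continuous (h : IsStableSymbol Ψ c β) : Continuous Ψ := by
  have hβ := Real.continuous_rpow_const h.beta_pos.le
  have h1 : Continuous fun ξ : ℝ => -c * ((ξ ^ β : ℝ) : ℂ) := by fun_prop
  have h2 : Continuous fun ξ : ℝ => -conj c * (((-ξ) ^ β : ℝ) : ℂ) := by
    have := hβ.comp continuous_neg
    simp only [Function.comp_def] at this
    fun_prop
  have : Ψ = fun ξ => if 0 ≤ ξ then -c * ((ξ ^ β : ℝ) : ℂ) else -conj c * (((-ξ) ^ β : ℝ) : ℂ) := by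
    ext ξ
    split_ifs with hξ
    · exact h.eq_of_nonneg ξ hξ
    · exact h.eq_of_nonpos (by linarith)
  rw [this]
  refine Continuous.if_le h1 h2 continuous_const continuous_id fun ξ hξ => ?_
  rw [← (show 0 = ξ from hξ)]
  simp [Real.zero_rpow h.beta_pos.ne']

lemma zero (h : IsStableSymbol Ψ c β) : Ψ 0 = 0 := by
  rw [h.eq_of_nonneg 0 le_rfl, Real.zero_rpow h.beta_pos.ne']
  simp

lemma integrable_exp (h : IsStableSymbol Ψ c β) {t : ℝ} (ht : 0 < t) :
    Integrable fun ξ : ℝ => Complex.exp (t * Ψ ξ) := by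
  have hcont : Continuous fun ξ : ℝ => Complex.exp (t * Ψ ξ) := by
    have := h.continuous
    fun_prop
  have hpos : IntegrableOn (fun ξ : ℝ => Complex.exp (t * Ψ ξ)) (Ioi 0) := by
    refine (integrableOn_powExp (s := 0) (re_ofReal_mul_pos h.re_pos ht) h.beta_pos
      (by norm_num)).congr_fun (fun ξ hξ => ?_) measurableSet_Ioi
    simp only [powExp]
    rw [h.eq_of_nonneg ξ (le_of_lt hξ), Real.rpow_zero, Complex.ofReal_one, one_mul]
    ring_nf
  have hneg : IntegrableOn (fun ξ : ℝ => Complex.exp (t * Ψ ξ)) (Iic 0) := by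
    have h1 : IntegrableOn (fun ξ : ℝ => Complex.exp (t * Ψ (-ξ))) (Ici (-0)) := by
      rw [neg_zero, integrableOn_Ici_iff_integrableOn_Ioi]
      refine Integrable.mono' hpos.norm (hcont.comp continuous_neg).aestronglyMeasurable
        (ae_of_all _ fun ξ => le_of_eq ?_)
      rw [Complex.norm_exp, Complex.norm_exp, Complex.re_ofReal_mul, Complex.re_ofReal_mul,
        h.eq_abs, h.eq_abs, abs_neg]
    have h2 := (Measure.measurePreserving_neg (volume : Measure ℝ)).integrableOn_comp_preimage
      (Homeomorph.neg ℝ).measurableEmbedding (f := fun ξ : ℝ => Complex.exp (t * Ψ ξ)) (s := Iic 0)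
    refine h2.1 ?_
    simpa [Function.comp_def] using h1
  have := hneg.union hpos
  rwa [Iic_union_Ioi, integrableOn_univ] at this

/-- The two half-lines contribute complex conjugates. Thus the integral is real, the real part in
`kernel` loses nothing, and estimates on the half-line suffice. -/
lemma integral_eq (h : IsStableSymbol Ψ c β) {t : ℝ} (ht : 0 < t) (x : ℝ) :
    ∫ ξ : ℝ, Complex.exp (Complex.I * ξ * x) * Complex.exp (t * Ψ ξ) =
      ((2 * (oscInt (t * c) β 0 x).re : ℝ) : ℂ) := by
  have hInt : Integrable fun ξ : ℝ => Complex.exp (Complex.I * ξ * x) * Complex.exp (t * Ψ ξ) :=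
    (h.integrable_exp ht).bdd_mul (c := 1) (Continuous.aestronglyMeasurable (by fun_prop))
      (ae_of_all _ fun ξ => (norm_exp_I_mul_mul _ _).le)
  have hpos : ∫ ξ in Ioi (0 : ℝ), Complex.exp (Complex.I * ξ * x) * Complex.exp (t * Ψ ξ) =
      oscInt (t * c) β 0 x := by
    refine setIntegral_congr_fun measurableSet_Ioi fun ξ hξ => ?_
    simp only [powExp]
    rw [h.eq_of_nonneg ξ (le_of_lt hξ), Real.rpow_zero, Complex.ofReal_one, one_mul]
    ring_nf
  have hneg : ∫ ξ in Iic (0 : ℝ), Complex.exp (Complex.I * ξ * x) * Complex.exp (t * Ψ ξ) =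
      conj (oscInt (t * c) β 0 x) := by
    have := integral_comp_neg_Ioi (0 : ℝ)
      (fun ξ : ℝ => Complex.exp (Complex.I * ξ * x) * Complex.exp (t * Ψ ξ))
    rw [neg_zero] at this
    rw [← this, ← hpos, ← integral_conj]
    congr 1
    ext ξ
    rw [map_mul, ← Complex.exp_conj, ← Complex.exp_conj, h.neg]
    simp
  rw [← intervalIntegral.integral_Iic_add_Ioi hInt.integrableOn hInt.integrableOn (b := 0), hneg,
    hpos, add_comm, Complex.add_conj]

lemma ofReal_kernel (h : IsStableSymbol Ψ c β) {t : ℝ} (ht : 0 < t) (x : ℝ) :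
    ((kernel Ψ t x : ℝ) : ℂ) = ((2 * Real.pi : ℝ) : ℂ)⁻¹ *
      ∫ ξ : ℝ, Complex.exp (Complex.I * ξ * x) * Complex.exp (t * Ψ ξ) := by
  rw [kernel, h.integral_eq ht, ← Complex.ofReal_inv, ← Complex.ofReal_mul, Complex.ofReal_re]

lemma kernel_eq (h : IsStableSymbol Ψ c β) {t : ℝ} (ht : 0 < t) (x : ℝ) :
    kernel Ψ t x = Real.pi⁻¹ * (oscInt (t * c) β 0 x).re := by
  rw [kernel, h.integral_eq ht, ← Complex.ofReal_inv, ← Complex.ofReal_mul, Complex.ofReal_re]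
  field_simp

/-- The derivative of the kernel in the space variable. -/
lemma hasDerivAt_kernel (h : IsStableSymbol Ψ c β) {t : ℝ} (ht : 0 < t) (x : ℝ) :
    HasDerivAt (kernel Ψ t) (-(Real.pi⁻¹ * (oscInt (t * c) β 1 x).im)) x := by
  have h1 := hasDerivAt_oscInt (s := 0) (re_ofReal_mul_pos h.re_pos ht) h.beta_pos
    (by norm_num) x
  have h2 : HasDerivAt (fun y => (oscInt (t * c) β 0 y).re) _ x :=
    (Complex.reCLM.hasFDerivAt.comp_hasDerivAt x h1)
  have h3 := h2.const_mul Real.pi⁻¹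
  have h4 : kernel Ψ t = fun y => Real.pi⁻¹ * (oscInt (t * c) β 0 y).re :=
    funext (h.kernel_eq ht)
  rw [h4]
  exact h3.congr_deriv (by simp)

lemma kernel_scaling (h : IsStableSymbol Ψ c β) {t : ℝ} (ht : 0 < t) (x : ℝ) :
    kernel Ψ t x = t ^ (-(1 / β)) * kernel Ψ 1 (t ^ (-(1 / β)) * x) := by
  rw [h.kernel_eq ht, h.kernel_eq one_pos, oscInt_scaling 0 h.beta_pos ht, Real.rpow_zero,
    Complex.ofReal_one, mul_one, one_mul, Complex.re_ofReal_mul]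
  ring

lemma deriv_kernel_scaling (h : IsStableSymbol Ψ c β) {t : ℝ} (ht : 0 < t) (x : ℝ) :
    deriv (kernel Ψ t) x =
      t ^ (-(1 / β)) * t ^ (-(1 / β)) * deriv (kernel Ψ 1) (t ^ (-(1 / β)) * x) := by
  rw [(h.hasDerivAt_kernel ht x).deriv, (h.hasDerivAt_kernel one_pos _).deriv,
    oscInt_scaling 1 h.beta_pos ht, Real.rpow_one, ← Complex.ofReal_mul, Complex.im_ofReal_mul,
    Complex.ofReal_one, one_mul]
  ring

lemma continuous_kernel (h : IsStableSymbol Ψ c β) {t : ℝ} (ht : 0 < t) :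
    Continuous (kernel Ψ t) :=
  continuous_iff_continuousAt.2 fun x => (h.hasDerivAt_kernel ht x).continuousAt

lemma continuous_deriv_kernel (h : IsStableSymbol Ψ c β) {t : ℝ} (ht : 0 < t) :
    Continuous (deriv (kernel Ψ t)) := by
  rw [funext fun x => (h.hasDerivAt_kernel ht x).deriv]
  have := continuous_oscInt (s := 1) (re_ofReal_mul_pos h.re_pos ht) h.beta_pos (by norm_num)
  fun_prop

lemma exists_abs_kernel_le (h : IsStableSymbol Ψ c β) {t : ℝ} (ht : 0 < t) :
    ∃ C, ∀ x, |kernel Ψ t x| ≤ C * (1 + x ^ 2)⁻¹ := by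
  obtain ⟨C, hC⟩ := exists_abs_re_oscInt_zero_le (re_ofReal_mul_pos h.re_pos ht) h.one_lt
  refine ⟨Real.pi⁻¹ * C, fun x => ?_⟩
  rw [h.kernel_eq ht, abs_mul, abs_of_pos (by positivity), mul_assoc]
  gcongr
  exact hC x

lemma exists_abs_deriv_kernel_le (h : IsStableSymbol Ψ c β) {t : ℝ} (ht : 0 < t) :
    ∃ C, ∀ x, |deriv (kernel Ψ t) x| ≤ C * (1 + x ^ 2)⁻¹ := by
  obtain ⟨C, hC⟩ := exists_norm_oscInt_one_le (re_ofReal_mul_pos h.re_pos ht) h.one_lt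
  refine ⟨Real.pi⁻¹ * C, fun x => ?_⟩
  rw [(h.hasDerivAt_kernel ht x).deriv, abs_neg, abs_mul, abs_of_pos (by positivity), mul_assoc]
  gcongr
  exact (Complex.abs_im_le_norm _).trans (hC x)

lemma integrable_kernel (h : IsStableSymbol Ψ c β) {t : ℝ} (ht : 0 < t) :
    Integrable (kernel Ψ t) := by
  obtain ⟨C, hC⟩ := h.exists_abs_kernel_le ht
  exact (integrable_inv_one_add_sq.const_mul C).mono'
    (h.continuous_kernel ht).aestronglyMeasurable (ae_of_all _ hC)

/-- Fourier inversion, available because the kernel decays like `1/(1 + x²)`. Unit mass is the case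
`ξ = 0`, and the semigroup law follows from the multiplicativity of `exp(tΨ)`. -/
lemma integral_kernel_mul_exp (h : IsStableSymbol Ψ c β) {t : ℝ} (ht : 0 < t) (ξ : ℝ) :
    ∫ x : ℝ, (kernel Ψ t x : ℂ) * Complex.exp (-(Complex.I * ξ * x)) = Complex.exp (t * Ψ ξ) := by
  have hpi : (2 * Real.pi) ≠ 0 := by positivity
  let φ : ℝ → ℂ := fun v => Complex.exp (t * Ψ (2 * Real.pi * v))
  have hφc : Continuous φ := by
    have := h.continuous
    fun_prop
  have hφi : Integrable φ := (h.integrable_exp ht).comp_mul_left' hpi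
  have hinv : ∀ x, 𝓕⁻ φ x = (kernel Ψ t x : ℂ) := fun x => by
    rw [Real.fourierInv_eq', h.ofReal_kernel ht]
    have := Measure.integral_comp_mul_left
      (fun ξ : ℝ => Complex.exp (Complex.I * ξ * x) * Complex.exp (t * Ψ ξ)) (2 * Real.pi)
    rw [abs_of_pos (by positivity), Complex.real_smul, Complex.ofReal_inv] at this
    rw [← this]
    congr 1
    ext v
    simp only [φ, smul_eq_mul, RCLike.inner_apply, conj_trivial]
    congr 2
    push_cast
    ring
  have hfou : Integrable (𝓕 φ) := by
    have h1 : Integrable (fun x : ℝ => (kernel Ψ t (-x) : ℂ)) :=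
      (h.integrable_kernel ht).comp_neg.ofReal
    refine h1.congr (ae_of_all _ fun x => ?_)
    simp only
    rw [← hinv, Real.fourierInv_eq_fourier_neg, neg_neg]
  have := congrFun (hφc.fourier_fourierInv_eq hφi hfou) (ξ / (2 * Real.pi))
  have h2 : φ (ξ / (2 * Real.pi)) = Complex.exp (t * Ψ ξ) := by
    simp only [φ]
    rw [mul_div_cancel₀ _ hpi]
  rw [h2, Real.fourier_eq'] at this
  rw [← this]
  congr 1
  ext x
  rw [hinv, smul_eq_mul, mul_comm]
  congr 2
  simp only [RCLike.inner_apply, conj_trivial]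
  push_cast
  field_simp

lemma integral_kernel (h : IsStableSymbol Ψ c β) {t : ℝ} (ht : 0 < t) :
    ∫ x : ℝ, kernel Ψ t x = 1 := by
  have := h.integral_kernel_mul_exp ht 0
  rw [h.zero] at this
  simp only [Complex.ofReal_zero, mul_zero, zero_mul, neg_zero, Complex.exp_zero, mul_one] at this
  rw [integral_complex_ofReal] at this
  exact_mod_cast this

lemma kernel_semigroup (h : IsStableSymbol Ψ c β) {s t : ℝ} (hs : 0 < s) (ht : 0 < t) (x : ℝ) :
    ∫ y : ℝ, kernel Ψ t (x - y) * kernel Ψ s y = kernel Ψ (t + s) x := by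
  have hInt : Integrable (fun p : ℝ × ℝ => Complex.exp (Complex.I * p.2 * ((x - p.1 : ℝ) : ℂ)) *
      ((kernel Ψ s p.1 : ℂ) * Complex.exp (t * Ψ p.2))) (volume.prod volume) := by
    refine ((h.integrable_kernel hs).ofReal.mul_prod (h.integrable_exp ht)).bdd_mul (c := 1)
      (Continuous.aestronglyMeasurable (by fun_prop)) (ae_of_all _ fun p => ?_)
    exact (norm_exp_I_mul_mul _ _).le
  have key : ((∫ y : ℝ, kernel Ψ t (x - y) * kernel Ψ s y : ℝ) : ℂ) = kernel Ψ (t + s) x := by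
    rw [← integral_complex_ofReal]
    calc ∫ y : ℝ, ((kernel Ψ t (x - y) * kernel Ψ s y : ℝ) : ℂ)
        = ∫ y : ℝ, ((2 * Real.pi : ℝ) : ℂ)⁻¹ * ∫ ξ : ℝ,
          Complex.exp (Complex.I * ξ * ((x - y : ℝ) : ℂ)) *
            ((kernel Ψ s y : ℂ) * Complex.exp (t * Ψ ξ)) := by
          congr 1
          ext y
          rw [Complex.ofReal_mul, h.ofReal_kernel ht, mul_assoc, ← integral_mul_const]
          congr 2
          ext ξ
          ring
      _ = ((2 * Real.pi : ℝ) : ℂ)⁻¹ * ∫ ξ : ℝ, ∫ y : ℝ,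
          Complex.exp (Complex.I * ξ * ((x - y : ℝ) : ℂ)) *
            ((kernel Ψ s y : ℂ) * Complex.exp (t * Ψ ξ)) := by
          rw [integral_const_mul, integral_integral_swap hInt]
      _ = kernel Ψ (t + s) x := by
          rw [h.ofReal_kernel (by positivity)]
          congr 2
          ext ξ
          rw [Complex.ofReal_add, add_mul, Complex.exp_add (t * Ψ ξ), ← h.integral_kernel_mul_exp hs,
            ← mul_assoc, ← integral_const_mul]
          congr 1
          ext y
          rw [show Complex.I * ξ * ((x - y : ℝ) : ℂ) = Complex.I * ξ * x + -(Complex.I * ξ * y) by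
            push_cast; ring, Complex.exp_add]
          ring
  exact_mod_cast key

end IsStableSymbol

/-! ### Positivity of inverse Fourier transforms. -/

/-- Integrable functions whose inverse Fourier transform has nonnegative real part. -/
def PosTransform (η : ℝ → ℂ) : Prop :=
  Integrable η ∧ ∀ x : ℝ, 0 ≤ (∫ ξ : ℝ, Complex.exp (Complex.I * ξ * x) * η ξ).re

lemma integrable_exp_I_mul {η : ℝ → ℂ} (h : Integrable η) (x : ℝ) :
    Integrable fun ξ : ℝ => Complex.exp (Complex.I * ξ * x) * η ξ :=
  h.bdd_mul (c := 1) (Continuous.aestronglyMeasurable (by fun_prop))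
    (ae_of_all _ fun ξ => (norm_exp_I_mul_mul _ _).le)

namespace PosTransform

variable {η η' : ℝ → ℂ}

lemma modulate (h : PosTransform η) (a : ℝ) :
    PosTransform fun ξ => Complex.exp (Complex.I * ξ * a) * η ξ := by
  refine ⟨integrable_exp_I_mul h.1 a, fun x => ?_⟩
  convert h.2 (x + a) using 4 with ξ
  rw [← mul_assoc, ← Complex.exp_add]
  push_cast
  ring_nf

lemma add (h : PosTransform η) (h' : PosTransform η') : PosTransform fun ξ => η ξ + η' ξ := by
  refine ⟨h.1.add h'.1, fun x => ?_⟩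
  simp_rw [mul_add]
  rw [integral_add (integrable_exp_I_mul h.1 x) (integrable_exp_I_mul h'.1 x), Complex.add_re]
  exact add_nonneg (h.2 x) (h'.2 x)

lemma const_mul (h : PosTransform η) {r : ℝ} (hr : 0 ≤ r) : PosTransform fun ξ => r * η ξ := by
  refine ⟨h.1.const_mul _, fun x => ?_⟩
  simp_rw [mul_left_comm _ (r : ℂ)]
  rw [integral_const_mul, Complex.re_ofReal_mul]
  exact mul_nonneg hr (h.2 x)

lemma sum {ι : Type*} (s : Finset ι) {η : ι → ℝ → ℂ} (h : ∀ i ∈ s, PosTransform (η i)) :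
    PosTransform fun ξ => ∑ i ∈ s, η i ξ := by
  classical
  induction s using Finset.induction_on with
  | empty => exact ⟨by simp, fun x => by simp⟩
  | insert i s hi ih =>
    simp_rw [Finset.sum_insert hi]
    exact (h i (Finset.mem_insert_self _ _)).add
      (ih fun j hj => h j (Finset.mem_insert_of_mem hj))

lemma of_tendsto {F : ℕ → ℝ → ℂ} {B : ℝ → ℝ} (hB : Integrable B) (hF : ∀ n, PosTransform (F n))
    (hb : ∀ n ξ, ‖F n ξ‖ ≤ B ξ) (hl : ∀ᵐ ξ, Tendsto (fun n => F n ξ) atTop (𝓝 (η ξ))) :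
    PosTransform η := by
  refine ⟨hB.mono' (aestronglyMeasurable_of_tendsto_ae atTop (fun n => (hF n).1.1) hl) ?_,
    fun x => ?_⟩
  · filter_upwards [hl] with ξ hξ
    exact le_of_tendsto hξ.norm (Eventually.of_forall fun n => hb n ξ)
  · have : Tendsto (fun n => ∫ ξ : ℝ, Complex.exp (Complex.I * ξ * x) * F n ξ) atTop
        (𝓝 (∫ ξ : ℝ, Complex.exp (Complex.I * ξ * x) * η ξ)) := by
      refine tendsto_integral_of_dominated_convergence B
        (fun n => (integrable_exp_I_mul (hF n).1 x).1) hB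
        (fun n => ae_of_all _ fun ξ => ?_) ?_
      · rw [norm_mul, norm_exp_I_mul_mul, one_mul]
        exact hb n ξ
      · filter_upwards [hl] with ξ hξ
        exact hξ.const_mul _
    exact ge_of_tendsto ((Complex.continuous_re.tendsto _).comp this)
      (Eventually.of_forall fun n => (hF n).2 x)

lemma comp_neg (h : PosTransform η) : PosTransform fun ξ => η (-ξ) := by
  refine ⟨h.1.comp_neg, fun x => ?_⟩
  rw [← integral_neg_eq_self]
  convert h.2 (-x) using 4 with ξ
  push_cast
  ring_nf

lemma gaussian {b : ℝ} (hb : 0 < b) : PosTransform fun ξ => Complex.exp (-b * ξ ^ 2) := by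
  constructor
  · have := integrable_cexp_quadratic (b := (b : ℂ)) (by simpa using hb) 0 0
    simpa using this
  · intro x
    have := fourierIntegral_gaussian (b := (b : ℂ)) (by simpa using hb) x
    simp_rw [mul_right_comm Complex.I _ (x : ℂ)]
    rw [this, ← Complex.ofReal_div, show (1 / 2 : ℂ) = ((1 / 2 : ℝ) : ℂ) by push_cast; ring,
      ← Complex.ofReal_cpow (by positivity),
      show -(x : ℂ) ^ 2 / (4 * b) = ((-x ^ 2 / (4 * b) : ℝ) : ℂ) by push_cast; ring,
      ← Complex.ofReal_exp, ← Complex.ofReal_mul, Complex.ofReal_re]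
    positivity

/-- Multiplication by a character only translates the transform, so nonnegative combinations of
characters keep its sign. -/
lemma mul_tsum (h : PosTransform η) {p x : ℕ → ℝ} (hp : ∀ k, 0 ≤ p k) (hs : Summable p) :
    PosTransform fun ξ => (∑' k, p k * Complex.exp (Complex.I * ξ * x k)) * η ξ := by
  have hnorm : ∀ ξ k, ‖(p k : ℂ) * Complex.exp (Complex.I * (ξ : ℝ) * x k)‖ = p k := fun ξ k => by
    rw [norm_mul, norm_exp_I_mul_mul, Complex.norm_real, Real.norm_of_nonneg (hp k), mul_one]
  refine of_tendsto (F := fun n ξ => ∑ k ∈ Finset.range n,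
    p k * (Complex.exp (Complex.I * ξ * x k) * η ξ)) (B := fun ξ => (∑' k, p k) * ‖η ξ‖)
    (h.1.norm.const_mul _) (fun n => sum _ fun k _ => (h.modulate _).const_mul (hp k))
    (fun n ξ => ?_) (ae_of_all _ fun ξ => ?_)
  · simp_rw [← mul_assoc]
    rw [← Finset.sum_mul, norm_mul]
    gcongr
    refine (norm_sum_le _ _).trans ?_
    simp_rw [hnorm]
    exact hs.sum_le_tsum _ fun k _ => hp k
  · simp_rw [← mul_assoc, ← Finset.sum_mul]
    refine Tendsto.mul_const _ ?_
    refine (Summable.of_norm ?_).hasSum.tendsto_sum_nat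
    simpa only [hnorm] using hs

lemma norm_tsum_le {p x : ℕ → ℝ} (hp : ∀ k, 0 ≤ p k) (hs : Summable p) (ξ : ℝ) :
    ‖∑' k, (p k : ℂ) * Complex.exp (Complex.I * ξ * x k)‖ ≤ ∑' k, p k := by
  have hnorm : ∀ k, ‖(p k : ℂ) * Complex.exp (Complex.I * (ξ : ℝ) * x k)‖ = p k := fun k => by
    rw [norm_mul, norm_exp_I_mul_mul, Complex.norm_real, Real.norm_of_nonneg (hp k), mul_one]
  refine (norm_tsum_le_tsum_norm (by simpa only [hnorm] using hs)).trans ?_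
  simp_rw [hnorm]
  rfl

/-- The exponential series has nonnegative coefficients, and each power of the character sum
preserves positivity. -/
lemma mul_exp_tsum (h : PosTransform η) {p x : ℕ → ℝ} (hp : ∀ k, 0 ≤ p k) (hs : Summable p) :
    PosTransform fun ξ =>
      Complex.exp (∑' k, p k * Complex.exp (Complex.I * ξ * x k)) * η ξ := by
  set χ : ℝ → ℂ := fun ξ => ∑' k, p k * Complex.exp (Complex.I * ξ * x k) with hχ
  have hpow : ∀ n : ℕ, PosTransform fun ξ => χ ξ ^ n * η ξ := by
    intro n
    induction n with
    | zero => simpa using h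
    | succ n ih =>
      have := ih.mul_tsum (x := x) hp hs
      convert this using 2 with ξ
      rw [pow_succ', mul_assoc]
  refine of_tendsto (F := fun n ξ => ∑ k ∈ Finset.range n,
    ((k.factorial : ℝ)⁻¹ : ℝ) * (χ ξ ^ k * η ξ)) (B := fun ξ => Real.exp (∑' k, p k) * ‖η ξ‖)
    (h.1.norm.const_mul _) (fun n => sum _ fun k _ => (hpow k).const_mul (by positivity))
    (fun n ξ => ?_) (ae_of_all _ fun ξ => ?_)
  · simp_rw [← mul_assoc]
    rw [← Finset.sum_mul, norm_mul]
    gcongr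
    refine (norm_sum_le _ _).trans ?_
    refine le_trans ?_ (Real.sum_le_exp_of_nonneg (tsum_nonneg hp) n)
    gcongr with k hk
    rw [norm_mul, norm_pow, Complex.norm_real, Real.norm_of_nonneg (by positivity), div_eq_inv_mul]
    gcongr
    exact norm_tsum_le hp hs ξ
  · simp_rw [← mul_assoc, ← Finset.sum_mul]
    refine Tendsto.mul_const _ ?_
    have := (NormedSpace.expSeries_div_hasSum_exp (χ ξ)).tendsto_sum_nat
    rw [← Complex.exp_eq_exp_ℂ] at this
    refine this.congr fun n => Finset.sum_congr rfl fun k _ => ?_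
    push_cast
    field_simp

end PosTransform

/-- Functions bounded by `1` that preserve `PosTransform` under multiplication. -/
def PosMultiplier (m : ℝ → ℂ) : Prop :=
  (∀ ξ, ‖m ξ‖ ≤ 1) ∧ ∀ η, PosTransform η → PosTransform fun ξ => m ξ * η ξ

namespace PosMultiplier

variable {m m' : ℝ → ℂ}

lemma mul (h : PosMultiplier m) (h' : PosMultiplier m') : PosMultiplier fun ξ => m ξ * m' ξ := by
  refine ⟨fun ξ => ?_, fun η hη => ?_⟩
  · rw [norm_mul]
    exact mul_le_one₀ (h.1 ξ) (norm_nonneg _) (h'.1 ξ)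
  · simpa only [mul_assoc] using h.2 _ (h'.2 _ hη)

lemma comp_neg (h : PosMultiplier m) : PosMultiplier fun ξ => m (-ξ) := by
  refine ⟨fun ξ => h.1 _, fun η hη => ?_⟩
  simpa using (h.2 _ hη.comp_neg).comp_neg

/-- The bound by `1` makes `‖η‖` a dominating function, so pointwise limits are enough. This is the
reason for working with multipliers: compound Poisson exponentials need not be integrable
themselves. -/
lemma of_tendsto {F : ℕ → ℝ → ℂ} (hF : ∀ n, PosMultiplier (F n))
    (hl : ∀ ξ, Tendsto (fun n => F n ξ) atTop (𝓝 (m ξ))) : PosMultiplier m := by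
  refine ⟨fun ξ => le_of_tendsto (hl ξ).norm (Eventually.of_forall fun n => (hF n).1 ξ),
    fun η hη => ?_⟩
  refine PosTransform.of_tendsto hη.1.norm (fun n => (hF n).2 η hη) (fun n ξ => ?_)
    (ae_of_all _ fun ξ => (hl ξ).mul_const _)
  rw [norm_mul]
  exact mul_le_of_le_one_left (norm_nonneg _) ((hF n).1 ξ)

/-- Apply the multiplier to the Gaussians `exp(-ξ²/(n+1))`, whose transforms are positive, and let
them tend to `1`. -/
lemma posTransform (h : PosMultiplier m) (hi : Integrable m) : PosTransform m := by
  refine PosTransform.of_tendsto (F := fun n ξ =>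
    m ξ * Complex.exp (-((1 / ((n : ℝ) + 1) : ℝ) : ℂ) * ξ ^ 2)) hi.norm
    (fun n => h.2 _ (PosTransform.gaussian (by positivity))) (fun n ξ => ?_)
    (ae_of_all _ fun ξ => ?_)
  · rw [norm_mul]
    refine mul_le_of_le_one_right (norm_nonneg _) ?_
    rw [Complex.norm_exp, Real.exp_le_one_iff,
      show -((1 / ((n : ℝ) + 1) : ℝ) : ℂ) * (ξ : ℂ) ^ 2 = ((-(1 / ((n : ℝ) + 1)) * ξ ^ 2 : ℝ) : ℂ) by
        push_cast; ring, Complex.ofReal_re]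
    have : 0 ≤ (1 / ((n : ℝ) + 1)) * ξ ^ 2 := by positivity
    linarith
  · have h1 : Tendsto (fun n : ℕ => (1 / ((n : ℝ) + 1) : ℝ)) atTop (𝓝 0) :=
      tendsto_one_div_add_atTop_nhds_zero_nat
    have h2 : Continuous fun r : ℝ => m ξ * Complex.exp (-(r : ℂ) * ξ ^ 2) := by fun_prop
    have h3 := (h2.tendsto 0).comp h1
    simp only [Complex.ofReal_zero, neg_zero, zero_mul, Complex.exp_zero, mul_one] at h3
    exact h3

/-- Exponentials of compound Poisson exponents. The weights of vanishing jumps are irrelevant. -/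
lemma exp_tsum {b x : ℕ → ℝ} (hb : Summable b) (h : ∀ k, 0 ≤ b k ∨ x k = 0) :
    PosMultiplier fun ξ =>
      Complex.exp (∑' k, (b k : ℂ) * (Complex.exp (Complex.I * ξ * x k) - 1)) := by
  classical
  set p : ℕ → ℝ := fun k => if x k = 0 then 0 else b k with hp
  have hp0 : ∀ k, 0 ≤ p k := fun k => by
    rcases h k with hk | hk <;> simp only [hp] <;> split_ifs <;> simp_all
  have hps : Summable p := by
    refine Summable.of_norm_bounded hb.norm fun k => ?_
    simp only [hp]
    split_ifs <;> simp
  have hnorm : ∀ (ξ : ℝ) k, ‖(p k : ℂ) * Complex.exp (Complex.I * ξ * x k)‖ = p k := fun ξ k => by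
    rw [norm_mul, norm_exp_I_mul_mul, Complex.norm_real, Real.norm_of_nonneg (hp0 k), mul_one]
  have heq : ∀ ξ : ℝ, ∑' k, (b k : ℂ) * (Complex.exp (Complex.I * ξ * x k) - 1) =
      (∑' k, (p k : ℂ) * Complex.exp (Complex.I * ξ * x k)) - ((∑' k, p k : ℝ) : ℂ) := fun ξ => by
    rw [Complex.ofReal_tsum, ← Summable.tsum_sub]
    · congr 1
      ext k
      simp only [hp]
      split_ifs with hk
      · simp [hk]
      · ring
    · exact Summable.of_norm (by simpa only [hnorm] using hps)
    · exact Complex.ofRealCLM.summable hps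
  simp_rw [heq]
  refine ⟨fun ξ => ?_, fun η hη => ?_⟩
  · rw [Complex.norm_exp, Real.exp_le_one_iff, Complex.sub_re, Complex.ofReal_re, sub_nonpos]
    exact (Complex.re_le_norm _).trans (PosTransform.norm_tsum_le hp0 hps ξ)
  · have := (hη.mul_exp_tsum (x := x) hp0 hps).const_mul (Real.exp_nonneg (-∑' k, p k))
    convert this using 2 with ξ
    simp only [sub_eq_add_neg, Complex.exp_add]
    push_cast
    ring

end PosMultiplier

/-! ### Grünwald–Letnikov approximation of `(iξ)^β`. -/

lemma choose_succ_mul (a : ℝ) (n : ℕ) :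
    ((n : ℝ) + 1) * Ring.choose a (n + 1) = (a - n) * Ring.choose a n := by
  have hn : ((n : ℝ) + 1) ≠ 0 := by positivity
  have hf : ((n.factorial : ℕ) : ℝ) ≠ 0 := by positivity
  rw [Ring.choose_eq_smul, Ring.choose_eq_smul, descPochhammer_succ_right, Polynomial.smeval_mul,
    Nat.factorial_succ]
  simp only [Polynomial.smeval_sub, Polynomial.smeval_X, Polynomial.smeval_natCast, pow_one,
    pow_zero, nsmul_eq_mul, mul_one, smul_eq_mul]
  push_cast
  field_simp

/-- Consecutive signed coefficients have ratio `(k - β)/(k + 1)`, nonnegative once `k ≥ 2 ≥ β`; the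
induction starts from `β(β - 1)/2`. -/
lemma choose_mul_neg_one_pow_nonneg {β : ℝ} (h1 : 1 ≤ β) (h2 : β ≤ 2) (n : ℕ) :
    0 ≤ Ring.choose β (n + 2) * (-1) ^ (n + 2) := by
  induction n with
  | zero =>
    have := choose_succ_mul β 1
    rw [Ring.choose_one_right] at this
    norm_num at this ⊢
    nlinarith
  | succ n ih =>
    have h := choose_succ_mul β (n + 2)
    push_cast at h
    have h3 : Ring.choose β (n + 2 + 1) * (-1) ^ (n + 2 + 1) =
        ((n + 2 - β) / (n + 2 + 1)) * (Ring.choose β (n + 2) * (-1) ^ (n + 2)) := by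
      rw [pow_succ]
      field_simp
      linear_combination -h
    rw [show n + 1 + 2 = n + 2 + 1 by ring, h3]
    have : (0 : ℝ) ≤ n + 2 - β := by
      have : (0 : ℝ) ≤ n := n.cast_nonneg
      linarith
    positivity

lemma hasSum_one_add_cpow (β : ℝ) {z : ℂ} (hz : ‖z‖ < 1) :
    HasSum (fun n : ℕ => (Ring.choose β n : ℂ) * z ^ n) ((1 + z) ^ (β : ℂ)) := by
  have hz' : z ∈ Metric.eball (0 : ℂ) 1 := by
    rw [Metric.mem_eball, edist_zero_right, ← ofReal_norm, ← ENNReal.ofReal_one]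
    exact (ENNReal.ofReal_lt_ofReal_iff one_pos).2 hz
  have := (Complex.one_add_cpow_hasFPowerSeriesOnBall_zero (a := (β : ℂ))).hasSum hz'
  simp only [zero_add, binomialSeries_apply, List.ofFn_const, List.prod_replicate,
    smul_eq_mul] at this
  simpa only [Complex.ofReal_choose] using this

/-- The shifted Grünwald–Letnikov approximation of `(iξ)^β`. -/
def grunwald (β h ξ : ℝ) : ℂ :=
  ((h⁻¹ : ℝ) : ℂ) ^ (β : ℂ) * (Complex.exp (Complex.I * ξ * h) *
    (1 + -((1 - h ^ 2 : ℝ) : ℂ) * Complex.exp (-(Complex.I * ξ * h))) ^ (β : ℂ) -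
      ((h ^ 2 : ℝ) : ℂ) ^ (β : ℂ))

/-- Expanding by the binomial series gives jumps `(1 - k)h` with weights proportional to `binom(β,
k)(-r)^k`, and the constant subtracted in `grunwald` is the sum of these weights, so the exponent is
compound Poisson. The factor `r < 1` keeps the series inside its open disc of convergence. -/
lemma posMultiplier_exp_grunwald {β h s : ℝ} (h1 : 1 ≤ β) (h2 : β ≤ 2) (hh : 0 < h) (hh1 : h < 1)
    (hs : 0 ≤ s) : PosMultiplier fun ξ => Complex.exp (s * grunwald β h ξ) := by
  set r := 1 - h ^ 2 with hr
  have hr0 : 0 < r := by nlinarith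
  have hr1 : r < 1 := by nlinarith
  have hz : ∀ ξ : ℝ, ‖-(r : ℂ) * Complex.exp (-(Complex.I * ξ * h))‖ < 1 := fun ξ => by
    rw [norm_mul, norm_neg, Complex.norm_real, Real.norm_of_nonneg hr0.le,
      show -(Complex.I * ξ * (h : ℂ)) = Complex.I * ξ * ((-h : ℝ) : ℂ) by push_cast; ring,
      norm_exp_I_mul_mul, mul_one]
    exact hr1
  set A : ℝ := s * (h⁻¹) ^ β with hA
  have hA0 : 0 ≤ A := by positivity
  have hcs := hasSum_one_add_cpow β (z := ((-r : ℝ) : ℂ)) (by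
    simpa [abs_of_pos hr0] using hr1)
  have hbs : Summable fun k : ℕ => A * (Ring.choose β k * (-r) ^ k) := by
    refine Summable.mul_left _ ?_
    have := hcs.summable
    exact_mod_cast this
  have key := PosMultiplier.exp_tsum (b := fun k : ℕ => A * (Ring.choose β k * (-r) ^ k))
    (x := fun k : ℕ => (1 - k) * h) hbs (fun k => by
      match k with
      | 0 => left; simpa using hA0
      -- The only negative weight is that of `k = 1`; the shift by `exp(iξh)` places it at the jump
      -- of size zero, where it has no effect.
      | 1 => right; simp
      | k + 2 =>
        left
        rw [neg_pow, ← mul_assoc (Ring.choose β (k + 2))]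
        have := choose_mul_neg_one_pow_nonneg h1 h2 k
        positivity)
  convert key using 3 with ξ
  have hpow : ((h⁻¹ : ℝ) : ℂ) ^ (β : ℂ) = (((h⁻¹) ^ β : ℝ) : ℂ) :=
    (Complex.ofReal_cpow (by positivity) β).symm
  have hsum := ((hasSum_one_add_cpow β (hz ξ)).mul_left (Complex.exp (Complex.I * ξ * h))).sub hcs
  have h1r : 1 + ((-r : ℝ) : ℂ) = ((h ^ 2 : ℝ) : ℂ) := by rw [hr]; push_cast; ring
  rw [h1r] at hsum
  rw [grunwald, hpow, ← (hsum.mul_left (((h⁻¹) ^ β : ℝ) : ℂ)).tsum_eq, ← tsum_mul_left]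
  congr 1
  ext k
  have he : Complex.exp (Complex.I * ξ * h) * Complex.exp (-(Complex.I * ξ * h)) ^ k =
      Complex.exp (Complex.I * ξ * (((1 - k) * h : ℝ) : ℂ)) := by
    rw [← Complex.exp_nat_mul, ← Complex.exp_add]
    push_cast
    ring_nf
  rw [← he, mul_pow]
  push_cast [hA]
  ring

/-- The base of the power is a curve through `0` with velocity `iξ` at `h = 0`: the damping `h²` is
of second order, and the subtracted constant contributes only `h^(-β) h^(2β) = h^β`. -/
lemma tendsto_grunwald {β : ℝ} (hβ : 0 < β) (ξ : ℝ) :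
    Tendsto (fun h : ℝ => grunwald β h ξ) (𝓝[>] 0) (𝓝 ((Complex.I * ξ) ^ (β : ℂ))) := by
  have hβ' : (β : ℂ) ≠ 0 := by exact_mod_cast hβ.ne'
  have hd : HasDerivAt (fun h : ℝ => 1 + -((1 - h ^ 2 : ℝ) : ℂ) *
      Complex.exp (-(Complex.I * ξ * h))) (Complex.I * ξ) 0 := by
    have e1 : HasDerivAt (fun h : ℝ => Complex.exp (-(Complex.I * ξ * h))) (-(Complex.I * ξ)) 0 := by
      have := ((((hasDerivAt_id (((0 : ℝ) : ℝ) : ℂ)).const_mul (Complex.I * ξ)).neg).cexp).comp_ofReal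
      simpa using this
    have e2 : HasDerivAt (fun h : ℝ => -((1 - h ^ 2 : ℝ) : ℂ)) 0 0 := by
      have := (((hasDerivAt_id (0 : ℝ)).pow 2).const_sub 1).ofReal_comp.neg
      exact this.congr_deriv (by simp)
    have := (e2.mul e1).const_add 1
    simpa using this
  have hw := hd.tendsto_slope_zero_right
  simp only [zero_add, Complex.ofReal_zero, mul_zero, neg_zero, Complex.exp_zero, mul_one, ne_eq,
    OfNat.ofNat_ne_zero, not_false_eq_true, zero_pow, sub_zero, Complex.ofReal_one,
    add_neg_cancel, Complex.real_smul] at hw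
  have hcont : ContinuousAt (fun z : ℂ => z ^ (β : ℂ)) (Complex.I * ξ) := by
    rcases eq_or_ne ξ 0 with rfl | hξ
    · simpa using Complex.continuousAt_cpow_const_of_re_pos (z := (0 : ℂ)) (w := (β : ℂ))
        (by simp) (by simpa using hβ)
    · exact continuousAt_cpow_const (Or.inr (by simpa using hξ))
  have hmain := (hcont.tendsto.comp hw)
  have hexp : Tendsto (fun h : ℝ => Complex.exp (Complex.I * ξ * h)) (𝓝[>] 0) (𝓝 1) := by
    have : Continuous fun h : ℝ => Complex.exp (Complex.I * ξ * h) := by fun_prop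
    simpa using (this.tendsto 0).mono_left (nhdsWithin_le_nhds (s := Ioi (0 : ℝ)))
  have hlast : Tendsto (fun h : ℝ => ((h ^ β : ℝ) : ℂ)) (𝓝[>] 0) (𝓝 0) := by
    have : Continuous fun h : ℝ => ((h ^ β : ℝ) : ℂ) :=
      Complex.continuous_ofReal.comp (Real.continuous_rpow_const hβ.le)
    simpa [Real.zero_rpow hβ.ne'] using
      (this.tendsto 0).mono_left (nhdsWithin_le_nhds (s := Ioi (0 : ℝ)))
  have := (hexp.mul hmain).sub hlast
  rw [one_mul, sub_zero] at this
  refine this.congr' ?_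
  filter_upwards [Ioo_mem_nhdsGT (zero_lt_one' ℝ)] with h hh
  have hh0 : 0 < h := hh.1
  have hw0 : 1 + -((1 - h ^ 2 : ℝ) : ℂ) * Complex.exp (-(Complex.I * ξ * h)) ≠ 0 := by
    intro h0
    have h3 : ‖((1 - h ^ 2 : ℝ) : ℂ) * Complex.exp (-(Complex.I * ξ * h))‖ = 1 := by
      rw [show ((1 - h ^ 2 : ℝ) : ℂ) * Complex.exp (-(Complex.I * ξ * h)) = 1 by
        linear_combination -h0, norm_one]
    rw [norm_mul, show -(Complex.I * ξ * (h : ℂ)) = Complex.I * ξ * ((-h : ℝ) : ℂ) by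
      push_cast; ring, norm_exp_I_mul_mul, mul_one, Complex.norm_real,
      Real.norm_of_nonneg (by nlinarith [hh.1, hh.2])] at h3
    nlinarith
  -- A positive real factor may be pulled out of a principal power, since it does not change the
  -- argument.
  have hmul : ((h⁻¹ : ℝ) * (1 + -((1 - h ^ 2 : ℝ) : ℂ) *
      Complex.exp (-(Complex.I * ξ * h)))) ^ (β : ℂ) = ((h⁻¹ : ℝ) : ℂ) ^ (β : ℂ) *
      (1 + -((1 - h ^ 2 : ℝ) : ℂ) * Complex.exp (-(Complex.I * ξ * h))) ^ (β : ℂ) := by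
    have hi : ((h⁻¹ : ℝ) : ℂ) ≠ 0 := by
      exact_mod_cast (inv_pos.2 hh0).ne'
    rw [Complex.cpow_def_of_ne_zero (mul_ne_zero hi hw0), Complex.cpow_def_of_ne_zero hi,
      Complex.cpow_def_of_ne_zero hw0, Complex.log_ofReal_mul (inv_pos.2 hh0) hw0,
      Complex.ofReal_log (inv_pos.2 hh0).le, ← Complex.exp_add]
    ring_nf
  have hlast' : ((h ^ β : ℝ) : ℂ) = ((h⁻¹ : ℝ) : ℂ) ^ (β : ℂ) * ((h ^ 2 : ℝ) : ℂ) ^ (β : ℂ) := by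
    rw [← Complex.ofReal_cpow (by positivity), ← Complex.ofReal_cpow (by positivity),
      ← Complex.ofReal_mul, ← Real.mul_rpow (by positivity) (by positivity)]
    congr 2
    field_simp
  simp only [Function.comp_apply]
  rw [hmul, hlast', grunwald]
  ring

lemma posMultiplier_exp_cpow {β s : ℝ} (h1 : 1 ≤ β) (h2 : β ≤ 2) (hs : 0 ≤ s) :
    PosMultiplier fun ξ => Complex.exp (s * (Complex.I * ξ) ^ (β : ℂ)) := by
  have hseq : Tendsto (fun n : ℕ => 1 / ((n : ℝ) + 2)) atTop (𝓝[>] 0) := by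
    rw [tendsto_nhdsWithin_iff]
    refine ⟨?_, Eventually.of_forall fun n => ?_⟩
    · have := (tendsto_one_div_add_atTop_nhds_zero_nat (𝕜 := ℝ)).comp (tendsto_add_atTop_nat 1)
      refine this.congr fun n => ?_
      simp only [Function.comp_apply]
      push_cast
      ring
    · simp only [mem_Ioi]
      positivity
  refine PosMultiplier.of_tendsto (F := fun n ξ =>
    Complex.exp (s * grunwald β (1 / ((n : ℝ) + 2)) ξ)) (fun n => ?_) (fun ξ => ?_)
  · refine posMultiplier_exp_grunwald h1 h2 (by positivity) ?_ hs
    rw [div_lt_one (by positivity)]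
    have : (0 : ℝ) ≤ n := n.cast_nonneg
    linarith
  · exact (((tendsto_grunwald (by linarith) ξ).comp hseq).const_mul _).cexp

/-! ### Stable kernels, and the two families of symbols. -/

/-- The properties of the densities of a strictly stable convolution semigroup that the
contraction argument uses. -/
structure IsStableKernel (K : ℝ → ℝ → ℝ) (θ : ℝ) : Prop where
  theta_lt_one : θ < 1
  hasDerivAt : ∀ t, 0 < t → ∀ x, HasDerivAt (K t) (deriv (K t) x) x
  continuous_one : Continuous (K 1)
  continuous_deriv_one : Continuous (deriv (K 1))
  scaling : ∀ t, 0 < t → ∀ x, K t x = t ^ (-θ) * K 1 (t ^ (-θ) * x)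
  deriv_scaling : ∀ t, 0 < t → ∀ x,
    deriv (K t) x = t ^ (-θ) * t ^ (-θ) * deriv (K 1) (t ^ (-θ) * x)
  bound : ∃ C, ∀ x, |K 1 x| ≤ C * (1 + x ^ 2)⁻¹
  deriv_bound : ∃ C, ∀ x, |deriv (K 1) x| ≤ C * (1 + x ^ 2)⁻¹
  nonneg : ∀ t, 0 < t → ∀ x, 0 ≤ K t x
  integral_eq_one : ∀ t, 0 < t → ∫ x, K t x = 1
  semigroup : ∀ s t, 0 < s → 0 < t → ∀ x, ∫ y, K t (x - y) * K s y = K (t + s) x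

/-- Positivity is the only property not already contained in the half-line analysis. The
decomposition of `Ψ` factors `exp(tΨ)` into two one-sided multipliers, the second reflected. -/
lemma IsStableSymbol.isStableKernel {Ψ : ℝ → ℂ} {c : ℂ} {β A B : ℝ} (h : IsStableSymbol Ψ c β)
    (hβ : β ≤ 2) (hA : 0 ≤ A) (hB : 0 ≤ B)
    (hΨ : ∀ ξ : ℝ, Ψ ξ = A * (Complex.I * ξ) ^ (β : ℂ) + B * (Complex.I * ((-ξ : ℝ) : ℂ)) ^ (β : ℂ)) :
    IsStableKernel (kernel Ψ) (1 / β) where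
  theta_lt_one := (div_lt_one h.beta_pos).2 h.one_lt
  hasDerivAt t ht x := (h.hasDerivAt_kernel ht x).differentiableAt.hasDerivAt
  continuous_one := h.continuous_kernel one_pos
  continuous_deriv_one := h.continuous_deriv_kernel one_pos
  scaling t ht x := h.kernel_scaling ht x
  deriv_scaling t ht x := h.deriv_kernel_scaling ht x
  bound := h.exists_abs_kernel_le one_pos
  deriv_bound := h.exists_abs_deriv_kernel_le one_pos
  nonneg t ht x := by
    have h1 := posMultiplier_exp_cpow h.one_lt.le hβ (mul_nonneg ht.le hA)
    have h2 := (posMultiplier_exp_cpow h.one_lt.le hβ (mul_nonneg ht.le hB)).comp_neg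
    have h3 : PosMultiplier fun ξ => Complex.exp (t * Ψ ξ) := by
      convert h1.mul h2 using 2 with ξ
      rw [← Complex.exp_add, hΨ ξ]
      push_cast
      ring_nf
    have := (h3.posTransform (h.integrable_exp ht)).2 x
    rw [kernel, ← Complex.ofReal_inv, Complex.re_ofReal_mul]
    positivity
  integral_eq_one t ht := h.integral_kernel ht
  semigroup s t hs ht x := h.kernel_semigroup hs ht x

lemma I_mul_cpow_of_nonneg {β ξ : ℝ} (hβ : β ≠ 0) (hξ : 0 ≤ ξ) :
    (Complex.I * ξ) ^ (β : ℂ) =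
      ((ξ ^ β : ℝ) : ℂ) * Complex.exp (Complex.I * ((β * (Real.pi / 2) : ℝ) : ℂ)) := by
  have hβ' : (β : ℂ) ≠ 0 := by exact_mod_cast hβ
  rcases hξ.eq_or_lt with rfl | hξ
  · simp [Real.zero_rpow hβ, Complex.zero_cpow hβ']
  have hξ' : (ξ : ℂ) ≠ 0 := by exact_mod_cast hξ.ne'
  rw [mul_comm, Complex.cpow_def_of_ne_zero (mul_ne_zero hξ' Complex.I_ne_zero),
    Complex.log_ofReal_mul hξ Complex.I_ne_zero, Complex.log_I, add_mul, Complex.exp_add,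
    Complex.ofReal_cpow hξ.le, Complex.cpow_def_of_ne_zero hξ', Complex.ofReal_log hξ.le]
  push_cast
  ring_nf

lemma I_mul_neg_cpow_of_nonneg {β ξ : ℝ} (hβ : β ≠ 0) (hξ : 0 ≤ ξ) :
    (Complex.I * ((-ξ : ℝ) : ℂ)) ^ (β : ℂ) =
      ((ξ ^ β : ℝ) : ℂ) * Complex.exp (-(Complex.I * ((β * (Real.pi / 2) : ℝ) : ℂ))) := by
  have hβ' : (β : ℂ) ≠ 0 := by exact_mod_cast hβ
  rcases hξ.eq_or_lt with rfl | hξ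
  · simp [Real.zero_rpow hβ, Complex.zero_cpow hβ']
  have hξ' : (ξ : ℂ) ≠ 0 := by exact_mod_cast hξ.ne'
  have hI : -Complex.I ≠ 0 := neg_ne_zero.2 Complex.I_ne_zero
  rw [show Complex.I * ((-ξ : ℝ) : ℂ) = ξ * -Complex.I by push_cast; ring,
    Complex.cpow_def_of_ne_zero (mul_ne_zero hξ' hI),
    Complex.log_ofReal_mul hξ hI, Complex.log_neg_I, add_mul, Complex.exp_add,
    Complex.ofReal_cpow hξ.le, Complex.cpow_def_of_ne_zero hξ', Complex.ofReal_log hξ.le]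
  push_cast
  ring_nf

lemma rieszFellerSymbol_of_pos {β γ ξ : ℝ} (hξ : 0 < ξ) :
    rieszFellerSymbol β γ ξ =
      -Complex.exp (Complex.I * ((γ * (Real.pi / 2) : ℝ) : ℂ)) * ((ξ ^ β : ℝ) : ℂ) := by
  rw [rieszFellerSymbol, abs_of_pos hξ, Real.sign_of_pos hξ, one_mul]
  ring

lemma rieszFellerSymbol_neg {β γ : ℝ} (ξ : ℝ) :
    rieszFellerSymbol β γ (-ξ) = conj (rieszFellerSymbol β γ ξ) := by
  rw [rieszFellerSymbol, rieszFellerSymbol, abs_neg, Real.sign_neg, map_neg, map_mul,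
    Complex.conj_ofReal, ← Complex.exp_conj, map_mul, Complex.conj_I, Complex.conj_ofReal]
  push_cast
  ring_nf

lemma rieszFellerSymbol_zero {β γ : ℝ} (hβ : 0 < β) : rieszFellerSymbol β γ 0 = 0 := by
  simp [rieszFellerSymbol, Real.zero_rpow hβ.ne']

lemma isStableSymbol_rieszFeller {β γ ε : ℝ} (h1 : 1 < β) (hγ : |γ| ≤ min β (2 - β)) (hε : 0 < ε) :
    IsStableSymbol (fun ξ => (ε : ℂ) * rieszFellerSymbol β γ ξ)
      (ε * Complex.exp (Complex.I * ((γ * (Real.pi / 2) : ℝ) : ℂ))) β where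
  eq_of_nonneg ξ hξ := by
    rcases hξ.eq_or_lt with rfl | hξ
    · simp [rieszFellerSymbol_zero (by linarith : 0 < β), Real.zero_rpow (by linarith : β ≠ 0)]
    · rw [rieszFellerSymbol_of_pos hξ]
      ring
  neg ξ := by
    rw [rieszFellerSymbol_neg, map_mul, Complex.conj_ofReal]
  re_pos := by
    rw [Complex.re_ofReal_mul, mul_comm Complex.I, Complex.exp_ofReal_mul_I_re]
    refine mul_pos hε (Real.cos_pos_of_mem_Ioo ?_)
    have hγ1 := abs_lt.1 (lt_of_le_of_lt (hγ.trans (min_le_right _ _)) (by linarith : 2 - β < 1))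
    have := Real.pi_pos
    constructor <;> nlinarith
  one_lt := h1

/-- The coefficients of the decomposition of a Riesz–Feller symbol into one-sided symbols. -/
lemma exists_rieszFeller_coeff {β γ : ℝ} (h1 : 1 < β) (h2 : β ≤ 2) (hγ : |γ| ≤ min β (2 - β)) :
    ∃ A B : ℝ, 0 ≤ A ∧ 0 ≤ B ∧
      A * Complex.exp (Complex.I * ((β * (Real.pi / 2) : ℝ) : ℂ)) +
        B * Complex.exp (-(Complex.I * ((β * (Real.pi / 2) : ℝ) : ℂ))) =
      -Complex.exp (Complex.I * ((γ * (Real.pi / 2) : ℝ) : ℂ)) := by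
  have hpi := Real.pi_pos
  obtain ⟨hγ1, hγ2⟩ := abs_le.1 (hγ.trans (min_le_right _ _))
  rcases h2.eq_or_lt with rfl | h2
  · have hγ0 : γ = 0 := by linarith
    -- At `β = 2` the two one-sided symbols coincide and the general formula would divide by `sin π
    -- = 0`.
    refine ⟨1, 0, zero_le_one, le_rfl, ?_⟩
    rw [hγ0, show Complex.I * ((2 * (Real.pi / 2) : ℝ) : ℂ) = Real.pi * Complex.I by
      push_cast; ring, Complex.exp_pi_mul_I]
    simp
  set b := β * (Real.pi / 2) with hb
  set g := γ * (Real.pi / 2) with hg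
  have hsin : 0 < Real.sin b := Real.sin_pos_of_pos_of_lt_pi (by positivity) (by nlinarith)
  have hcos : Real.cos b < 0 :=
    Real.cos_neg_of_pi_div_two_lt_of_lt (by nlinarith) (by nlinarith)
  have hD : 0 < -(2 * Real.sin b * Real.cos b) := by nlinarith
  -- This solves the real system `(A + B) cos b = -cos g`, `(A - B) sin b = -sin g`. The condition
  -- `|γ| ≤ 2 - β` says that `b ± g ≤ π`, and with `β > 1` it gives `b ± g ≥ 0`, whence the signs.
  refine ⟨Real.sin (b + g) / -(2 * Real.sin b * Real.cos b),
    Real.sin (b - g) / -(2 * Real.sin b * Real.cos b), ?_, ?_, ?_⟩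
  · exact div_nonneg (Real.sin_nonneg_of_nonneg_of_le_pi (by nlinarith) (by nlinarith)) hD.le
  · exact div_nonneg (Real.sin_nonneg_of_nonneg_of_le_pi (by nlinarith) (by nlinarith)) hD.le
  · have e1 : ∀ y : ℝ, Complex.exp (Complex.I * (y : ℂ)) =
        (Real.cos y : ℂ) + (Real.sin y : ℂ) * Complex.I := fun y => by
      rw [mul_comm, Complex.exp_mul_I, Complex.ofReal_cos, Complex.ofReal_sin]
    have e2 : Complex.exp (-(Complex.I * (b : ℂ))) =
        (Real.cos b : ℂ) - (Real.sin b : ℂ) * Complex.I := by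
      rw [show -(Complex.I * (b : ℂ)) = Complex.I * ((-b : ℝ) : ℂ) by push_cast; ring, e1,
        Real.cos_neg, Real.sin_neg]
      push_cast
      ring
    rw [e1, e2, e1, Real.sin_add, Real.sin_sub]
    have hs' : ((Real.sin b : ℝ) : ℂ) ≠ 0 := by exact_mod_cast hsin.ne'
    have hc' : ((Real.cos b : ℝ) : ℂ) ≠ 0 := by exact_mod_cast hcos.ne
    clear e1 e2 hD hsin hcos
    generalize Real.sin b = sb at *
    generalize Real.cos b = cb at *
    generalize Real.sin g = sg at *
    generalize Real.cos g = cg at *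
    push_cast
    field_simp
    ring

lemma isStableKernel_rieszFeller {β γ ε : ℝ} (h1 : 1 < β) (h2 : β ≤ 2)
    (hγ : |γ| ≤ min β (2 - β)) (hε : 0 < ε) :
    IsStableKernel (kernel fun ξ => (ε : ℂ) * rieszFellerSymbol β γ ξ) (1 / β) := by
  obtain ⟨A, B, hA, hB, hAB⟩ := exists_rieszFeller_coeff h1 h2 hγ
  have hβ : β ≠ 0 := by linarith
  refine (isStableSymbol_rieszFeller h1 hγ hε).isStableKernel h2 (mul_nonneg hε.le hA)
    (mul_nonneg hε.le hB) fun ξ => ?_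
  have key : ∀ ξ : ℝ, 0 ≤ ξ → rieszFellerSymbol β γ ξ = A * (Complex.I * ξ) ^ (β : ℂ) +
      B * (Complex.I * ((-ξ : ℝ) : ℂ)) ^ (β : ℂ) := fun ξ hξ => by
    rw [I_mul_cpow_of_nonneg hβ hξ, I_mul_neg_cpow_of_nonneg hβ hξ]
    rcases hξ.eq_or_lt with rfl | hξ
    · simp [rieszFellerSymbol_zero (by linarith : 0 < β), Real.zero_rpow hβ]
    · rw [rieszFellerSymbol_of_pos hξ, ← hAB]
      ring
  have hconj : ∀ ξ : ℝ, 0 ≤ ξ → conj ((Complex.I * ξ) ^ (β : ℂ)) =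
      (Complex.I * ((-ξ : ℝ) : ℂ)) ^ (β : ℂ) := fun ξ hξ => by
    rw [I_mul_cpow_of_nonneg hβ hξ, I_mul_neg_cpow_of_nonneg hβ hξ, map_mul, Complex.conj_ofReal,
      ← Complex.exp_conj, map_mul, Complex.conj_I, Complex.conj_ofReal, neg_mul]
  rcases le_total 0 ξ with hξ | hξ
  · rw [key ξ hξ]
    push_cast
    ring
  · have h3 : 0 ≤ -ξ := by linarith
    have h4 := rieszFellerSymbol_neg (β := β) (γ := γ) (-ξ)
    rw [neg_neg, key _ h3, map_add, map_mul, map_mul, Complex.conj_ofReal, Complex.conj_ofReal,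
      hconj _ h3, ← hconj _ h3, Complex.conj_conj, hconj _ h3, neg_neg] at h4
    rw [h4]
    push_cast
    ring

/-- Lowering the phase `(α + 1)π/2` by `π` produces the minus sign of the Riesz–Feller form. The
resulting skewness has `|α - 1| = 2 - β` with `β = α + 1`, the extreme admissible value. -/
lemma caputoSymbol_eq_rieszFellerSymbol {α : ℝ} (h0 : 0 < α) :
    caputoSymbol α = rieszFellerSymbol (α + 1) (α - 1) := by
  have hβ : α + 1 ≠ 0 := by linarith
  have hexp : Complex.exp (Complex.I * (((α - 1) * (Real.pi / 2) : ℝ) : ℂ)) =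
      -Complex.exp (Complex.I * (((α + 1) * (Real.pi / 2) : ℝ) : ℂ)) := by
    rw [show Complex.I * (((α - 1) * (Real.pi / 2) : ℝ) : ℂ) =
      Complex.I * (((α + 1) * (Real.pi / 2) : ℝ) : ℂ) - Real.pi * Complex.I by push_cast; ring,
      Complex.exp_sub, Complex.exp_pi_mul_I]
    ring
  ext ξ
  have hcast : ((α : ℂ) + 1) = ((α + 1 : ℝ) : ℂ) := by push_cast; ring
  rw [caputoSymbol, hcast]
  rcases lt_trichotomy ξ 0 with hξ | rfl | hξ
  · have h3 : 0 < -ξ := by linarith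
    have h4 := rieszFellerSymbol_neg (β := α + 1) (γ := α - 1) (-ξ)
    rw [neg_neg, rieszFellerSymbol_of_pos h3, hexp, neg_neg, map_mul, Complex.conj_ofReal,
      ← Complex.exp_conj, map_mul, Complex.conj_I, Complex.conj_ofReal, neg_mul] at h4
    rw [h4]
    have h5 := I_mul_neg_cpow_of_nonneg hβ h3.le
    rw [neg_neg] at h5
    rw [h5, mul_comm]
  · rw [rieszFellerSymbol_zero (by linarith)]
    have : ((α + 1 : ℝ) : ℂ) ≠ 0 := by exact_mod_cast hβ
    rw [Complex.ofReal_zero, mul_zero, Complex.zero_cpow this]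
  · rw [rieszFellerSymbol_of_pos hξ, hexp, neg_neg, I_mul_cpow_of_nonneg hβ hξ.le, mul_comm]

/-- Both families of symbols generate stable convolution semigroups. -/
lemma exists_isStableKernel {ψ : ℝ → ℂ}
    (hψ : (∃ α : ℝ, 0 < α ∧ α < 1 ∧ ψ = caputoSymbol α) ∨
      (∃ β γ : ℝ, 1 < β ∧ β ≤ 2 ∧ |γ| ≤ min β (2 - β) ∧ ψ = rieszFellerSymbol β γ))
    {ε : ℝ} (hε : 0 < ε) : ∃ θ, IsStableKernel (kernel fun ξ => (ε : ℂ) * ψ ξ) θ := by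
  rcases hψ with ⟨α, h0, h1, rfl⟩ | ⟨β, γ, h1, h2, hγ, rfl⟩
  · rw [caputoSymbol_eq_rieszFellerSymbol h0]
    refine ⟨_, isStableKernel_rieszFeller (by linarith) (by linarith) ?_ hε⟩
    rw [abs_of_neg (by linarith)]
    exact le_min (by linarith) (by linarith)
  · exact ⟨_, isStableKernel_rieszFeller h1 h2 hγ hε⟩

/-! ### Continuity of translations and of convolutions. -/

section Translation

/-- Translations act continuously on `L¹`. -/
lemma tendsto_lintegral_translate {k : ℝ × ℝ → ℝ} (hk : Integrable k) :
    Tendsto (fun a : ℝ × ℝ => ∫⁻ p, ‖k (p - a) - k p‖ₑ) (𝓝 0) (𝓝 0) := by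
  have hm : MemLp k 1 volume := memLp_one_iff_integrable.2 hk
  have : Fact ((1 : ENNReal) ≠ ⊤) := ⟨ENNReal.one_ne_top⟩
  have hcont : Continuous fun a : ℝ × ℝ => DomAddAct.mk (-a) +ᵥ hm.toLp k :=
    (DomAddAct.mkHomeomorph.continuous.comp continuous_neg).vadd continuous_const
  have h0 := (hcont.tendsto 0).edist (tendsto_const_nhds (x := hm.toLp k))
  have h1 : edist (DomAddAct.mk (-(0 : ℝ × ℝ)) +ᵥ hm.toLp k) (hm.toLp k) = 0 := by
    rw [neg_zero, DomAddAct.mk_zero, zero_vadd, edist_self]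
  rw [h1] at h0
  refine h0.congr fun a => ?_
  rw [DomAddAct.mk_vadd_toLp, Lp.edist_toLp_toLp, eLpNorm_one_eq_lintegral_enorm]
  congr 1
  ext p
  simp [sub_eq_neg_add]

/-- Moving `p` translates `k`, and translation is continuous in `L¹`; no continuity of `F` is
needed. It yields the continuity of the Duhamel integral. -/
lemma continuous_convolution_bounded {k F : ℝ × ℝ → ℝ} (hk : Integrable k)
    (hF : AEStronglyMeasurable F volume) {M : ℝ} (hM : ∀ᵐ q, |F q| ≤ M) :
    Continuous fun p => ∫ q, k (p - q) * F q := by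
  have hInt : ∀ p, Integrable fun q => k (p - q) * F q := fun p =>
    (hk.comp_sub_left p).mul_bdd (c := M) hF hM
  rw [continuous_iff_continuousAt]
  intro p₀
  rw [ContinuousAt, tendsto_iff_edist_tendsto_0]
  have h1 : Tendsto (fun p : ℝ × ℝ => ENNReal.ofReal M * ∫⁻ q, ‖k (q - (p₀ - p)) - k q‖ₑ)
      (𝓝 p₀) (𝓝 0) := by
    have h2 : Tendsto (fun p : ℝ × ℝ => p₀ - p) (𝓝 p₀) (𝓝 0) := by
      have : Continuous fun p : ℝ × ℝ => p₀ - p := by fun_prop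
      simpa using this.tendsto p₀
    simpa using ENNReal.Tendsto.const_mul ((tendsto_lintegral_translate hk).comp h2)
      (Or.inr ENNReal.ofReal_ne_top)
  refine tendsto_of_tendsto_of_tendsto_of_le_of_le tendsto_const_nhds h1 (fun _ => zero_le)
    fun p => ?_
  rw [edist_eq_enorm_sub, ← integral_sub (hInt p) (hInt p₀)]
  refine (enorm_integral_le_lintegral_enorm _).trans ?_
  have hsub := lintegral_sub_left_eq_self (fun q => ‖k (q - (p₀ - p)) - k q‖ₑ) p₀
    (μ := (volume : Measure (ℝ × ℝ)))
  rw [← hsub, ← lintegral_const_mul' _ _ ENNReal.ofReal_ne_top]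
  refine lintegral_mono_ae ?_
  filter_upwards [hM] with q hq
  rw [← sub_mul, enorm_mul, mul_comm, show p₀ - q - (p₀ - p) = p - q by abel]
  gcongr
  rw [← ofReal_norm]
  exact ENNReal.ofReal_le_ofReal hq

end Translation

/-! ### Laplace-weighted space-time kernels. -/

section Scaled

/-- The space-time kernel `exp(-λt) t^(-ρ) t^(-θ) G(t^(-θ) x)` for `t > 0`. -/
def scaledKernel (G : ℝ → ℝ) (θ ρ lam : ℝ) (p : ℝ × ℝ) : ℝ :=
  if 0 < p.1 then
    Real.exp (-(lam * p.1)) * p.1 ^ (-ρ) * (p.1 ^ (-θ) * G (p.1 ^ (-θ) * p.2)) else 0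

variable {G : ℝ → ℝ} {θ ρ lam : ℝ}

lemma measurable_scaledKernel (hG : Measurable G) : Measurable (scaledKernel G θ ρ lam) := by
  refine Measurable.ite (measurableSet_lt measurable_const measurable_fst) ?_ measurable_const
  have h1 : ∀ s : ℝ, Measurable fun p : ℝ × ℝ => p.1 ^ s := fun s => measurable_fst.pow_const s
  have h2 : Measurable fun p : ℝ × ℝ => G (p.1 ^ (-θ) * p.2) :=
    hG.comp ((h1 (-θ)).mul measurable_snd)
  exact ((Real.measurable_exp.comp (measurable_fst.const_mul lam).neg).mul (h1 _)).mul
    ((h1 _).mul h2)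

lemma integral_norm_scaledKernel (t : ℝ) :
    ∫ x, ‖scaledKernel G θ ρ lam (t, x)‖ = (Ioi (0 : ℝ)).indicator
      (fun t => (t ^ ((1 - ρ) - 1) * Real.exp (-(lam * t))) * ∫ x, |G x|) t := by
  by_cases ht : 0 < t
  · rw [indicator_of_mem (mem_Ioi.2 ht)]
    have ha : 0 < t ^ (-θ) := by positivity
    have := Measure.integral_comp_mul_left (fun x => |G x|) (t ^ (-θ))
    rw [abs_of_pos (inv_pos.2 ha), smul_eq_mul] at this
    simp only [scaledKernel, ht, if_true, norm_mul, Real.norm_eq_abs]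
    simp_rw [integral_const_mul]
    rw [this, abs_of_pos ha, abs_of_pos (Real.exp_pos _),
      abs_of_pos (Real.rpow_pos_of_pos ht (-ρ))]
    rw [show 1 - ρ - 1 = -ρ by ring]
    field_simp
  · rw [indicator_of_notMem (by simpa using ht)]
    simp [scaledKernel, ht]

/-- The spatial norm at time `t` is a multiple of `t^(-ρ) exp(-λt)`: `ρ < 1` controls `t → 0` and `λ
> 0` controls `t → ∞`. The kernel has `ρ = 0`, its space derivative `ρ = θ`. -/
lemma integrable_scaledKernel (hG : Continuous G) (hGi : Integrable G) (hρ : ρ < 1)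
    (hl : 0 < lam) : Integrable (scaledKernel G θ ρ lam) := by
  rw [Measure.volume_eq_prod, integrable_prod_iff
    (measurable_scaledKernel hG.measurable).aestronglyMeasurable]
  constructor
  · refine ae_of_all _ fun t => ?_
    by_cases ht : 0 < t
    · simp only [scaledKernel, ht, if_true]
      have ha : t ^ (-θ) ≠ 0 := by positivity
      exact ((hGi.comp_mul_left' ha).const_mul _).const_mul _
    · simp [scaledKernel, ht]
  · simp_rw [integral_norm_scaledKernel]
    rw [integrable_indicator_iff measurableSet_Ioi]
    refine Integrable.mul_const ?_ _
    have := integrableOn_rpow_mul_exp_neg_mul_rpow (s := 1 - ρ - 1) (p := 1) (b := lam)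
      (by linarith) one_pos hl
    simp only [Real.rpow_one, neg_mul] at this
    exact this

lemma integral_norm_scaledKernel_eq (hG : Continuous G) (hGi : Integrable G) (hρ : ρ < 1)
    (hl : 0 < lam) : ∫ p, ‖scaledKernel G θ ρ lam p‖ =
      (1 / lam) ^ (1 - ρ) * Real.Gamma (1 - ρ) * ∫ x, |G x| := by
  have hi := (integrable_scaledKernel (θ := θ) hG hGi hρ hl).norm
  rw [Measure.volume_eq_prod] at hi ⊢
  rw [integral_prod _ hi]
  simp_rw [integral_norm_scaledKernel]
  rw [integral_indicator measurableSet_Ioi, integral_mul_const,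
    Real.integral_rpow_mul_exp_neg_mul_Ioi (by linarith) hl]

end Scaled

/-- The space-time kernel `exp(-λt) K(t,x)`, `t > 0`. -/
def spaceTimeKernel (K : ℝ → ℝ → ℝ) (lam : ℝ) (p : ℝ × ℝ) : ℝ :=
  if 0 < p.1 then Real.exp (-(lam * p.1)) * K p.1 p.2 else 0

/-- The space-time kernel `exp(-λt) ∂ₓK(t,x)`, `t > 0`. -/
def spaceTimeKernelDeriv (K : ℝ → ℝ → ℝ) (lam : ℝ) (p : ℝ × ℝ) : ℝ :=
  if 0 < p.1 then Real.exp (-(lam * p.1)) * deriv (K p.1) p.2 else 0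

lemma integrable_of_abs_le_inv_one_add_sq {G : ℝ → ℝ} (hG : Continuous G)
    (hb : ∃ C, ∀ x, |G x| ≤ C * (1 + x ^ 2)⁻¹) : Integrable G := by
  obtain ⟨C, hC⟩ := hb
  exact (integrable_inv_one_add_sq.const_mul C).mono' hG.aestronglyMeasurable (ae_of_all _ hC)

namespace IsStableKernel

variable {K : ℝ → ℝ → ℝ} {θ lam μ : ℝ}

lemma spaceTimeKernel_eq (h : IsStableKernel K θ) :
    spaceTimeKernel K lam = scaledKernel (K 1) θ 0 lam := by
  ext p
  simp only [spaceTimeKernel, scaledKernel]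
  split_ifs with hp
  · rw [h.scaling p.1 hp, neg_zero, Real.rpow_zero, mul_one]
  · rfl

lemma spaceTimeKernelDeriv_eq (h : IsStableKernel K θ) :
    spaceTimeKernelDeriv K lam = scaledKernel (deriv (K 1)) θ θ lam := by
  ext p
  simp only [spaceTimeKernelDeriv, scaledKernel]
  split_ifs with hp
  · rw [h.deriv_scaling p.1 hp]
    ring
  · rfl

lemma measurable_spaceTimeKernel (h : IsStableKernel K θ) : Measurable (spaceTimeKernel K lam) := by
  rw [h.spaceTimeKernel_eq]
  exact measurable_scaledKernel h.continuous_one.measurable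

lemma measurable_spaceTimeKernelDeriv (h : IsStableKernel K θ) :
    Measurable (spaceTimeKernelDeriv K lam) := by
  rw [h.spaceTimeKernelDeriv_eq]
  exact measurable_scaledKernel h.continuous_deriv_one.measurable

lemma integrable_spaceTimeKernel (h : IsStableKernel K θ) (hl : 0 < lam) :
    Integrable (spaceTimeKernel K lam) := by
  rw [h.spaceTimeKernel_eq]
  exact integrable_scaledKernel h.continuous_one
    (integrable_of_abs_le_inv_one_add_sq h.continuous_one h.bound) one_pos hl

lemma integrable_spaceTimeKernelDeriv (h : IsStableKernel K θ) (hl : 0 < lam) :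
    Integrable (spaceTimeKernelDeriv K lam) := by
  rw [h.spaceTimeKernelDeriv_eq]
  exact integrable_scaledKernel h.continuous_deriv_one
    (integrable_of_abs_le_inv_one_add_sq h.continuous_deriv_one h.deriv_bound) h.theta_lt_one hl

lemma nonneg_spaceTimeKernel (h : IsStableKernel K θ) (p : ℝ × ℝ) :
    0 ≤ spaceTimeKernel K lam p := by
  simp only [spaceTimeKernel]
  split_ifs with hp
  · exact mul_nonneg (Real.exp_nonneg _) (h.nonneg _ hp _)
  · exact le_rfl

lemma integrable_kernel (h : IsStableKernel K θ) {t : ℝ} (ht : 0 < t) : Integrable (K t) := by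
  rw [funext (h.scaling t ht)]
  exact ((integrable_of_abs_le_inv_one_add_sq h.continuous_one h.bound).comp_mul_left'
    (Real.rpow_pos_of_pos ht _).ne').const_mul _

lemma continuous_kernel (h : IsStableKernel K θ) {t : ℝ} (ht : 0 < t) : Continuous (K t) := by
  rw [funext (h.scaling t ht)]
  have := h.continuous_one
  fun_prop

lemma continuous_deriv_kernel (h : IsStableKernel K θ) {t : ℝ} (ht : 0 < t) :
    Continuous (deriv (K t)) := by
  rw [funext (h.deriv_scaling t ht)]
  have := h.continuous_deriv_one
  fun_prop

lemma exists_abs_kernel_le (h : IsStableKernel K θ) {t : ℝ} (ht : 0 < t) :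
    ∃ C, ∀ x, |K t x| ≤ C := by
  obtain ⟨C, hC⟩ := h.bound
  have hC0 : 0 ≤ C := by
    have := (abs_nonneg _).trans (hC 0)
    simpa using this
  refine ⟨t ^ (-θ) * C, fun x => ?_⟩
  have ha : 0 < t ^ (-θ) := by positivity
  rw [h.scaling t ht, abs_mul, abs_of_pos ha]
  gcongr
  refine (hC _).trans (mul_le_of_le_one_right hC0 (inv_le_one_of_one_le₀ ?_))
  nlinarith [sq_nonneg (t ^ (-θ) * x)]

/-- Positivity and unit mass enter here: the slice norm is exactly `exp(-λt)`, and this is the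
origin of the constant `1` in the contraction. -/
lemma lintegral_enorm_spaceTimeKernel (h : IsStableKernel K θ) (t : ℝ) :
    ∫⁻ x, ‖spaceTimeKernel K lam (t, x)‖ₑ =
      (Ioi (0 : ℝ)).indicator (fun t => ENNReal.ofReal (Real.exp (-(lam * t)))) t := by
  by_cases ht : 0 < t
  · rw [indicator_of_mem (mem_Ioi.2 ht)]
    have hi : Integrable fun x => spaceTimeKernel K lam (t, x) := by
      simp only [spaceTimeKernel, ht, if_true]
      exact (h.integrable_kernel ht).const_mul _
    rw [← ofReal_integral_norm_eq_lintegral_enorm hi]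
    congr 1
    simp_rw [Real.norm_of_nonneg (h.nonneg_spaceTimeKernel _)]
    simp only [spaceTimeKernel, ht, if_true]
    rw [integral_const_mul, h.integral_eq_one t ht, mul_one]
  · rw [indicator_of_notMem (by simpa using ht)]
    simp [spaceTimeKernel, ht]

/-- Smallness of the gradient kernel for large `λ`. -/
lemma exists_integral_norm_spaceTimeKernelDeriv_le (h : IsStableKernel K θ) (L : ℝ) :
    ∃ lam, 0 < lam ∧ L * ∫ p, ‖spaceTimeKernelDeriv K lam p‖ ≤ 1 / 2 := by
  have hGi := integrable_of_abs_le_inv_one_add_sq h.continuous_deriv_one h.deriv_bound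
  -- The gradient kernel has norm `λ^(θ-1) Γ(1-θ) ‖∂ₓK(1,·)‖₁`, which tends to `0` because `θ < 1`.
  have h1 : Tendsto (fun lam : ℝ => L * ((1 / lam) ^ (1 - θ) * Real.Gamma (1 - θ) *
      ∫ x, |deriv (K 1) x|)) atTop (𝓝 0) := by
    have h2 : Tendsto (fun lam : ℝ => (1 / lam) ^ (1 - θ)) atTop (𝓝 0) := by
      have h3 : Tendsto (fun lam : ℝ => 1 / lam) atTop (𝓝 0) := by
        simpa using tendsto_inv_atTop_zero (𝕜 := ℝ)
      have h4 := h3.rpow_const (p := 1 - θ) (Or.inr (by linarith [h.theta_lt_one]))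
      rwa [Real.zero_rpow (by linarith [h.theta_lt_one])] at h4
    simpa using ((h2.mul_const (Real.Gamma (1 - θ))).mul_const
      (∫ x, |deriv (K 1) x|)).const_mul L
  obtain ⟨lam, hlam, hlam0⟩ := ((h1.eventually_le_const (by norm_num : (0 : ℝ) < 1 / 2)).and
    (eventually_gt_atTop 0)).exists
  refine ⟨lam, hlam0, ?_⟩
  rwa [h.spaceTimeKernelDeriv_eq, integral_norm_scaledKernel_eq h.continuous_deriv_one hGi
    h.theta_lt_one hlam0]

lemma integral_norm_spaceTimeKernel (h : IsStableKernel K θ) (hl : 0 < lam) :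
    ∫ p, ‖spaceTimeKernel K lam p‖ = 1 / lam := by
  have h1 : ∫ x, |K 1 x| = 1 := by
    refine Eq.trans ?_ (h.integral_eq_one 1 one_pos)
    simp_rw [abs_of_nonneg (h.nonneg 1 one_pos _)]
  rw [h.spaceTimeKernel_eq, integral_norm_scaledKernel_eq h.continuous_one
    (integrable_of_abs_le_inv_one_add_sq h.continuous_one h.bound) one_pos hl, h1]
  simp

/-- The resolvent identity for the Laplace-weighted kernels. -/
lemma resolvent_identity (h : IsStableKernel K θ) (hμ : 0 < μ) (p : ℝ × ℝ) :
    ∫ q, spaceTimeKernel K lam (p - q) * spaceTimeKernel K (lam + μ) q =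
      μ⁻¹ * (spaceTimeKernel K lam p - spaceTimeKernel K (lam + μ) p) := by
  obtain ⟨t, x⟩ := p
  have hmem : ∀ s y : ℝ, s ∈ Ioo 0 t →
      spaceTimeKernel K lam ((t, x) - (s, y)) * spaceTimeKernel K (lam + μ) (s, y) =
        (Real.exp (-(lam * t)) * Real.exp (-(μ * s))) * (K (t - s) (x - y) * K s y) := by
    intro s y hs
    have h1 : 0 < t - s := by linarith [hs.2]
    simp only [spaceTimeKernel, Prod.mk_sub_mk, h1, hs.1, if_true]
    rw [mul_mul_mul_comm, ← Real.exp_add, ← Real.exp_add]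
    congr 2
    ring
  have hnot : ∀ s y : ℝ, s ∉ Ioo 0 t →
      spaceTimeKernel K lam ((t, x) - (s, y)) * spaceTimeKernel K (lam + μ) (s, y) = 0 := by
    intro s y hs
    simp only [spaceTimeKernel, Prod.mk_sub_mk]
    by_cases h1 : 0 < s
    · have h2 : ¬ 0 < t - s := fun h2 => hs ⟨h1, by linarith⟩
      simp [h2]
    · simp [h1]
  -- By the semigroup law the spatial integral depends on `s` only through `exp(-μs)`.
  have hinner : ∀ s : ℝ,
      ∫ y, spaceTimeKernel K lam ((t, x) - (s, y)) * spaceTimeKernel K (lam + μ) (s, y) =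
        (Ioo 0 t).indicator
          (fun s => Real.exp (-(lam * t)) * K t x * Real.exp (-(μ * s))) s := by
    intro s
    by_cases hs : s ∈ Ioo 0 t
    · rw [indicator_of_mem hs]
      simp_rw [hmem s _ hs]
      rw [integral_const_mul, h.semigroup s (t - s) hs.1 (by linarith [hs.2]), sub_add_cancel]
      ring
    · rw [indicator_of_notMem hs]
      simp_rw [hnot s _ hs]
      simp
  have hInt : Integrable (fun q : ℝ × ℝ =>
      spaceTimeKernel K lam ((t, x) - q) * spaceTimeKernel K (lam + μ) q) (volume.prod volume) := by
    have hmeas : Measurable fun q : ℝ × ℝ =>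
        spaceTimeKernel K lam ((t, x) - q) * spaceTimeKernel K (lam + μ) q :=
      (h.measurable_spaceTimeKernel.comp (measurable_const.sub measurable_id)).mul
        h.measurable_spaceTimeKernel
    rw [integrable_prod_iff hmeas.aestronglyMeasurable]
    constructor
    · refine ae_of_all _ fun s => ?_
      by_cases hs : s ∈ Ioo 0 t
      · simp_rw [hmem s _ hs]
        refine Integrable.const_mul ?_ _
        have h1 : 0 < t - s := by linarith [hs.2]
        obtain ⟨C, hC⟩ := h.exists_abs_kernel_le h1
        exact (h.integrable_kernel hs.1).bdd_mul (c := C)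
          ((h.continuous_kernel h1).comp (by fun_prop)).aestronglyMeasurable
          (ae_of_all _ fun y => hC _)
      · simp_rw [hnot s _ hs]
        simp
    · simp_rw [Real.norm_of_nonneg (mul_nonneg (h.nonneg_spaceTimeKernel _)
        (h.nonneg_spaceTimeKernel _)), hinner]
      rw [integrable_indicator_iff measurableSet_Ioo]
      refine Continuous.integrableOn_Icc (a := 0) (b := t) (by fun_prop) |>.mono_set Ioo_subset_Icc_self
  rw [Measure.volume_eq_prod, integral_prod _ hInt]
  simp_rw [hinner]
  rw [integral_indicator measurableSet_Ioo, integral_const_mul]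
  by_cases ht : 0 < t
  · rw [← integral_Ioc_eq_integral_Ioo, ← intervalIntegral.integral_of_le ht.le]
    have hd : ∀ s : ℝ, HasDerivAt (fun s : ℝ => -μ⁻¹ * Real.exp (-(μ * s)))
        (Real.exp (-(μ * s))) s := fun s => by
      have := (((hasDerivAt_id s).const_mul μ).neg.exp).const_mul (-μ⁻¹)
      refine this.congr_deriv ?_
      simp only [Pi.neg_apply, id]
      field_simp
    rw [intervalIntegral.integral_eq_sub_of_hasDerivAt (fun s _ => hd s)
      (Continuous.intervalIntegrable (by fun_prop) _ _)]
    simp only [spaceTimeKernel, ht, if_true]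
    rw [show -((lam + μ) * t) = -(lam * t) + -(μ * t) by ring, Real.exp_add]
    simp only [mul_zero, neg_zero, Real.exp_zero]
    ring
  · rw [Ioo_eq_empty (by linarith)]
    simp [spaceTimeKernel, ht]

/-- First-order Taylor formula for spatial shifts of the kernel, in `L¹`. -/
lemma lintegral_taylor_le (h : IsStableKernel K θ) {a : ℝ} {δ : ENNReal}
    (hδ : ∀ b : ℝ, |b| ≤ |a| → ∫⁻ p, ‖spaceTimeKernelDeriv K lam (p - (0, b)) -
      spaceTimeKernelDeriv K lam p‖ₑ ≤ δ) :
    ∫⁻ p, ‖spaceTimeKernel K lam (p - (0, a)) - spaceTimeKernel K lam p +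
      a * spaceTimeKernelDeriv K lam p‖ₑ ≤ ‖a‖ₑ * δ := by
  -- The fundamental theorem of calculus along the shifts `r a`, `0 ≤ r ≤ 1`; only these shifts
  -- occur, so a modulus of continuity for `|b| ≤ |a|` is sufficient.
  have hpt : ∀ p : ℝ × ℝ, spaceTimeKernel K lam (p - (0, a)) - spaceTimeKernel K lam p +
      a * spaceTimeKernelDeriv K lam p = -a * ∫ r in (0 : ℝ)..1,
        (spaceTimeKernelDeriv K lam (p - (0, r * a)) - spaceTimeKernelDeriv K lam p) := by
    rintro ⟨t, x⟩
    by_cases ht : 0 < t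
    · simp only [spaceTimeKernel, spaceTimeKernelDeriv, Prod.mk_sub_mk, sub_zero, ht, if_true]
      have hc := h.continuous_deriv_kernel ht
      have hd : ∀ r : ℝ, HasDerivAt (fun r : ℝ => Real.exp (-(lam * t)) * K t (x - r * a) +
          r * (a * (Real.exp (-(lam * t)) * deriv (K t) x)))
          (-a * (Real.exp (-(lam * t)) * deriv (K t) (x - r * a) -
            Real.exp (-(lam * t)) * deriv (K t) x)) r := fun r => by
        have h1 : HasDerivAt (fun r : ℝ => x - r * a) (-a) r := by
          simpa using ((hasDerivAt_id r).mul_const a).const_sub x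
        have h2 := ((h.hasDerivAt t ht (x - r * a)).comp r h1).const_mul (Real.exp (-(lam * t)))
        have h3 := (hasDerivAt_id r).mul_const (a * (Real.exp (-(lam * t)) * deriv (K t) x))
        refine (h2.add h3).congr_deriv ?_
        ring
      have := intervalIntegral.integral_eq_sub_of_hasDerivAt (a := 0) (b := 1) (fun r _ => hd r)
        (Continuous.intervalIntegrable (by fun_prop) _ _)
      rw [intervalIntegral.integral_const_mul] at this
      rw [this]
      ring_nf
    · simp [spaceTimeKernel, spaceTimeKernelDeriv, ht]
  have hm : Measurable fun z : (ℝ × ℝ) × ℝ => ‖spaceTimeKernelDeriv K lam (z.1 - (0, z.2 * a)) -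
      spaceTimeKernelDeriv K lam z.1‖ₑ := by
    have h1 : Measurable fun z : (ℝ × ℝ) × ℝ => z.1 - ((0 : ℝ), z.2 * a) := by fun_prop
    exact ((h.measurable_spaceTimeKernelDeriv.comp h1).sub
      (h.measurable_spaceTimeKernelDeriv.comp measurable_fst)).enorm
  calc _ ≤ ∫⁻ p, ‖a‖ₑ * ∫⁻ r in Ioc (0 : ℝ) 1,
        ‖spaceTimeKernelDeriv K lam (p - (0, r * a)) - spaceTimeKernelDeriv K lam p‖ₑ := by
        refine lintegral_mono fun p => ?_
        simp only
        rw [hpt, enorm_mul, enorm_neg, intervalIntegral.integral_of_le zero_le_one]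
        gcongr
        exact enorm_integral_le_lintegral_enorm _
    _ = ‖a‖ₑ * ∫⁻ r in Ioc (0 : ℝ) 1, ∫⁻ p,
        ‖spaceTimeKernelDeriv K lam (p - (0, r * a)) - spaceTimeKernelDeriv K lam p‖ₑ := by
        rw [lintegral_const_mul' _ _ enorm_ne_top, lintegral_lintegral_swap hm.aemeasurable]
    _ ≤ ‖a‖ₑ * ∫⁻ _ in Ioc (0 : ℝ) 1, δ := by
        refine mul_le_mul_right ?_ _
        refine setLIntegral_mono measurable_const fun r hr => hδ _ ?_
        rw [abs_mul, abs_of_pos hr.1]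
        exact mul_le_of_le_one_left (abs_nonneg _) hr.2
    _ = ‖a‖ₑ * δ := by simp

end IsStableKernel

/-! ### Integral operators on `L¹` with displaced sources. -/

section IntegralOperators

variable {X Y : Type*} [MeasurableSpace X] [MeasurableSpace Y] {μ : Measure X} {ν : Measure Y}

/-- The operator `F ↦ ∫ k(p - σ(y)) F(y) dν(y)`. -/
def shiftOp (k : ℝ × ℝ → ℝ) (σ : Y → ℝ × ℝ) (ν : Measure Y) (F : Y → ℝ) (p : ℝ × ℝ) : ℝ :=
  ∫ y, k (p - σ y) * F y ∂ν

lemma shiftOp_congr {k : ℝ × ℝ → ℝ} {σ : Y → ℝ × ℝ} {F F' : Y → ℝ} (h : F =ᵐ[ν] F') :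
    shiftOp k σ ν F = shiftOp k σ ν F' := by
  ext p
  refine integral_congr_ae ?_
  filter_upwards [h] with y hy
  rw [hy]

variable [SFinite μ] [SFinite ν]

/-- Schur's bound for integral operators on `L¹`. -/
lemma lintegral_enorm_integral_mul_le {R : X → Y → ℝ} (hR : Measurable (Function.uncurry R))
    {F : Y → ℝ} (hF : AEStronglyMeasurable F ν) {C : Y → ENNReal}
    (hC : ∀ y, ∫⁻ x, ‖R x y‖ₑ ∂μ ≤ C y) :
    ∫⁻ x, ‖∫ y, R x y * F y ∂ν‖ₑ ∂μ ≤ ∫⁻ y, C y * ‖F y‖ₑ ∂ν := by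
  have hm : AEMeasurable (Function.uncurry fun x y => ‖R x y * F y‖ₑ) (μ.prod ν) :=
    (hR.aestronglyMeasurable.mul hF.comp_snd).enorm
  calc _ ≤ ∫⁻ x, ∫⁻ y, ‖R x y * F y‖ₑ ∂ν ∂μ :=
        lintegral_mono fun x => enorm_integral_le_lintegral_enorm _
    _ = ∫⁻ y, ∫⁻ x, ‖R x y * F y‖ₑ ∂μ ∂ν := lintegral_lintegral_swap hm
    _ ≤ _ := by
        refine lintegral_mono fun y => ?_
        simp only [enorm_mul]
        rw [lintegral_mul_const' _ _ enorm_ne_top]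
        gcongr
        exact hC y

variable {k k' : ℝ × ℝ → ℝ} {σ : Y → ℝ × ℝ} {F : Y → ℝ}

lemma measurable_uncurry_shift (hk : Measurable k) (hσ : Measurable σ) :
    Measurable (Function.uncurry fun (p : ℝ × ℝ) (y : Y) => k (p - σ y)) :=
  hk.comp (measurable_fst.sub (hσ.comp measurable_snd))

/-- By translation invariance each source contributes the norm of `k`, wherever `σ` sends it. The
choices of `σ` needed are the identity (convolution), `initialSlice` (initial data) and `q ↦ q + (0,
τ g(q))` (jumps). -/
lemma integrable_shift_mul (hk : Measurable k) (hki : Integrable k) (hσ : Measurable σ)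
    (hF : Integrable F ν) :
    Integrable (fun z : (ℝ × ℝ) × Y => k (z.1 - σ z.2) * F z.2) (volume.prod ν) := by
  have hm : AEStronglyMeasurable (fun z : (ℝ × ℝ) × Y => k (z.1 - σ z.2) * F z.2)
      (volume.prod ν) :=
    (measurable_uncurry_shift hk hσ).aestronglyMeasurable.mul hF.1.comp_snd
  rw [integrable_prod_iff' hm]
  refine ⟨ae_of_all _ fun y => (hki.comp_sub_right (σ y)).mul_const (F y), ?_⟩
  refine (hF.norm.const_mul (∫ p, ‖k p‖)).congr (ae_of_all _ fun y => ?_)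
  simp only [norm_mul]
  rw [integral_mul_const, integral_sub_right_eq_self (fun p => ‖k p‖) (σ y)]

lemma integrable_shiftOp (hk : Measurable k) (hki : Integrable k) (hσ : Measurable σ)
    (hF : Integrable F ν) : Integrable (shiftOp k σ ν F) :=
  (integrable_shift_mul hk hki hσ hF).integral_prod_left

lemma ae_integrable_shift (hk : Measurable k) (hki : Integrable k) (hσ : Measurable σ)
    (hF : Integrable F ν) : ∀ᵐ p, Integrable (fun y => k (p - σ y) * F y) ν :=
  (integrable_shift_mul hk hki hσ hF).prod_right_ae

lemma shiftOp_sub (hk : Measurable k) (hki : Integrable k) (hσ : Measurable σ) {F' : Y → ℝ}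
    (hF : Integrable F ν) (hF' : Integrable F' ν) :
    ∀ᵐ p, shiftOp k σ ν F p - shiftOp k σ ν F' p = shiftOp k σ ν (F - F') p := by
  filter_upwards [ae_integrable_shift hk hki hσ hF, ae_integrable_shift hk hki hσ hF'] with p h1 h2
  rw [shiftOp, shiftOp, ← integral_sub h1 h2]
  simp only [shiftOp, Pi.sub_apply, mul_sub]

lemma lintegral_enorm_shiftOp_le (hk : Measurable k) (hσ : Measurable σ)
    (hF : AEStronglyMeasurable F ν) :
    ∫⁻ p, ‖shiftOp k σ ν F p‖ₑ ≤ (∫⁻ p, ‖k p‖ₑ) * ∫⁻ y, ‖F y‖ₑ ∂ν := by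
  have h := lintegral_enorm_integral_mul_le (μ := volume) (ν := ν)
    (measurable_uncurry_shift hk hσ) hF (C := fun _ => ∫⁻ p, ‖k p‖ₑ)
    fun y => le_of_eq (lintegral_sub_right_eq_self (fun p => ‖k p‖ₑ) (σ y))
  rwa [lintegral_const_mul'' _ hF.enorm] at h

lemma integral_norm_shiftOp_le (hk : Measurable k) (hki : Integrable k) (hσ : Measurable σ)
    (hF : Integrable F ν) :
    ∫ p, ‖shiftOp k σ ν F p‖ ≤ (∫ p, ‖k p‖) * ∫ y, ‖F y‖ ∂ν := by
  have h := lintegral_enorm_shiftOp_le (ν := ν) hk hσ hF.1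
  rw [← ofReal_integral_norm_eq_lintegral_enorm (integrable_shiftOp hk hki hσ hF),
    ← ofReal_integral_norm_eq_lintegral_enorm hki, ← ofReal_integral_norm_eq_lintegral_enorm hF,
    ← ENNReal.ofReal_mul (integral_nonneg fun _ => norm_nonneg _)] at h
  exact (ENNReal.ofReal_le_ofReal_iff (mul_nonneg (integral_nonneg fun _ => norm_nonneg _)
    (integral_nonneg fun _ => norm_nonneg _))).1 h

/-- Composition of a convolution with a shift operator. -/
lemma shiftOp_comp (hk : Measurable k) (hki : Integrable k) (hk' : Measurable k')
    (hki' : Integrable k') (hσ : Measurable σ) (hF : Integrable F ν) :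
    ∀ᵐ p, shiftOp k id volume (shiftOp k' σ ν F) p =
      shiftOp (fun r => ∫ q, k (r - q) * k' q) σ ν F p := by
  have h1 := integrable_shift_mul (ν := ν) hk' hki' hσ hF
  have h2 := integrable_shift_mul (ν := volume.prod ν) (σ := fun z : (ℝ × ℝ) × Y => z.1) hk hki
    measurable_fst h1
  filter_upwards [h2.prod_right_ae] with p hp
  simp only [shiftOp, id]
  simp_rw [← integral_const_mul]
  rw [integral_integral_swap hp]
  refine integral_congr_ae (ae_of_all _ fun y => ?_)
  simp only
  rw [← integral_mul_const,
    ← integral_sub_right_eq_self (fun q => k (p - σ y - q) * k' q * F y) (σ y)]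
  refine integral_congr_ae (ae_of_all _ fun q => ?_)
  simp only [sub_sub_sub_cancel_right, mul_assoc]

end IntegralOperators

/-! ### Fixed points in `L¹` and passage to the limit. -/

/-- Banach's fixed point theorem in `L¹`, for maps given on functions. -/
lemma exists_fixedPoint_integrable {X : Type*} [MeasurableSpace X] {μ : Measure X}
    {A : (X → ℝ) → X → ℝ} {r : ℝ} (hr0 : 0 ≤ r) (hr : r < 1)
    (hcongr : ∀ F G : X → ℝ, F =ᵐ[μ] G → A F =ᵐ[μ] A G)
    (hInt : ∀ F, Integrable F μ → Integrable (A F) μ)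
    (hcontr : ∀ F G, Integrable F μ → Integrable G μ →
      ∫ x, ‖A F x - A G x‖ ∂μ ≤ r * ∫ x, ‖F x - G x‖ ∂μ) :
    ∃ Z : X → ℝ, Integrable Z μ ∧ Z =ᵐ[μ] A Z ∧ ∃ ns : ℕ → ℕ, StrictMono ns ∧
      ∀ᵐ x ∂μ, Tendsto (fun n => A^[ns n] 0 x) atTop (𝓝 (Z x)) := by
  let Φ : (X →₁[μ] ℝ) → (X →₁[μ] ℝ) := fun f => (hInt f (L1.integrable_coeFn f)).toL1 (A f)
  have hΦ : ∀ f, Φ f =ᵐ[μ] A f := fun f => Integrable.coeFn_toL1 _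
  have hdist : ∀ f g : X →₁[μ] ℝ, dist f g = ∫ x, ‖f x - g x‖ ∂μ := fun f g => by
    rw [dist_eq_norm, L1.norm_eq_integral_norm]
    refine integral_congr_ae ?_
    filter_upwards [Lp.coeFn_sub f g] with x hx
    rw [hx, Pi.sub_apply]
  have hC : ContractingWith ⟨r, hr0⟩ Φ := by
    refine ⟨by exact_mod_cast hr, LipschitzWith.of_dist_le_mul fun f g => ?_⟩
    rw [hdist, hdist]
    refine le_trans (le_of_eq ?_) (hcontr f g (L1.integrable_coeFn f) (L1.integrable_coeFn g))
    refine integral_congr_ae ?_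
    filter_upwards [hΦ f, hΦ g] with x h1 h2
    rw [h1, h2]
  set Z := hC.fixedPoint
  have hiter : ∀ n : ℕ, (Φ^[n] 0 : X →₁[μ] ℝ) =ᵐ[μ] A^[n] 0 := fun n => by
    induction n with
    | zero => exact Lp.coeFn_zero _ _ _
    | succ n ih =>
      rw [Function.iterate_succ_apply', Function.iterate_succ_apply']
      exact (hΦ _).trans (hcongr _ _ ih)
  have htend := hC.tendsto_iterate_fixedPoint 0
  -- Almost everywhere convergence of a subsequence of the iterates is what lets bounds on iterates
  -- pass to the fixed point.
  obtain ⟨ns, hns, hae⟩ := (tendstoInMeasure_of_tendsto_Lp htend).exists_seq_tendsto_ae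
  refine ⟨Z, L1.integrable_coeFn Z, ?_, ns, hns, ?_⟩
  · have h1 := hΦ Z
    rwa [show Φ Z = Z from hC.fixedPoint_isFixedPt] at h1
  · filter_upwards [hae, ae_all_iff.2 hiter] with x h1 h2
    exact h1.congr fun n => h2 (ns n)

/-- Slicewise `L¹` bounds pass to almost everywhere limits. -/
lemma ae_lintegral_slice_le_of_tendsto {Z : ℕ → ℝ × ℝ → ℝ} {W : ℝ × ℝ → ℝ} {B : ℝ → ENNReal}
    (hZ : ∀ n, AEStronglyMeasurable (Z n) volume)
    (hB : ∀ n, ∀ᵐ t, ∫⁻ x, ‖Z n (t, x)‖ₑ ≤ B t)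
    (hlim : ∀ᵐ p, Tendsto (fun n => Z n p) atTop (𝓝 (W p))) :
    ∀ᵐ t, ∫⁻ x, ‖W (t, x)‖ₑ ≤ B t := by
  rw [Measure.volume_eq_prod] at hlim
  have hm : ∀ n, ∀ᵐ t, AEStronglyMeasurable (fun x => Z n (t, x)) volume := fun n => by
    have := hZ n
    rw [Measure.volume_eq_prod] at this
    exact this.prodMk_left
  filter_upwards [ae_all_iff.2 hB, ae_all_iff.2 hm, Measure.ae_ae_of_ae_prod hlim]
    with t h1 h2 h3
  calc ∫⁻ x, ‖W (t, x)‖ₑ ≤ ∫⁻ x, liminf (fun n => ‖Z n (t, x)‖ₑ) atTop := by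
        refine lintegral_mono_ae ?_
        filter_upwards [h3] with x hx
        exact (hx.enorm.liminf_eq).ge
    _ ≤ liminf (fun n => ∫⁻ x, ‖Z n (t, x)‖ₑ) atTop := lintegral_liminf_le' fun n => (h2 n).enorm
    _ ≤ B t := by
        refine (liminf_le_liminf (Eventually.of_forall h1)).trans ?_
        rw [liminf_const]

/-- Bounded solutions of a linear fixed point equation with small integrable kernel and integrable
inhomogeneity are integrable. -/
lemma integrable_of_bounded_fixedPoint {k g W W₀ : ℝ × ℝ → ℝ} {L M : ℝ} (hk : Measurable k)
    (hki : Integrable k) (hg : Measurable g) (hL : ∀ q, |g q| ≤ L)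
    (hsmall : L * ∫ p, ‖k p‖ ≤ 1 / 2) (hW₀ : Integrable W₀)
    (hW : AEStronglyMeasurable W volume) (hM : ∀ᵐ q, |W q| ≤ M)
    (hfix : ∀ᵐ p, W p = W₀ p - shiftOp k id volume (g * W) p) : Integrable W := by
  have hgmul : ∀ {F : ℝ × ℝ → ℝ}, Integrable F → Integrable (g * F) := fun hF =>
    hF.bdd_mul (c := L) hg.aestronglyMeasurable (ae_of_all _ hL)
  let A : (ℝ × ℝ → ℝ) → ℝ × ℝ → ℝ := fun F p => W₀ p - shiftOp k id volume (g * F) p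
  have hInt : ∀ F, Integrable F → Integrable (A F) := fun F hF =>
    hW₀.sub (integrable_shiftOp hk hki measurable_id (hgmul hF))
  obtain ⟨Z, hZ, -, ns, hns, hlim⟩ := exists_fixedPoint_integrable (μ := volume) (A := A)
    (r := 1 / 2) (by norm_num) (by norm_num) (fun F G hFG => by
      have : g * F =ᵐ[volume] g * G := by
        filter_upwards [hFG] with q hq
        simp [hq]
      simp only [A]
      rw [shiftOp_congr this]) hInt (fun F G hF hG => by
      have h1 : ∫ p, ‖A F p - A G p‖ = ∫ p, ‖shiftOp k id volume (g * G - g * F) p‖ := by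
        refine integral_congr_ae ?_
        filter_upwards [shiftOp_sub hk hki measurable_id (hgmul hG) (hgmul hF)] with p hp
        simp only [A]
        rw [← hp]
        congr 1
        ring
      rw [h1]
      refine (integral_norm_shiftOp_le hk hki measurable_id ((hgmul hG).sub (hgmul hF))).trans ?_
      have h2 : ∫ p, ‖(g * G - g * F) p‖ ≤ L * ∫ p, ‖F p - G p‖ := by
        rw [← integral_const_mul]
        refine integral_mono ((hgmul hG).sub (hgmul hF)).norm ((hF.sub hG).norm.const_mul L)
          fun q => ?_
        simp only [Pi.sub_apply, Pi.mul_apply]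
        rw [← mul_sub, norm_mul, norm_sub_rev]
        exact mul_le_mul_of_nonneg_right (hL q) (norm_nonneg _)
      have h3 : 0 ≤ ∫ p, ‖k p‖ := integral_nonneg fun _ => norm_nonneg _
      have h4 : 0 ≤ ∫ p, ‖F p - G p‖ := integral_nonneg fun _ => norm_nonneg _
      calc (∫ p, ‖k p‖) * ∫ p, ‖(g * G - g * F) p‖
          ≤ (∫ p, ‖k p‖) * (L * ∫ p, ‖F p - G p‖) := by gcongr
        _ = (L * ∫ p, ‖k p‖) * ∫ p, ‖F p - G p‖ := by ring
        _ ≤ _ := by gcongr)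
  have hiter : ∀ n : ℕ, Integrable (A^[n] 0) := fun n => by
    induction n with
    | zero => exact integrable_zero _ _ _
    | succ n ih =>
      rw [Function.iterate_succ_apply']
      exact hInt _ ih
  have hL0 : 0 ≤ L := (abs_nonneg _).trans (hL 0)
  have hM0 : 0 ≤ M := by
    obtain ⟨q, hq⟩ := hM.exists
    exact (abs_nonneg _).trans hq
  -- The same iterates approach `W` uniformly, by the same factor `1/2`. Hence their `L¹` limit is
  -- `W`, although `W` is not known in advance to be integrable.
  have hbound : ∀ n : ℕ, ∀ᵐ p, |W p - A^[n] 0 p| ≤ (1 / 2) ^ n * M := fun n => by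
    induction n with
    | zero => simpa using hM
    | succ n ih =>
      have hi := ae_integrable_shift (ν := volume) hk hki measurable_id (hgmul (hiter n))
      filter_upwards [hfix, hi] with p hp hip
      rw [Function.iterate_succ_apply', hp]
      simp only [A]
      have hWi : Integrable fun q => k (p - id q) * (g * W) q := by
        refine (hki.comp_sub_left p).mul_bdd (c := L * M) (hg.aestronglyMeasurable.mul hW) ?_
        filter_upwards [hM] with q hq
        rw [Pi.mul_apply, norm_mul]
        exact mul_le_mul (hL q) hq (norm_nonneg _) hL0
      rw [sub_sub_sub_cancel_left, shiftOp, shiftOp, ← integral_sub hip hWi, ← Real.norm_eq_abs]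
      refine (norm_integral_le_of_norm_le
        ((hki.comp_sub_left p).norm.mul_const (L * ((1 / 2) ^ n * M))) ?_).trans ?_
      · filter_upwards [ih] with q hq
        simp only [id, Pi.mul_apply]
        rw [← mul_sub, ← mul_sub, norm_mul, norm_mul, norm_sub_rev (A^[n] 0 q)]
        refine mul_le_mul_of_nonneg_left ?_ (norm_nonneg _)
        exact mul_le_mul (hL q) hq (norm_nonneg _) hL0
      · rw [integral_mul_const, integral_sub_left_eq_self (fun q => ‖k q‖) volume p, pow_succ]
        have h5 : 0 ≤ (1 / 2 : ℝ) ^ n * M := by positivity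
        nlinarith
  refine hZ.congr ?_
  filter_upwards [hlim, ae_all_iff.2 hbound] with p h1 h2
  refine tendsto_nhds_unique h1 ?_
  rw [tendsto_iff_norm_sub_tendsto_zero]
  have h3 : Tendsto (fun n : ℕ => (1 / 2 : ℝ) ^ n * M) atTop (𝓝 0) := by
    simpa using (tendsto_pow_atTop_nhds_zero_of_lt_one (r := (1 / 2 : ℝ)) (by norm_num)
      (by norm_num)).mul_const M
  refine squeeze_zero (fun _ => norm_nonneg _) (fun n => ?_) (h3.comp hns.tendsto_atTop)
  rw [norm_sub_rev]
  exact h2 (ns n)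

/-! ### Exponential weights and the regularized jump problem. -/

/-- The weight `exp(-λt)` for `t > 0`. -/
def expWeight (lam t : ℝ) : ENNReal :=
  (Ioi (0 : ℝ)).indicator (fun t => ENNReal.ofReal (Real.exp (-(lam * t)))) t

lemma measurable_expWeight (lam : ℝ) : Measurable (expWeight lam) :=
  Measurable.indicator (by fun_prop) measurableSet_Ioi

lemma expWeight_ne_top (lam t : ℝ) : expWeight lam t ≠ ⊤ := by
  unfold expWeight indicator
  split_ifs <;> simp

lemma lintegral_expWeight {lam : ℝ} (hl : 0 < lam) :
    ∫⁻ t, expWeight lam t = ENNReal.ofReal (1 / lam) := by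
  unfold expWeight
  rw [lintegral_indicator measurableSet_Ioi]
  have hi : IntegrableOn (fun t : ℝ => Real.exp (-(lam * t))) (Ioi 0) := by
    simpa only [neg_mul] using integrableOn_exp_mul_Ioi (a := -lam) (by linarith) 0
  rw [← ofReal_integral_eq_lintegral_ofReal hi (ae_of_all _ fun t => Real.exp_nonneg _)]
  have := integral_exp_mul_Ioi (a := -lam) (by linarith) 0
  simp only [neg_mul] at this
  rw [this]
  simp

/-- The renewal identity satisfied by exponential weights. -/
lemma expWeight_add_lintegral {lam μ : ℝ} (hμ : 0 < μ) (t : ℝ) :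
    expWeight (lam + μ) t +
      ENNReal.ofReal μ * ∫⁻ s, expWeight (lam + μ) (t - s) * expWeight lam s =
    expWeight lam t := by
  by_cases ht : 0 < t
  · have h1 : ∀ s : ℝ, expWeight (lam + μ) (t - s) * expWeight lam s = (Ioo 0 t).indicator
        (fun s => ENNReal.ofReal
          (Real.exp (-((lam + μ) * t)) * Real.exp (μ * s))) s := fun s => by
      by_cases hs : s ∈ Ioo 0 t
      · rw [indicator_of_mem hs, expWeight, expWeight,
          indicator_of_mem (mem_Ioi.2 (by linarith [hs.2])), indicator_of_mem (mem_Ioi.2 hs.1),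
          ← ENNReal.ofReal_mul (Real.exp_nonneg _), ← Real.exp_add, ← Real.exp_add]
        congr 2
        ring
      · rw [indicator_of_notMem hs, expWeight, expWeight]
        by_cases hs0 : 0 < s
        · rw [indicator_of_notMem (s := Ioi (0 : ℝ)) (a := t - s), zero_mul]
          intro h2
          exact hs ⟨hs0, by linarith [mem_Ioi.1 h2]⟩
        · rw [indicator_of_notMem (s := Ioi (0 : ℝ)) (a := s) hs0, mul_zero]
    have hd : ∀ s : ℝ, HasDerivAt (fun s : ℝ => Real.exp (-((lam + μ) * t)) *
        (μ⁻¹ * Real.exp (μ * s))) (Real.exp (-((lam + μ) * t)) * Real.exp (μ * s)) s := fun s => by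
      have := (((hasDerivAt_id s).const_mul μ).exp.const_mul μ⁻¹).const_mul
        (Real.exp (-((lam + μ) * t)))
      refine this.congr_deriv ?_
      simp only [id]
      field_simp
    simp_rw [h1]
    rw [lintegral_indicator measurableSet_Ioo, ← ofReal_integral_eq_lintegral_ofReal
      ((Continuous.integrableOn_Icc (a := 0) (b := t) (by fun_prop)).mono_set Ioo_subset_Icc_self)
      (ae_of_all _ fun s => by positivity), ← integral_Ioc_eq_integral_Ioo,
      ← intervalIntegral.integral_of_le ht.le,
      intervalIntegral.integral_eq_sub_of_hasDerivAt (fun s _ => hd s)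
        (Continuous.intervalIntegrable (by fun_prop) _ _), ← ENNReal.ofReal_mul hμ.le,
      expWeight, expWeight, indicator_of_mem (mem_Ioi.2 ht), indicator_of_mem (mem_Ioi.2 ht)]
    have h2 : μ * (Real.exp (-((lam + μ) * t)) * (μ⁻¹ * Real.exp (μ * t)) -
        Real.exp (-((lam + μ) * t)) * (μ⁻¹ * Real.exp (μ * 0))) =
        Real.exp (-(lam * t)) - Real.exp (-((lam + μ) * t)) := by
      rw [mul_zero, Real.exp_zero, show -(lam * t) = -((lam + μ) * t) + μ * t by ring, Real.exp_add]
      field_simp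
    have h3 : Real.exp (-((lam + μ) * t)) ≤ Real.exp (-(lam * t)) :=
      Real.exp_le_exp.2 (by nlinarith)
    rw [h2, ← ENNReal.ofReal_add (Real.exp_nonneg _) (by linarith)]
    congr 1
    ring
  · have h1 : ∀ s : ℝ, expWeight (lam + μ) (t - s) * expWeight lam s = 0 := fun s => by
      unfold expWeight
      by_cases hs : 0 < s
      · rw [indicator_of_notMem (s := Ioi (0 : ℝ)) (a := t - s), zero_mul]
        intro h2
        linarith [mem_Ioi.1 h2]
      · rw [indicator_of_notMem (s := Ioi (0 : ℝ)) (a := s) hs, mul_zero]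
    simp_rw [h1]
    simp [expWeight, ht]

/-- The embedding of `ℝ` as the initial time slice. -/
def initialSlice (y : ℝ) : ℝ × ℝ := (0, y)

lemma measurable_initialSlice : Measurable initialSlice := by
  unfold initialSlice
  fun_prop

namespace IsStableKernel

variable {K : ℝ → ℝ → ℝ} {θ lam μ : ℝ} {w₀ : ℝ → ℝ} {g : ℝ × ℝ → ℝ}

/-- A unit source at `σ(y)` contributes to the slice at time `t` its survival weight for the elapsed
time. Only the time component of `σ` matters, so purely spatial jumps cost nothing. -/
lemma lintegral_slice_shiftOp_le {Y : Type*} [MeasurableSpace Y] {ν : Measure Y} [SFinite ν]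
    (h : IsStableKernel K θ) {σ : Y → ℝ × ℝ} (hσ : Measurable σ) {F : Y → ℝ}
    (hF : AEStronglyMeasurable F ν) (t : ℝ) :
    ∫⁻ x, ‖shiftOp (spaceTimeKernel K lam) σ ν F (t, x)‖ₑ ≤
      ∫⁻ y, expWeight lam (t - (σ y).1) * ‖F y‖ₑ ∂ν := by
  refine lintegral_enorm_integral_mul_le (μ := volume) (ν := ν)
    (R := fun x y => spaceTimeKernel K lam ((t, x) - σ y)) ?_ hF fun y => ?_
  · exact h.measurable_spaceTimeKernel.comp
      ((measurable_const.prodMk measurable_fst).sub (hσ.comp measurable_snd))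
  · have h1 := lintegral_sub_right_eq_self
      (fun x => ‖spaceTimeKernel K lam (t - (σ y).1, x)‖ₑ) (σ y).2 (μ := (volume : Measure ℝ))
    rw [h.lintegral_enorm_spaceTimeKernel] at h1
    exact le_of_eq h1

/-- The regularized transport problem: its solution obeys the contraction estimate. -/
lemma exists_regularized_solution (h : IsStableKernel K θ) (hl : 0 < lam) (hμ : 0 < μ)
    (hw₀ : Integrable w₀) {σ : ℝ × ℝ → ℝ × ℝ} (hσ : Measurable σ) (hσ1 : ∀ q, (σ q).1 = q.1) :
    ∃ Z : ℝ × ℝ → ℝ, Integrable Z ∧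
      (∀ᵐ t, ∫⁻ x, ‖Z (t, x)‖ₑ ≤ expWeight lam t * ∫⁻ y, ‖w₀ y‖ₑ) ∧
      ∀ᵐ p, Z p = shiftOp (spaceTimeKernel K lam) initialSlice volume w₀ p +
        μ * (shiftOp (spaceTimeKernel K lam) σ volume Z p -
          shiftOp (spaceTimeKernel K lam) id volume Z p) := by
  have hlμ : 0 < lam + μ := by linarith
  set k := spaceTimeKernel K lam with hkdef
  set k' := spaceTimeKernel K (lam + μ) with hkdef'
  have hk : Measurable k := h.measurable_spaceTimeKernel
  have hk' : Measurable k' := h.measurable_spaceTimeKernel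
  have hki : Integrable k := h.integrable_spaceTimeKernel hl
  have hki' : Integrable k' := h.integrable_spaceTimeKernel hlμ
  have hι := measurable_initialSlice
  set a := shiftOp k' initialSlice volume w₀ with ha
  have hai : Integrable a := integrable_shiftOp hk' hki' hι hw₀
  -- Using `λ + μ` in the kernel absorbs the loss term, so that only the gain by jumps is iterated;
  -- its norm is `μ ‖k'‖₁ = μ/(λ + μ) < 1`.
  let A : (ℝ × ℝ → ℝ) → ℝ × ℝ → ℝ := fun F p => a p + μ * shiftOp k' σ volume F p
  have hInt : ∀ F, Integrable F → Integrable (A F) := fun F hF =>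
    hai.add ((integrable_shiftOp hk' hki' hσ hF).const_mul μ)
  obtain ⟨Z, hZ, hfix, ns, hns, hlim⟩ := exists_fixedPoint_integrable (μ := volume) (A := A)
    (r := μ / (lam + μ)) (by positivity) ((div_lt_one hlμ).2 (by linarith))
    (fun F G hFG => by
      simp only [A]
      rw [shiftOp_congr hFG]) hInt (fun F G hF hG => by
      have h1 : ∫ p, ‖A F p - A G p‖ = ∫ p, μ * ‖shiftOp k' σ volume (F - G) p‖ := by
        refine integral_congr_ae ?_
        filter_upwards [shiftOp_sub hk' hki' hσ hF hG] with p hp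
        simp only [A]
        rw [← hp, add_sub_add_left_eq_sub, ← mul_sub, norm_mul, Real.norm_of_nonneg hμ.le]
      rw [h1, integral_const_mul]
      have h2 := integral_norm_shiftOp_le hk' hki' hσ (hF.sub hG)
      rw [hkdef', h.integral_norm_spaceTimeKernel hlμ] at h2
      calc _ ≤ μ * (1 / (lam + μ) * ∫ y, ‖(F - G) y‖) := by gcongr
        _ = _ := by
          simp only [Pi.sub_apply]
          ring)
  have hiter : ∀ n : ℕ, Integrable (A^[n] 0) := fun n => by
    induction n with
    | zero => exact integrable_zero _ _ _
    | succ n ih =>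
      rw [Function.iterate_succ_apply']
      exact hInt _ ih
  -- The renewal identity `expWeight_add_lintegral` reproduces the bound exactly, with no growth in
  -- `n` and no dependence on `μ`.
  have hbound : ∀ n : ℕ, ∀ᵐ t, ∫⁻ x, ‖A^[n] 0 (t, x)‖ₑ ≤ expWeight lam t * ∫⁻ y, ‖w₀ y‖ₑ := by
    intro n
    induction n with
    | zero => exact ae_of_all _ fun t => by simp
    | succ n ih =>
      rw [Function.iterate_succ_apply']
      set F := A^[n] 0
      have hFm : AEStronglyMeasurable F (volume.prod volume) := by
        rw [← Measure.volume_eq_prod]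
        exact (hiter n).1
      refine ae_of_all _ fun t => ?_
      set N := ∫⁻ y, ‖w₀ y‖ₑ
      have e1 : ∫⁻ x, ‖a (t, x)‖ₑ ≤ expWeight (lam + μ) t * N := by
        refine (h.lintegral_slice_shiftOp_le hι hw₀.1 t).trans (le_of_eq ?_)
        simp only [initialSlice, sub_zero]
        rw [lintegral_const_mul'' _ hw₀.1.enorm]
      have e2 : ∫⁻ x, ‖shiftOp k' σ volume F (t, x)‖ₑ ≤
          (∫⁻ s, expWeight (lam + μ) (t - s) * expWeight lam s) * N := by
        refine (h.lintegral_slice_shiftOp_le hσ (hiter n).1 t).trans ?_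
        simp only [hσ1]
        have hm : AEMeasurable (fun q : ℝ × ℝ => expWeight (lam + μ) (t - q.1) * ‖F q‖ₑ)
            (volume.prod volume) :=
          (((measurable_expWeight _).comp (measurable_const.sub measurable_fst)).aemeasurable).mul
            hFm.enorm
        rw [Measure.volume_eq_prod, lintegral_prod _ hm, ← lintegral_mul_const]
        · refine lintegral_mono_ae ?_
          filter_upwards [ih] with s hs
          rw [lintegral_const_mul' _ _ (expWeight_ne_top _ _), mul_assoc]
          gcongr
        · exact ((measurable_expWeight _).comp (measurable_const.sub measurable_id)).mul
            (measurable_expWeight _)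
      have hmeas : AEMeasurable (fun x => ‖a (t, x)‖ₑ) volume := by
        have hm : AEStronglyMeasurable (fun z : ℝ × ℝ =>
            k' ((t, z.1) - initialSlice z.2) * w₀ z.2) (volume.prod volume) := by
          refine AEStronglyMeasurable.mul (Measurable.aestronglyMeasurable ?_) hw₀.1.comp_snd
          exact hk'.comp ((measurable_const.prodMk measurable_fst).sub (hι.comp measurable_snd))
        exact hm.integral_prod_right'.enorm
      calc ∫⁻ x, ‖A F (t, x)‖ₑ
          ≤ ∫⁻ x, (‖a (t, x)‖ₑ + ENNReal.ofReal μ * ‖shiftOp k' σ volume F (t, x)‖ₑ) := by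
            refine lintegral_mono fun x => ?_
            simp only [A]
            refine (enorm_add_le _ _).trans ?_
            rw [enorm_mul, Real.enorm_of_nonneg hμ.le]
        _ = (∫⁻ x, ‖a (t, x)‖ₑ) + ENNReal.ofReal μ * ∫⁻ x, ‖shiftOp k' σ volume F (t, x)‖ₑ := by
            rw [lintegral_add_left' hmeas, lintegral_const_mul' _ _ ENNReal.ofReal_ne_top]
        _ ≤ expWeight (lam + μ) t * N + ENNReal.ofReal μ *
            ((∫⁻ s, expWeight (lam + μ) (t - s) * expWeight lam s) * N) := by gcongr
        _ = expWeight lam t * N := by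
            rw [← mul_assoc, ← add_mul, expWeight_add_lintegral hμ]
  refine ⟨Z, hZ, ae_lintegral_slice_le_of_tendsto (fun n => (hiter (ns n)).1)
    (fun n => hbound (ns n)) hlim, ?_⟩
  -- To recover the equation with the kernel `k`, convolve the fixed point equation with `k` and
  -- replace each `k * k'` by `(k - k')/μ`.
  have hres : ∀ r, ∫ q, k (r - q) * k' q = μ⁻¹ * (k r - k' r) := h.resolvent_identity hμ
  have hdiff : ∀ {Y : Type} [MeasurableSpace Y] {ν : Measure Y} [SFinite ν] {τ : Y → ℝ × ℝ}
      {F : Y → ℝ}, Measurable τ → Integrable F ν → ∀ᵐ p,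
      shiftOp k id volume (shiftOp k' τ ν F) p =
        μ⁻¹ * (shiftOp k τ ν F p - shiftOp k' τ ν F p) := by
    intro Y _ ν _ τ F hτ hF
    filter_upwards [shiftOp_comp hk hki hk' hki' hτ hF, ae_integrable_shift hk hki hτ hF,
      ae_integrable_shift hk' hki' hτ hF] with p h1 h2 h3
    rw [h1]
    simp only [shiftOp, hres]
    rw [← integral_sub h2 h3, ← integral_const_mul]
    congr 1
    ext y
    ring
  have hshift := shiftOp_congr (k := k) (σ := id) hfix
  filter_upwards [hfix, hdiff hι hw₀, hdiff hσ hZ,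
    ae_integrable_shift (ν := volume) hk hki measurable_id hai,
    ae_integrable_shift (ν := volume) hk hki measurable_id (integrable_shiftOp hk' hki' hσ hZ)]
    with p h1 h2 h3 h4 h5
  have h6 : shiftOp k id volume Z p = shiftOp k id volume a p +
      μ * shiftOp k id volume (shiftOp k' σ volume Z) p := by
    rw [hshift]
    simp only [shiftOp, A] at h4 h5 ⊢
    rw [← integral_const_mul, ← integral_add h4 (h5.const_mul μ)]
    congr 1
    ext q
    ring
  rw [h6, h2, h3]
  have h7 : Z p = a p + μ * shiftOp k' σ volume Z p := h1
  rw [h7]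
  field_simp
  ring

end IsStableKernel

/-! ### Consistency of the jumps and contraction for the linear problem. -/

namespace IsStableKernel

variable {K : ℝ → ℝ → ℝ} {θ lam : ℝ} {w₀ : ℝ → ℝ} {g W : ℝ × ℝ → ℝ} {L M : ℝ}

/-- Consistency of the regularized transport operator. -/
lemma lintegral_sub_regularized_le (h : IsStableKernel K θ) (hl : 0 < lam) (hg : Measurable g)
    (hL : ∀ q, |g q| ≤ L) (hsmall : L * ∫ p, ‖spaceTimeKernelDeriv K lam p‖ ≤ 1 / 2)
    (hWi : Integrable W)
    (hfix : ∀ᵐ p, W p = shiftOp (spaceTimeKernel K lam) initialSlice volume w₀ p -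
      shiftOp (spaceTimeKernelDeriv K lam) id volume (g * W) p)
    {τ : ℝ} (hτ : 0 < τ) {δ : ENNReal}
    (hδ : ∀ b : ℝ, |b| ≤ τ * L → ∫⁻ p, ‖spaceTimeKernelDeriv K lam (p - (0, b)) -
      spaceTimeKernelDeriv K lam p‖ₑ ≤ δ)
    {Z : ℝ × ℝ → ℝ} (hZi : Integrable Z)
    (hZ : ∀ᵐ p, Z p = shiftOp (spaceTimeKernel K lam) initialSlice volume w₀ p +
        τ⁻¹ * (shiftOp (spaceTimeKernel K lam) (fun q => q + (0, τ * g q)) volume Z p -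
          shiftOp (spaceTimeKernel K lam) id volume Z p)) :
    ∫⁻ p, ‖W p - Z p‖ₑ ≤ 2 * (ENNReal.ofReal L * δ * ∫⁻ p, ‖Z p‖ₑ) := by
  set k := spaceTimeKernel K lam with hkdef
  set kx := spaceTimeKernelDeriv K lam with hkxdef
  have hk : Measurable k := h.measurable_spaceTimeKernel
  have hkx : Measurable kx := h.measurable_spaceTimeKernelDeriv
  have hki : Integrable k := h.integrable_spaceTimeKernel hl
  have hkxi : Integrable kx := h.integrable_spaceTimeKernelDeriv hl
  have hL0 : 0 ≤ L := (abs_nonneg _).trans (hL 0)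
  set σ : ℝ × ℝ → ℝ × ℝ := fun q => q + (0, τ * g q) with hσdef
  have hσ : Measurable σ := measurable_id.add (measurable_const.prodMk (hg.const_mul τ))
  have hgmul : ∀ {F : ℝ × ℝ → ℝ}, Integrable F → Integrable (g * F) := fun hF =>
    hF.bdd_mul (c := L) hg.aestronglyMeasurable (ae_of_all _ hL)
  -- The consistency error: the jump difference quotient plus the transport term it should cancel.
  -- Its `L¹` norm in `p` is at most `τ⁻¹ |τ g(q)| δ ≤ L δ`.
  let R : ℝ × ℝ → ℝ × ℝ → ℝ := fun p q =>
    τ⁻¹ * (k (p - σ q) - k (p - q) + (τ * g q) * kx (p - q))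
  have hRm : Measurable (Function.uncurry R) := by
    refine Measurable.const_mul (((hk.comp (measurable_fst.sub (hσ.comp measurable_snd))).sub
      (hk.comp (measurable_fst.sub measurable_snd))).add
      (((hg.comp measurable_snd).const_mul τ).mul
        (hkx.comp (measurable_fst.sub measurable_snd)))) _
  have hRb : ∀ q, ∫⁻ p, ‖R p q‖ₑ ≤ ENNReal.ofReal L * δ := fun q => by
    have h1 := h.lintegral_taylor_le (lam := lam) (a := τ * g q) (δ := δ) (fun b hb => hδ b (by
      refine hb.trans ?_
      rw [abs_mul, abs_of_pos hτ]
      exact mul_le_mul_of_nonneg_left (hL q) hτ.le))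
    rw [← lintegral_sub_right_eq_self _ q] at h1
    have h2 : ∀ p, ‖R p q‖ₑ = ‖τ⁻¹‖ₑ * ‖k (p - q - (0, τ * g q)) - k (p - q) +
        τ * g q * kx (p - q)‖ₑ := fun p => by
      simp only [R, hσdef]
      rw [enorm_mul, sub_add_eq_sub_sub]
    simp_rw [h2]
    rw [lintegral_const_mul' _ _ enorm_ne_top]
    calc _ ≤ ‖τ⁻¹‖ₑ * (‖τ * g q‖ₑ * δ) := by gcongr
      _ = ‖g q‖ₑ * δ := by
        rw [← mul_assoc, ← enorm_mul, inv_mul_cancel_left₀ hτ.ne']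
      _ ≤ _ := by
        gcongr
        rw [← ofReal_norm]
        exact ENNReal.ofReal_le_ofReal (hL q)
  -- The error solves the linear equation of `W` with the consistency error as source in place of
  -- the data.
  have hdecomp : ∀ᵐ p, W p - Z p =
      -(shiftOp kx id volume (g * W - g * Z) p + ∫ q, R p q * Z q) := by
    filter_upwards [hfix, hZ, shiftOp_sub hkx hkxi measurable_id (hgmul hWi) (hgmul hZi),
      ae_integrable_shift (ν := volume) hk hki hσ hZi,
      ae_integrable_shift (ν := volume) hk hki measurable_id hZi,
      ae_integrable_shift (ν := volume) hkx hkxi measurable_id (hgmul hZi)]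
      with p h1 h2 h3 h4 h5 h6
    have h7 : ∫ q, R p q * Z q = τ⁻¹ * (shiftOp k σ volume Z p - shiftOp k id volume Z p) +
        shiftOp kx id volume (g * Z) p := by
      have h45 : Integrable fun q => τ⁻¹ * (k (p - σ q) * Z q - k (p - id q) * Z q) :=
        (h4.sub h5).const_mul _
      rw [shiftOp, shiftOp, shiftOp, ← integral_sub h4 h5, ← integral_const_mul,
        ← integral_add h45 h6]
      refine integral_congr_ae (ae_of_all _ fun q => ?_)
      simp only [R, id, Pi.mul_apply]
      field_simp
    rw [← h3, h7]
    linear_combination h1 - h2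
  set X := ∫⁻ p, ‖W p - Z p‖ₑ with hX
  set C := ENNReal.ofReal L * δ * ∫⁻ p, ‖Z p‖ₑ with hC
  have hXtop : X ≠ ⊤ := (hWi.sub hZi).2.ne
  have hgX : ∫⁻ p, ‖(g * W - g * Z) p‖ₑ ≤ ENNReal.ofReal L * X := by
    rw [hX, ← lintegral_const_mul' _ _ ENNReal.ofReal_ne_top]
    refine lintegral_mono fun q => ?_
    simp only [Pi.sub_apply, Pi.mul_apply]
    rw [← mul_sub, enorm_mul]
    gcongr
    rw [← ofReal_norm]
    exact ENNReal.ofReal_le_ofReal (hL q)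
  have e1 : ∫⁻ p, ‖shiftOp kx id volume (g * W - g * Z) p‖ₑ ≤ X / 2 := by
    refine (lintegral_enorm_shiftOp_le hkx measurable_id
      ((hgmul hWi).sub (hgmul hZi)).1).trans ?_
    calc _ ≤ (∫⁻ p, ‖kx p‖ₑ) * (ENNReal.ofReal L * X) := by gcongr
      _ = ENNReal.ofReal (L * ∫ p, ‖kx p‖) * X := by
        rw [← ofReal_integral_norm_eq_lintegral_enorm hkxi, ENNReal.ofReal_mul hL0]
        ring
      _ ≤ ENNReal.ofReal (1 / 2) * X := by gcongr
      _ = X / 2 := by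
        rw [ENNReal.div_eq_inv_mul, one_div, ENNReal.ofReal_inv_of_pos two_pos]
        simp
  have e2 : ∫⁻ p, ‖∫ q, R p q * Z q‖ₑ ≤ C := by
    have := lintegral_enorm_integral_mul_le (μ := volume) (ν := volume) hRm hZi.1 hRb
    rwa [lintegral_const_mul'' _ hZi.1.enorm] at this
  have hXle : X ≤ X / 2 + C := by
    calc X = ∫⁻ p, ‖shiftOp kx id volume (g * W - g * Z) p + ∫ q, R p q * Z q‖ₑ := by
          refine lintegral_congr_ae ?_
          filter_upwards [hdecomp] with p hp
          rw [hp, enorm_neg]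
      _ ≤ ∫⁻ p, (‖shiftOp kx id volume (g * W - g * Z) p‖ₑ + ‖∫ q, R p q * Z q‖ₑ) :=
          lintegral_mono fun p => enorm_add_le _ _
      _ = _ := lintegral_add_left' (integrable_shiftOp hkx hkxi measurable_id
          ((hgmul hWi).sub (hgmul hZi))).1.enorm _
      _ ≤ _ := add_le_add e1 e2
  -- Subtracting `X / 2` requires `X < ∞`, which is where the integrability of `W` enters.
  have hhalf : X / 2 ≤ C := by
    have h2top : X / 2 ≠ ⊤ := (ENNReal.div_lt_top hXtop two_ne_zero).ne
    refine (ENNReal.add_le_add_iff_left h2top).1 ?_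
    rwa [ENNReal.add_halves]
  rw [mul_comm]
  exact (ENNReal.div_le_iff two_ne_zero ENNReal.ofNat_ne_top).1 hhalf

/-- The `L¹` contraction estimate for bounded solutions of the linear transport problem with
bounded measurable velocity. -/
lemma ae_lintegral_slice_le (h : IsStableKernel K θ) (hl : 0 < lam) (hg : Measurable g)
    (hL : ∀ q, |g q| ≤ L) (hsmall : L * ∫ p, ‖spaceTimeKernelDeriv K lam p‖ ≤ 1 / 2)
    (hw₀ : Integrable w₀) (hW : AEStronglyMeasurable W volume) (hM : ∀ᵐ q, |W q| ≤ M)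
    (hfix : ∀ᵐ p, W p = shiftOp (spaceTimeKernel K lam) initialSlice volume w₀ p -
      shiftOp (spaceTimeKernelDeriv K lam) id volume (g * W) p) :
    ∀ᵐ t, ∫⁻ x, ‖W (t, x)‖ₑ ≤ expWeight lam t * ∫⁻ y, ‖w₀ y‖ₑ := by
  have hk := h.measurable_spaceTimeKernel (lam := lam)
  have hki := h.integrable_spaceTimeKernel hl
  have hkx := h.measurable_spaceTimeKernelDeriv (lam := lam)
  have hkxi := h.integrable_spaceTimeKernelDeriv hl
  have hL0 : 0 ≤ L := (abs_nonneg _).trans (hL 0)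
  have hWi : Integrable W := integrable_of_bounded_fixedPoint hkx hkxi hg hL hsmall
    (integrable_shiftOp hk hki measurable_initialSlice hw₀) hW hM hfix
  set N := ∫⁻ y, ‖w₀ y‖ₑ with hN
  have hNtop : N ≠ ⊤ := hw₀.2.ne
  have hstep : ∀ n : ℕ, ∃ Z : ℝ × ℝ → ℝ, Integrable Z ∧
      (∀ᵐ t, ∫⁻ x, ‖Z (t, x)‖ₑ ≤ expWeight lam t * N) ∧
      ∫⁻ p, ‖W p - Z p‖ₑ ≤ 2 * (ENNReal.ofReal L * (n : ENNReal)⁻¹ *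
        (ENNReal.ofReal (1 / lam) * N)) := by
    intro n
    have h1 : Tendsto (fun b : ℝ => ∫⁻ p, ‖spaceTimeKernelDeriv K lam (p - (0, b)) -
        spaceTimeKernelDeriv K lam p‖ₑ) (𝓝 0) (𝓝 0) := by
      have h2 : Tendsto (fun b : ℝ => ((0 : ℝ), b)) (𝓝 0) (𝓝 0) := by
        have : Continuous fun b : ℝ => ((0 : ℝ), b) := by fun_prop
        exact this.tendsto 0
      exact (tendsto_lintegral_translate hkxi).comp h2
    -- For `n = 0` the tolerance is `∞`, which is harmless.
    have h3 := h1.eventually_le_const (u := (n : ENNReal)⁻¹) (by simp)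
    obtain ⟨η, hη, hηb⟩ := Metric.eventually_nhds_iff.1 h3
    -- All jumps have length at most `τ L < η`; `L + 1` avoids a zero denominator.
    set τ := η / (2 * (L + 1)) with hτdef
    have hτ : 0 < τ := by positivity
    have hτL : τ * L < η := by
      rw [hτdef, div_mul_eq_mul_div, div_lt_iff₀ (by positivity)]
      nlinarith
    obtain ⟨Z, hZi, hZb, hZ⟩ := h.exists_regularized_solution hl (inv_pos.2 hτ) hw₀
      (σ := fun q => q + (0, τ * g q))
      (measurable_id.add (measurable_const.prodMk (hg.const_mul τ))) (fun q => by simp)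
    refine ⟨Z, hZi, hZb, ?_⟩
    refine (h.lintegral_sub_regularized_le hl hg hL hsmall hWi hfix hτ
      (δ := (n : ENNReal)⁻¹) (fun b hb => hηb ?_) hZi hZ).trans ?_
    · rw [Real.dist_eq, sub_zero]
      exact hb.trans_lt hτL
    · gcongr
      -- Integrating the slice bound in time gives `‖Z‖₁ ≤ ‖w₀‖₁ / λ`, uniformly in `τ`.
      rw [Measure.volume_eq_prod, lintegral_prod]
      · refine (lintegral_mono_ae hZb).trans ?_
        rw [lintegral_mul_const' _ _ hNtop, lintegral_expWeight hl]
      · rw [← Measure.volume_eq_prod]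
        exact hZi.1.enorm
  choose Z hZi hZb hZX using hstep
  have htend : Tendsto (fun n => eLpNorm (Z n - W) 1 volume) atTop (𝓝 0) := by
    have h4 : Tendsto (fun n : ℕ => 2 * (ENNReal.ofReal L * (n : ENNReal)⁻¹ *
        (ENNReal.ofReal (1 / lam) * N))) atTop (𝓝 0) := by
      have h5 := ENNReal.tendsto_inv_nat_nhds_zero
      have h6 := ENNReal.Tendsto.const_mul (a := ENNReal.ofReal L) h5
        (Or.inr ENNReal.ofReal_ne_top)
      have h7 := ENNReal.Tendsto.mul_const (b := ENNReal.ofReal (1 / lam) * N) h6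
        (Or.inr (ENNReal.mul_ne_top ENNReal.ofReal_ne_top hNtop))
      have h8 := ENNReal.Tendsto.const_mul (a := 2) h7 (Or.inr ENNReal.ofNat_ne_top)
      simpa using h8
    refine tendsto_of_tendsto_of_tendsto_of_le_of_le tendsto_const_nhds h4 (fun _ => zero_le)
      fun n => ?_
    simp only
    rw [eLpNorm_one_eq_lintegral_enorm]
    refine le_trans (le_of_eq ?_) (hZX n)
    refine lintegral_congr fun p => ?_
    rw [Pi.sub_apply, enorm_sub_rev]
  obtain ⟨ns, hns, hae⟩ := (tendstoInMeasure_of_tendsto_eLpNorm one_ne_zero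
    (fun n => (hZi n).1) hWi.1 htend).exists_seq_tendsto_ae
  exact ae_lintegral_slice_le_of_tendsto (fun n => (hZi (ns n)).1) (fun n => hZb (ns n)) hae

end IsStableKernel

/-! ### Duhamel's formula as a space-time convolution, and its continuity. -/

lemma ae_halfPlaneMeasure_iff {P : ℝ × ℝ → Prop} :
    (∀ᵐ p ∂halfPlaneMeasure, P p) ↔ ∀ᵐ p : ℝ × ℝ, 0 < p.1 → P p := by
  rw [halfPlaneMeasure, ae_restrict_iff' (measurableSet_Ioi.prod MeasurableSet.univ)]
  simp

/-- Essentially bounded functions have bounded measurable representatives. -/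
lemma exists_measurable_bounded_representative {u : ℝ → ℝ → ℝ}
    (hu : MemLp (fun p : ℝ × ℝ => u p.1 p.2) ⊤ halfPlaneMeasure) :
    ∃ (M : ℝ) (w : ℝ × ℝ → ℝ), Measurable w ∧ (∀ q, |w q| ≤ M) ∧
      ∀ᵐ p : ℝ × ℝ, 0 < p.1 → u p.1 p.2 = w p := by
  have hfin : eLpNormEssSup (fun p : ℝ × ℝ => u p.1 p.2) halfPlaneMeasure ≠ ⊤ := by
    rw [← eLpNorm_exponent_top]
    exact hu.2.ne
  set M := (eLpNormEssSup (fun p : ℝ × ℝ => u p.1 p.2) halfPlaneMeasure).toReal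
  have hM0 : 0 ≤ M := ENNReal.toReal_nonneg
  have hm := hu.1.stronglyMeasurable_mk.measurable
  refine ⟨M, fun p => max (-M) (min M (hu.1.mk _ p)), measurable_const.max (measurable_const.min hm),
    fun q => abs_le.2 ⟨le_max_left _ _, max_le (by linarith) (min_le_left _ _)⟩, ?_⟩
  rw [← ae_halfPlaneMeasure_iff]
  filter_upwards [hu.1.ae_eq_mk, ae_le_eLpNormEssSup (f := fun p : ℝ × ℝ => u p.1 p.2)] with p h1 h2
  rw [← ofReal_norm, ENNReal.ofReal_le_iff_le_toReal hfin, Real.norm_eq_abs, abs_le] at h2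
  rw [← h1, min_eq_right h2.2, max_eq_right h2.1]

/-- The flux `F` weighted by `exp(-λt)` and restricted to positive times. -/
def weighted (lam : ℝ) (F : ℝ × ℝ → ℝ) (q : ℝ × ℝ) : ℝ :=
  if 0 < q.1 then Real.exp (-(lam * q.1)) * F q else 0

lemma measurable_weighted {lam : ℝ} {F : ℝ × ℝ → ℝ} (hF : Measurable F) :
    Measurable (weighted lam F) :=
  Measurable.ite (measurableSet_lt measurable_const measurable_fst) (by fun_prop) measurable_const

lemma abs_weighted_le {lam B : ℝ} (hl : 0 ≤ lam) {F : ℝ × ℝ → ℝ} (hF : ∀ q, |F q| ≤ B)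
    (q : ℝ × ℝ) : |weighted lam F q| ≤ B := by
  simp only [weighted]
  split_ifs with hq
  · rw [abs_mul, abs_of_pos (Real.exp_pos _)]
    refine (mul_le_of_le_one_left (abs_nonneg _) ?_).trans (hF q)
    rw [Real.exp_le_one_iff]
    have : 0 ≤ lam * q.1 := by positivity
    linarith
  · rw [abs_zero]
    exact (abs_nonneg _).trans (hF q)

namespace IsStableKernel

variable {K : ℝ → ℝ → ℝ} {θ lam B : ℝ}

/-- The Duhamel integral as a space-time convolution. -/
lemma duhamel_integral_eq (h : IsStableKernel K θ) (hl : 0 < lam) {F : ℝ × ℝ → ℝ}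
    (hF : Measurable F) (hB : ∀ q, |F q| ≤ B) {t : ℝ} (ht : 0 < t) (x : ℝ) :
    ∫ s in (0 : ℝ)..t, ∫ y : ℝ, deriv (K (t - s)) (x - y) * F (s, y) =
      Real.exp (lam * t) *
        shiftOp (spaceTimeKernelDeriv K lam) id volume (weighted lam F) (t, x) := by
  have hInt : Integrable (fun q : ℝ × ℝ => spaceTimeKernelDeriv K lam ((t, x) - id q) *
      weighted lam F q) (volume.prod volume) := by
    rw [← Measure.volume_eq_prod]
    exact ((h.integrable_spaceTimeKernelDeriv hl).comp_sub_left (t, x)).mul_bdd (c := B)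
      (measurable_weighted hF).aestronglyMeasurable (ae_of_all _ (abs_weighted_le hl.le hB))
  have hinner : ∀ s : ℝ, ∫ y, spaceTimeKernelDeriv K lam ((t, x) - id (s, y)) *
      weighted lam F (s, y) = (Ioo 0 t).indicator (fun s => Real.exp (-(lam * t)) *
        ∫ y : ℝ, deriv (K (t - s)) (x - y) * F (s, y)) s := fun s => by
    by_cases hs : s ∈ Ioo 0 t
    · have h1 : 0 < t - s := by linarith [hs.2]
      rw [indicator_of_mem hs, ← integral_const_mul]
      congr 1
      ext y
      simp only [spaceTimeKernelDeriv, weighted, id, Prod.mk_sub_mk, h1, hs.1, if_true]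
      rw [mul_mul_mul_comm, ← Real.exp_add]
      congr 2
      ring
    · rw [indicator_of_notMem hs]
      refine integral_eq_zero_of_ae (ae_of_all _ fun y => ?_)
      simp only [spaceTimeKernelDeriv, weighted, id, Prod.mk_sub_mk, Pi.zero_apply]
      by_cases h1 : 0 < s
      · have h2 : ¬ 0 < t - s := fun h2 => hs ⟨h1, by linarith⟩
        simp [h2]
      · simp [h1]
  rw [shiftOp, Measure.volume_eq_prod, integral_prod _ hInt]
  simp_rw [hinner]
  rw [integral_indicator measurableSet_Ioo, integral_const_mul, ← mul_assoc, ← Real.exp_add,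
    add_neg_cancel, Real.exp_zero, one_mul, ← integral_Ioc_eq_integral_Ioo,
    intervalIntegral.integral_of_le ht.le]

/-- Continuity of the linear evolution of essentially bounded data. -/
lemma continuousAt_linear (h : IsStableKernel K θ) {w : ℝ → ℝ}
    (hw : AEStronglyMeasurable w volume) (hB : ∀ᵐ y, |w y| ≤ B) {p₀ : ℝ × ℝ} (hp₀ : 0 < p₀.1) :
    ContinuousAt (fun p : ℝ × ℝ => ∫ y, K p.1 (p.2 - y) * w y) p₀ := by
  obtain ⟨C, hC⟩ := h.bound
  have hC0 : 0 ≤ C := by simpa using (abs_nonneg _).trans (hC 0)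
  have hB0 : 0 ≤ B := by
    obtain ⟨y, hy⟩ := hB.exists
    exact (abs_nonneg _).trans hy
  set a₀ := p₀.1 ^ (-θ) with ha₀
  have ha₀pos : 0 < a₀ := by positivity
  have hpow : ContinuousAt (fun p : ℝ × ℝ => p.1 ^ (-θ)) p₀ :=
    (Real.continuousAt_rpow_const _ _ (Or.inl hp₀.ne')).comp continuousAt_fst
  have hpos : ∀ᶠ p : ℝ × ℝ in 𝓝 p₀, 0 < p.1 :=
    (isOpen_lt continuous_const continuous_fst).mem_nhds hp₀
  have hnear : ∀ᶠ p : ℝ × ℝ in 𝓝 p₀, 0 < p.1 ∧ a₀ / 2 ≤ p.1 ^ (-θ) ∧ p.1 ^ (-θ) ≤ 2 * a₀ ∧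
      |p.2 - p₀.2| ≤ 1 := by
    have h3 : ∀ᶠ p : ℝ × ℝ in 𝓝 p₀, |p.2 - p₀.2| ≤ 1 := by
      have : ContinuousAt (fun p : ℝ × ℝ => |p.2 - p₀.2|) p₀ := by fun_prop
      exact this.eventually_le_const (by simp)
    filter_upwards [hpos, hpow.eventually_const_le (show a₀ / 2 < p₀.1 ^ (-θ) by linarith),
      hpow.eventually_le_const (show p₀.1 ^ (-θ) < 2 * a₀ by linarith), h3] with p h1 h2 h4 h5
    exact ⟨h1, h2, h4, h5⟩
  -- Near `p₀` one has `|x - x₀| ≤ 1` and `a ≥ a₀/2`, so `1 + (x₀ - y)² ≤ 3 + 2(x - y)² ≤ D (1 +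
  -- (a(x - y))²)`; this dominates all nearby kernels by one integrable function.
  set D := 3 + 2 / (a₀ / 2) ^ 2 with hD
  have hD0 : 0 < D := by positivity
  refine continuousAt_of_dominated
    (bound := fun y => 2 * a₀ * (C * (D * (1 + (p₀.2 - y) ^ 2)⁻¹)) * B) ?_ ?_ ?_ ?_
  · filter_upwards [hpos] with p hp
    exact ((h.continuous_kernel hp).comp (by fun_prop)).aestronglyMeasurable.mul hw
  · filter_upwards [hnear] with p ⟨hp, h1, h2, h3⟩
    filter_upwards [hB] with y hy
    rw [norm_mul, h.scaling p.1 hp, norm_mul, Real.norm_of_nonneg (by positivity)]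
    set a := p.1 ^ (-θ)
    have ha : 0 < a := by linarith
    have hmain : (1 + (a * (p.2 - y)) ^ 2)⁻¹ ≤ D * (1 + (p₀.2 - y) ^ 2)⁻¹ := by
      rw [← div_eq_mul_inv, le_div_iff₀ (by positivity), inv_mul_le_iff₀ (by positivity)]
      have e1 : (p₀.2 - y) ^ 2 ≤ 2 * (p.2 - y) ^ 2 + 2 := by
        have e2 : (p.2 - p₀.2) ^ 2 ≤ 1 := by
          rw [← sq_abs]
          nlinarith [abs_nonneg (p.2 - p₀.2)]
        nlinarith [sq_nonneg ((p.2 - y) + (p.2 - p₀.2))]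
      have e3 : 2 * (p.2 - y) ^ 2 ≤ 2 / (a₀ / 2) ^ 2 * (a * (p.2 - y)) ^ 2 := by
        rw [mul_pow, ← mul_assoc]
        refine mul_le_mul_of_nonneg_right ?_ (sq_nonneg _)
        rw [div_mul_eq_mul_div, le_div_iff₀ (by positivity)]
        have : (a₀ / 2) ^ 2 ≤ a ^ 2 := by gcongr
        linarith
      rw [hD]
      have e4 : 0 ≤ 2 / (a₀ / 2) ^ 2 := by positivity
      nlinarith [sq_nonneg (a * (p.2 - y))]
    have h4 : ‖K 1 (a * (p.2 - y))‖ ≤ C * (D * (1 + (p₀.2 - y) ^ 2)⁻¹) :=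
      (hC _).trans (by gcongr)
    have h5 : ‖w y‖ ≤ B := hy
    gcongr
  · exact (((integrable_inv_one_add_sq.comp_sub_left p₀.2).const_mul D).const_mul C
      |>.const_mul (2 * a₀)).mul_const B
  · refine ae_of_all _ fun y => ?_
    have h1 : ContinuousAt (fun p : ℝ × ℝ => p.1 ^ (-θ) * K 1 (p.1 ^ (-θ) * (p.2 - y)) * w y) p₀ := by
      have h2 : ContinuousAt (fun p : ℝ × ℝ => K 1 (p.1 ^ (-θ) * (p.2 - y))) p₀ :=
        h.continuous_one.continuousAt.comp (hpow.mul (by fun_prop))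
      exact (hpow.mul h2).mul continuousAt_const
    refine h1.congr ?_
    filter_upwards [hpos] with p hp
    rw [h.scaling p.1 hp]

end IsStableKernel

lemma exists_abs_le_of_memLp_top {w : ℝ → ℝ} (hw : MemLp w ⊤ volume) :
    ∃ B, ∀ᵐ y, |w y| ≤ B := by
  have hfin : eLpNormEssSup w volume ≠ ⊤ := by
    rw [← eLpNorm_exponent_top]
    exact hw.2.ne
  refine ⟨(eLpNormEssSup w volume).toReal, ?_⟩
  filter_upwards [ae_le_eLpNormEssSup (f := w)] with y hy
  rwa [← ofReal_norm, ENNReal.ofReal_le_iff_le_toReal hfin] at hy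

/-- By Fubini, almost every time slice of `u` agrees almost everywhere with that of `w`, so the
formula sees only the class of `u`, yet yields a value at every point with `t > 0`. -/
lemma duhamel_congr {ψ : ℝ → ℂ} {f u₀ : ℝ → ℝ} {u : ℝ → ℝ → ℝ} {w : ℝ × ℝ → ℝ}
    (hw : ∀ᵐ p : ℝ × ℝ, 0 < p.1 → u p.1 p.2 = w p) {t : ℝ} (ht : 0 < t) (x : ℝ) :
    duhamel ψ f u₀ u t x = (∫ y : ℝ, kernel ψ t (x - y) * u₀ y) -
      ∫ s in (0 : ℝ)..t, ∫ y : ℝ, deriv (kernel ψ (t - s)) (x - y) * f (w (s, y)) := by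
  rw [duhamel]
  congr 1
  rw [Measure.volume_eq_prod] at hw
  rw [intervalIntegral.integral_of_le ht.le, intervalIntegral.integral_of_le ht.le]
  refine setIntegral_congr_ae measurableSet_Ioc ?_
  filter_upwards [Measure.ae_ae_of_ae_prod hw] with s hs hs0
  refine integral_congr_ae ?_
  filter_upwards [hs] with y hy
  rw [hy hs0.1]

lemma duhamel_eq_shiftOp {ψ : ℝ → ℂ} {θ lam B : ℝ} (h : IsStableKernel (kernel ψ) θ) (hl : 0 < lam)
    {f u₀ : ℝ → ℝ} (hf : Continuous f) {u : ℝ → ℝ → ℝ} {w : ℝ × ℝ → ℝ}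
    (hw : ∀ᵐ p : ℝ × ℝ, 0 < p.1 → u p.1 p.2 = w p) (hwm : Measurable w)
    (hB : ∀ q, |f (w q)| ≤ B) {t : ℝ} (ht : 0 < t) (x : ℝ) :
    duhamel ψ f u₀ u t x = (∫ y : ℝ, kernel ψ t (x - y) * u₀ y) - Real.exp (lam * t) *
      shiftOp (spaceTimeKernelDeriv (kernel ψ) lam) id volume
        (weighted lam fun q => f (w q)) (t, x) := by
  rw [duhamel_congr hw ht,
    h.duhamel_integral_eq (F := fun q => f (w q)) hl (hf.measurable.comp hwm) hB ht]

lemma continuousOn_duhamel {ψ : ℝ → ℂ} {θ B : ℝ} (h : IsStableKernel (kernel ψ) θ)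
    {f u₀ : ℝ → ℝ} (hf : Continuous f) (hu₀ : MemLp u₀ ⊤ volume) {u : ℝ → ℝ → ℝ} {w : ℝ × ℝ → ℝ}
    (hw : ∀ᵐ p : ℝ × ℝ, 0 < p.1 → u p.1 p.2 = w p) (hwm : Measurable w)
    (hB : ∀ q, |f (w q)| ≤ B) :
    ContinuousOn (fun p : ℝ × ℝ => duhamel ψ f u₀ u p.1 p.2) (Ioi (0 : ℝ) ×ˢ (univ : Set ℝ)) := by
  obtain ⟨B₀, hB₀⟩ := exists_abs_le_of_memLp_top hu₀
  have hm := measurable_weighted (lam := 1) (hf.measurable.comp hwm)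
  have h1 : Continuous (shiftOp (spaceTimeKernelDeriv (kernel ψ) 1) id volume
      (weighted 1 fun q => f (w q))) :=
    continuous_convolution_bounded (h.integrable_spaceTimeKernelDeriv one_pos)
      hm.aestronglyMeasurable (ae_of_all _ (abs_weighted_le zero_le_one hB))
  have h2 : ContinuousOn (fun p : ℝ × ℝ => (∫ y : ℝ, kernel ψ p.1 (p.2 - y) * u₀ y) -
      Real.exp (1 * p.1) * shiftOp (spaceTimeKernelDeriv (kernel ψ) 1) id volume
        (weighted 1 fun q => f (w q)) p) (Ioi (0 : ℝ) ×ˢ (univ : Set ℝ)) := by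
    refine ContinuousOn.sub (fun p hp => (h.continuousAt_linear hu₀.1 hB₀
      hp.1).continuousWithinAt) (Continuous.continuousOn (by fun_prop))
  exact h2.congr fun p hp => duhamel_eq_shiftOp h one_pos hf hw hwm hB hp.1 p.2

lemma exists_lipschitz_constant {f : ℝ → ℝ} (hf : ContDiff ℝ 1 f) (M : ℝ) :
    ∃ L, 0 ≤ L ∧ ∀ a b, |a| ≤ M → |b| ≤ M → |f a - f b| ≤ L * |a - b| := by
  obtain ⟨C, hC⟩ := (isCompact_Icc (a := -M) (b := M)).exists_bound_of_continuousOn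
    (hf.continuous_deriv le_rfl).continuousOn
  refine ⟨max C 0, le_max_right _ _, fun a b ha hb => ?_⟩
  refine (convex_Icc (-M) M).norm_image_sub_le_of_norm_deriv_le
    (fun x _ => (hf.differentiable one_ne_zero).differentiableAt)
    (fun x hx => (hC x hx).trans (le_max_left _ _)) (abs_le.1 hb) (abs_le.1 ha)

lemma exists_bound_comp {f : ℝ → ℝ} (hf : Continuous f) {M : ℝ} {w : ℝ × ℝ → ℝ}
    (hM : ∀ q, |w q| ≤ M) : ∃ B, ∀ q, |f (w q)| ≤ B := by
  obtain ⟨C, hC⟩ := (isCompact_Icc (a := -M) (b := M)).exists_bound_of_continuousOn hf.continuousOn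
  exact ⟨C, fun q => hC _ (abs_le.1 (hM q))⟩

/-! ### The contraction estimate for mild solutions. -/

/-- The contraction estimate for bounded measurable representatives of mild solutions, at almost
every time. -/
lemma ae_contraction {ψ : ℝ → ℂ} {θ : ℝ} (h : IsStableKernel (kernel ψ) θ) {f : ℝ → ℝ}
    (hf : ContDiff ℝ 1 f) {u₀ v₀ : ℝ → ℝ} (hu₀ : MemLp u₀ ⊤ volume) (hv₀ : MemLp v₀ ⊤ volume)
    (h₀ : Integrable fun x => u₀ x - v₀ x) {u v : ℝ → ℝ → ℝ} (hu : IsMildSolution ψ f u₀ u)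
    (hv : IsMildSolution ψ f v₀ v) {U V : ℝ × ℝ → ℝ} {M : ℝ} (hU : Measurable U)
    (hV : Measurable V) (hUM : ∀ q, |U q| ≤ M) (hVM : ∀ q, |V q| ≤ M)
    (huU : ∀ᵐ p : ℝ × ℝ, 0 < p.1 → u p.1 p.2 = U p)
    (hvV : ∀ᵐ p : ℝ × ℝ, 0 < p.1 → v p.1 p.2 = V p) :
    ∀ᵐ t : ℝ, 0 < t → ∫⁻ x, ‖U (t, x) - V (t, x)‖ₑ ≤ ∫⁻ x, ‖u₀ x - v₀ x‖ₑ := by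
  obtain ⟨L, hL0, hL⟩ := exists_lipschitz_constant hf M
  obtain ⟨lam, hl, hsmall⟩ := h.exists_integral_norm_spaceTimeKernelDeriv_le L
  have hfm := hf.continuous.measurable
  -- Where `U = V` the quotient is `0` by the convention for division, and `g (U - V) = f(U) - f(V)`
  -- still holds.
  let g : ℝ × ℝ → ℝ := fun q => (f (U q) - f (V q)) / (U q - V q)
  have hg : Measurable g := ((hfm.comp hU).sub (hfm.comp hV)).div (hU.sub hV)
  have hgL : ∀ q, |g q| ≤ L := fun q => by
    rw [abs_div]
    exact div_le_of_le_mul₀ (abs_nonneg _) hL0 (hL _ _ (hUM q) (hVM q))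
  let W : ℝ × ℝ → ℝ := weighted lam fun q => U q - V q
  have hgW : g * W = weighted lam (fun q => f (U q)) - weighted lam (fun q => f (V q)) := by
    ext q
    simp only [g, W, weighted, Pi.mul_apply, Pi.sub_apply]
    split_ifs
    · rcases eq_or_ne (U q - V q) 0 with h0 | h0
      · rw [sub_eq_zero.1 h0]
        simp
      · field_simp
    · simp
  have hWm : Measurable W := measurable_weighted (hU.sub hV)
  have hWM : ∀ q, |W q| ≤ M + M := abs_weighted_le hl.le fun q =>
    (abs_sub _ _).trans (add_le_add (hUM q) (hVM q))
  obtain ⟨Bu, hBu⟩ := exists_bound_comp hf.continuous hUM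
  obtain ⟨Bv, hBv⟩ := exists_bound_comp hf.continuous hVM
  obtain ⟨Cu, hCu⟩ := exists_abs_le_of_memLp_top hu₀
  obtain ⟨Cv, hCv⟩ := exists_abs_le_of_memLp_top hv₀
  have hfix : ∀ᵐ p, W p = shiftOp (spaceTimeKernel (kernel ψ) lam) initialSlice volume
      (fun x => u₀ x - v₀ x) p -
      shiftOp (spaceTimeKernelDeriv (kernel ψ) lam) id volume (g * W) p := by
    filter_upwards [ae_halfPlaneMeasure_iff.1 hu.duhamel_eq, ae_halfPlaneMeasure_iff.1 hv.duhamel_eq,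
      huU, hvV] with p h1 h2 h3 h4
    obtain ⟨t, x⟩ := p
    by_cases ht : 0 < t
    · have hdu := duhamel_eq_shiftOp h hl hf.continuous huU hU hBu ht x (u₀ := u₀)
      have hdv := duhamel_eq_shiftOp h hl hf.continuous hvV hV hBv ht x (u₀ := v₀)
      have hi : ∀ {F : ℝ × ℝ → ℝ} {B : ℝ}, Measurable F → (∀ q, |F q| ≤ B) →
          Integrable fun q => spaceTimeKernelDeriv (kernel ψ) lam ((t, x) - id q) *
            weighted lam F q := fun hF hB =>
        ((h.integrable_spaceTimeKernelDeriv hl).comp_sub_left (t, x)).mul_bdd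
          (measurable_weighted hF).aestronglyMeasurable (ae_of_all _ (abs_weighted_le hl.le hB))
      have hi1 := hi (F := fun q => f (U q)) (hfm.comp hU) hBu
      have hi2 := hi (F := fun q => f (V q)) (hfm.comp hV) hBv
      have hk1 : Integrable fun y => kernel ψ t (x - y) * u₀ y :=
        ((h.integrable_kernel ht).comp_sub_left x).mul_bdd hu₀.1 hCu
      have hk2 : Integrable fun y => kernel ψ t (x - y) * v₀ y :=
        ((h.integrable_kernel ht).comp_sub_left x).mul_bdd hv₀.1 hCv
      have e1 : shiftOp (spaceTimeKernelDeriv (kernel ψ) lam) id volume (g * W) (t, x) =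
          shiftOp (spaceTimeKernelDeriv (kernel ψ) lam) id volume
            (weighted lam fun q => f (U q)) (t, x) -
          shiftOp (spaceTimeKernelDeriv (kernel ψ) lam) id volume
            (weighted lam fun q => f (V q)) (t, x) := by
        rw [hgW, shiftOp, shiftOp, shiftOp, ← integral_sub hi1 hi2]
        simp only [Pi.sub_apply, mul_sub]
      have e2 : shiftOp (spaceTimeKernel (kernel ψ) lam) initialSlice volume
          (fun x => u₀ x - v₀ x) (t, x) = Real.exp (-(lam * t)) *
          ((∫ y : ℝ, kernel ψ t (x - y) * u₀ y) - ∫ y : ℝ, kernel ψ t (x - y) * v₀ y) := by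
        rw [← integral_sub hk1 hk2, shiftOp, ← integral_const_mul]
        congr 1
        ext y
        simp only [spaceTimeKernel, initialSlice, Prod.mk_sub_mk, sub_zero, ht, if_true]
        ring
      have e3 : W (t, x) = Real.exp (-(lam * t)) * (U (t, x) - V (t, x)) := by
        simp only [W, weighted, ht, if_true]
      have e4 : Real.exp (-(lam * t)) * Real.exp (lam * t) = 1 := by
        rw [← Real.exp_add, neg_add_cancel, Real.exp_zero]
      simp only at h1 h2 h3 h4
      rw [e3, e1, e2, ← h3 ht, ← h4 ht, h1 ht, h2 ht, hdu, hdv]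
      set Su := shiftOp (spaceTimeKernelDeriv (kernel ψ) lam) id volume
            (weighted lam fun q => f (U q)) (t, x)
      set Sv := shiftOp (spaceTimeKernelDeriv (kernel ψ) lam) id volume
            (weighted lam fun q => f (V q)) (t, x)
      linear_combination (Sv - Su) * e4
    -- For `t ≤ 0` both sides vanish by causality: the kernels live on positive elapsed times and
    -- `W` on positive times.
    · have e1 : shiftOp (spaceTimeKernelDeriv (kernel ψ) lam) id volume (g * W) (t, x) = 0 := by
        refine integral_eq_zero_of_ae (ae_of_all _ fun q => ?_)
        obtain ⟨s, y⟩ := q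
        simp only [spaceTimeKernelDeriv, W, weighted, id, Prod.mk_sub_mk, Pi.mul_apply,
          Pi.zero_apply]
        by_cases hs : 0 < s
        · rw [if_neg (by linarith), zero_mul]
        · rw [if_neg hs, mul_zero, mul_zero]
      have e2 : shiftOp (spaceTimeKernel (kernel ψ) lam) initialSlice volume
          (fun x => u₀ x - v₀ x) (t, x) = 0 := by
        refine integral_eq_zero_of_ae (ae_of_all _ fun y => ?_)
        simp only [spaceTimeKernel, initialSlice, Prod.mk_sub_mk, sub_zero, Pi.zero_apply]
        rw [if_neg ht, zero_mul]
      rw [e1, e2, sub_zero]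
      simp only [W, weighted]
      rw [if_neg ht]
  have key := h.ae_lintegral_slice_le hl hg hgL hsmall h₀ hWm.aestronglyMeasurable
    (ae_of_all _ hWM) hfix
  filter_upwards [key] with t ht1 ht
  have e5 : ∀ x, ‖W (t, x)‖ₑ = ENNReal.ofReal (Real.exp (-(lam * t))) * ‖U (t, x) - V (t, x)‖ₑ :=
    fun x => by
      simp only [W, weighted, ht, if_true]
      rw [enorm_mul, Real.enorm_of_nonneg (Real.exp_nonneg _)]
  simp_rw [e5] at ht1
  rw [lintegral_const_mul' _ _ ENNReal.ofReal_ne_top, expWeight,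
    indicator_of_mem (mem_Ioi.2 ht)] at ht1
  exact (ENNReal.mul_le_mul_iff_right (by simpa using Real.exp_pos _) ENNReal.ofReal_ne_top).1 ht1

/-- Time-uniform bounds extend from almost every time to every time for continuous functions. -/
lemma lintegral_enorm_le_of_ae {D : ℝ → ℝ → ℝ} {N : ENNReal}
    (hD : ContinuousOn (fun p : ℝ × ℝ => D p.1 p.2) (Ioi (0 : ℝ) ×ˢ (univ : Set ℝ)))
    (hae : ∀ᵐ t : ℝ, 0 < t → ∫⁻ x, ‖D t x‖ₑ ≤ N) {t : ℝ} (ht : 0 < t) : ∫⁻ x, ‖D t x‖ₑ ≤ N := by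
  -- A set of full measure is dense, so every `t > 0` is a limit of good times, and Fatou's lemma
  -- applies along such a sequence.
  have hdense := Measure.dense_of_ae hae
  obtain ⟨τ, hτ, hlim⟩ := mem_closure_iff_seq_limit.1 (hdense t)
  obtain ⟨n₀, hn₀⟩ := eventually_atTop.1 (hlim.eventually_const_lt ht)
  have hlim' : Tendsto (fun n => τ (n + n₀)) atTop (𝓝 t) := hlim.comp (tendsto_add_atTop_nat n₀)
  have hpos : ∀ n, 0 < τ (n + n₀) := fun n => hn₀ _ (by lia)
  have hcont : ∀ s, 0 < s → Continuous (D s) := fun s hs => by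
    refine continuousOn_univ.1 (hD.comp (f := fun x : ℝ => (s, x)) (by fun_prop) ?_)
    exact fun x _ => ⟨hs, mem_univ _⟩
  have hptw : ∀ x, Tendsto (fun n => D (τ (n + n₀)) x) atTop (𝓝 (D t x)) := fun x => by
    have h1 : ContinuousAt (fun p : ℝ × ℝ => D p.1 p.2) (t, x) :=
      hD.continuousAt ((isOpen_Ioi.prod isOpen_univ).mem_nhds ⟨ht, mem_univ _⟩)
    exact h1.tendsto.comp (hlim'.prodMk_nhds tendsto_const_nhds)
  calc ∫⁻ x, ‖D t x‖ₑ = ∫⁻ x, liminf (fun n => ‖D (τ (n + n₀)) x‖ₑ) atTop :=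
        lintegral_congr fun x => ((hptw x).enorm.liminf_eq).symm
    _ ≤ liminf (fun n => ∫⁻ x, ‖D (τ (n + n₀)) x‖ₑ) atTop :=
        lintegral_liminf_le fun n => (hcont _ (hpos n)).measurable.enorm
    _ ≤ N := by
        refine (liminf_le_liminf (Eventually.of_forall fun n => hτ (n + n₀) (hpos n))).trans ?_
        rw [liminf_const]

end NonlocalConservationLaw

end

/-! ### Assembly of the theorem. -/

open NonlocalConservationLaw in
theorem mainTheorem2
    (ψ : ℝ → ℂ)
    (hψ : (∃ α : ℝ, 0 < α ∧ α < 1 ∧ ψ = NonlocalConservationLaw.caputoSymbol α) ∨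
      (∃ β γ : ℝ, 1 < β ∧ β ≤ 2 ∧ |γ| ≤ min β (2 - β) ∧
        ψ = NonlocalConservationLaw.rieszFellerSymbol β γ))
    (ε : ℝ) (hε : 0 < ε)
    (f : ℝ → ℝ) (hf : ContDiff ℝ ∞ f)
    (u₀ v₀ : ℝ → ℝ) (hu₀ : MemLp u₀ ⊤ volume) (hv₀ : MemLp v₀ ⊤ volume)
    (h₀ : Integrable (fun x : ℝ => u₀ x - v₀ x) volume)
    (u v : ℝ → ℝ → ℝ)
    (hu : NonlocalConservationLaw.IsMildSolution (fun ξ => (ε : ℂ) * ψ ξ) f u₀ u)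
    (hv : NonlocalConservationLaw.IsMildSolution (fun ξ => (ε : ℂ) * ψ ξ) f v₀ v) :
    (∃ U V : ℝ → ℝ → ℝ,
      NonlocalConservationLaw.IsContinuousRepresentative U u ∧
      NonlocalConservationLaw.IsContinuousRepresentative V v ∧
      ∀ t : ℝ, 0 < t →
        Integrable (fun x : ℝ => U t x - V t x) volume ∧
        ∫ x : ℝ, |U t x - V t x| ≤ ∫ x : ℝ, |u₀ x - v₀ x|) ∧
    ((∀ᵐ x : ℝ, u₀ x = v₀ x) →
      ∀ᵐ p : ℝ × ℝ ∂NonlocalConservationLaw.halfPlaneMeasure, u p.1 p.2 = v p.1 p.2) := by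
  obtain ⟨θ, h⟩ := exists_isStableKernel hψ hε
  have hf1 : ContDiff ℝ 1 f := hf.of_le (by exact_mod_cast le_top)
  obtain ⟨Mu, uR, huRm, hMu, huR⟩ := exists_measurable_bounded_representative hu.memLp_top
  obtain ⟨Mv, vR, hvRm, hMv, hvR⟩ := exists_measurable_bounded_representative hv.memLp_top
  have hcontr := ae_contraction h hf1 hu₀ hv₀ h₀ hu hv huRm hvRm
    (fun q => (hMu q).trans (le_max_left Mu Mv)) (fun q => (hMv q).trans (le_max_right Mu Mv))
    huR hvR
  obtain ⟨Bu, hBu⟩ := exists_bound_comp hf.continuous hMu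
  obtain ⟨Bv, hBv⟩ := exists_bound_comp hf.continuous hMv
  constructor
  · have hUc := continuousOn_duhamel h hf.continuous hu₀ huR huRm hBu
    have hVc := continuousOn_duhamel h hf.continuous hv₀ hvR hvRm hBv
    -- The right-hand sides of Duhamel's formula are the representatives: continuous, and almost
    -- everywhere equal to `u` and `v`.
    refine ⟨duhamel (fun ξ => (ε : ℂ) * ψ ξ) f u₀ u, duhamel (fun ξ => (ε : ℂ) * ψ ξ) f v₀ v,
      ⟨hUc, hu.duhamel_eq.mono fun p hp => hp.symm⟩,
      ⟨hVc, hv.duhamel_eq.mono fun p hp => hp.symm⟩, fun t ht => ?_⟩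
    set U := duhamel (fun ξ => (ε : ℂ) * ψ ξ) f u₀ u
    set V := duhamel (fun ξ => (ε : ℂ) * ψ ξ) f v₀ v
    have hDc : ContinuousOn (fun p : ℝ × ℝ => U p.1 p.2 - V p.1 p.2)
        (Ioi (0 : ℝ) ×ˢ (univ : Set ℝ)) := hUc.sub hVc
    have hae : ∀ᵐ p : ℝ × ℝ, 0 < p.1 → U p.1 p.2 - V p.1 p.2 = uR p - vR p := by
      filter_upwards [ae_halfPlaneMeasure_iff.1 hu.duhamel_eq,
        ae_halfPlaneMeasure_iff.1 hv.duhamel_eq, huR, hvR] with p h1 h2 h3 h4 hp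
      rw [← h3 hp, ← h4 hp, h1 hp, h2 hp]
    rw [Measure.volume_eq_prod] at hae
    have hslice : ∀ᵐ t : ℝ, 0 < t → ∫⁻ x, ‖U t x - V t x‖ₑ ≤ ∫⁻ x, ‖u₀ x - v₀ x‖ₑ := by
      filter_upwards [hcontr, Measure.ae_ae_of_ae_prod hae] with s h1 h2 hs
      refine le_trans (le_of_eq (lintegral_congr_ae ?_)) (h1 hs)
      filter_upwards [h2] with x hx
      rw [hx hs]
    have hle := lintegral_enorm_le_of_ae (D := fun t x => U t x - V t x) hDc hslice ht
    have hcont : Continuous fun x => U t x - V t x :=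
      continuousOn_univ.1 (hDc.comp (f := fun x : ℝ => (t, x)) (by fun_prop)
        fun x _ => ⟨ht, mem_univ _⟩)
    have hInt : Integrable fun x => U t x - V t x :=
      ⟨hcont.aestronglyMeasurable, hle.trans_lt h₀.2⟩
    refine ⟨hInt, ?_⟩
    rw [← ofReal_integral_norm_eq_lintegral_enorm hInt,
      ← ofReal_integral_norm_eq_lintegral_enorm h₀] at hle
    exact (ENNReal.ofReal_le_ofReal_iff (integral_nonneg fun _ => norm_nonneg _)).1 hle
  · intro heq
    have hN : ∫⁻ x, ‖u₀ x - v₀ x‖ₑ = 0 := by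
      rw [lintegral_congr_ae (g := fun _ => 0)]
      · simp
      · filter_upwards [heq] with x hx
        simp [hx]
    -- Uniqueness is read off the estimate at almost every time; passing from slices to the
    -- half-plane requires a measurable set, hence the measurable representatives.
    have hzero : ∀ᵐ p : ℝ × ℝ, 0 < p.1 → uR p = vR p := by
      rw [Measure.volume_eq_prod, Measure.ae_prod_iff_ae_ae]
      · filter_upwards [hcontr] with t ht
        by_cases ht0 : 0 < t
        · have h1 := ht ht0
          rw [hN, nonpos_iff_eq_zero, lintegral_eq_zero_iff (by fun_prop)] at h1
          filter_upwards [h1] with x hx _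
          simpa [sub_eq_zero] using hx
        · exact ae_of_all _ fun x hx => absurd hx ht0
      · have : {x : ℝ × ℝ | 0 < x.1 → uR x = vR x} = {x | 0 < x.1}ᶜ ∪ {x | uR x = vR x} := by
          ext x
          simp [imp_iff_not_or]
        rw [this]
        exact (measurableSet_lt measurable_const measurable_fst).compl.union
          (measurableSet_eq_fun huRm hvRm)
    rw [ae_halfPlaneMeasure_iff]
    filter_upwards [hzero, huR, hvR] with p h1 h2 h3 hp
    rw [h2 hp, h3 hp, h1 hp]
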